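/- Units $c=m=\hbar=1$; $x=|\mathbf x|$, $k=|\mathbf k|$, $E_k=\sqrt{1+k^2}$. Let $\alpha_l=\begin{pmatrix}0&\sigma_l\\ \sigma_l&0\end{pmatrix}$, $l=1,2,3$, and $\beta=\mathrm{diag}(1,1,-1,-1)$ be the Dirac matrices, with $\sigma_1=\mathrm{diag}(1,-1)$, $\sigma_2=\begin{pmatrix}0&1\\1&0\end{pmatrix}$, $\sigma_3=\begin{pmatrix}0&-i\\i&0\end{pmatrix}$, and let $$G_{E_k}^+(\mathbf x)=\frac{e^{ikx}}{4\pi}\Big(-x^{-1}\big(E_k+k\,\boldsymbol\alpha\cdot\tfrac{\mathbf x}{x}+\beta\big)-ix^{-2}\,\boldsymbol\alpha\cdot\tfrac{\mathbf x}{x}\Big)$$ be the outgoing Green's function of the free Dirac operator at energy $E_k$. A potential is a function $V\in L^1\cap L^\infty$ on $\mathbb R^3$ with values in the Hermitian $4\times4$ matrices (in particular, any four-potential $V=V_0+\sum_l\alpha_lV_l$ in $L^1\cap L^\infty$). Put $T^V_{E_k}f(\mathbf x)=\int G^+_{E_k}(\mathbf x-\mathbf y)V(\mathbf y)f(\mathbf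 y)\,d^3y$ and $\langle f,V,g\rangle=\int f^\dagger Vg\,d^3x$. Let $\mathcal B$ be the space of functions in $L^\infty(\mathbb R^3;\mathbb C^4)$ tending to $0$ at infinity, $\mathcal N=\{\Phi\in\mathcal B:(1-T^A_1)\Phi=0\}$, and $\mathcal M^\perp=\{h\in\mathcal B:\langle h,A,\Phi\rangle=0\ \forall\Phi\in\mathcal N\}$. The class $\mathcal C$ consists of the potentials $A$ such that: (a) $A$ is critical, i.e. $\mathcal N\neq\{0\}$, and $A$ is Lipschitz continuous; (b) $(1+x)^2A\in L^1\cap L^\infty$; (c) $\mathcal N\cap\mathcal M^\perp=\{0\}$; (d) $\mathcal N\subset L^2$ or $\mathcal N\cap L^2=\{0\}$; (e) for every $0\ne\Phi\in\mathcal N$, $\int A\Phi\,d^3x\neq0$ or $(1-i\beta)\int A\Phi\,\mathbf x\,d^3x\ne0$. We say $\overline\lambda=1$ if $\lambda(\Phi):=\int(1+\beta)A\Phi\,d^3y\neq0$ for all $0\ne\Phi\in\mathcal N$ (the resonance case). For $K>0$ let $\mathcal W_K$ be the set of potentials $B$ with $\|\Phi\|_\infty^2(\|B\|_1+\|B\|_\infty)^2\le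 K|\langle\Phi,B,\Phi\rangle|$ for all $\Phi\in\mathcal N$. For $j=1,2$ let $\chi(j,\mathbf k,\mathbf x)=e^{i\mathbf k\cdot\mathbf x}\,\dfrac{(1+E_k)e_j+\boldsymbol\alpha\cdot\mathbf k\,e_j}{\sqrt{2E_k(1+E_k)}}$ be the normalized free generalized eigenfunctions of energy $E_k$, where $e_1,e_2$ are the first two standard basis vectors of $\mathbb C^4$. **Theorem 6.2.** Let $A\in\mathcal C$ be compactly supported with $\overline\lambda=1$. There are constants $K,k_0>0$ such that for every $R$ there are constants $C_m<\infty$ $(m\in\mathbb N_0)$ with the following property. Let $B\in\mathcal W_K$ vanish outside the ball of radius $R$ about $0$, and let $j\in\{1,2\}$. Then for every $\mathbf k\in\mathbb R^3$ with $0<k<k_0$ the equation $$(1-T^{A+B}_{E_k})\,\phi(A+B,j,\mathbf k,\cdot)=\chi(j,\mathbf k,\cdot)$$ has exactly one solution $\phi(A+B,j,\mathbf k,\cdot)\in L^\infty$; for every $\mathbf x$ it depends smoothly on $k\in(0,k_0)$ at fixed direction $\mathbf k/k$, and, with $\partial_k$ denoting the derivative in $k=|\mathbf k|$ at fixed direction,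 for every $m\in\mathbb N_0$ and every $\mathbf k$ with $0<k<k_0$ $$\big\|(1+x)^{-m}\,\partial_k^m\phi(A+B,j,\mathbf k,\cdot)\big\|_\infty\le C_m\big(k^{-m}+\alpha^{m+1}\big),\qquad \alpha=1+\Big(\inf_{\Phi\in\mathcal N,\ \|\Phi\|_\infty=1}|\langle\Phi,B,\Phi\rangle|+k\Big)^{-1}.$$ -/

import Mathlib

open MeasureTheory Set Filter Topology
open scoped ContDiff NNReal

noncomputable section

namespace DiracScattering

/-- Position and momentum space `ℝ³`. -/
abbrev E3 : Type := EuclideanSpace ℝ (Fin 3)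

/-- The spinor space `ℂ⁴` with its Euclidean norm. -/
abbrev Spinor : Type := EuclideanSpace ℂ (Fin 4)

/-- Matrices acting on spinors, with the operator norm. -/
abbrev SpinorOp : Type := Spinor →L[ℂ] Spinor

/-- The Dirac matrices `α₁, α₂, α₃`, with off-diagonal blocks the Pauli matrices
`σ₁ = diag(1,-1)`, `σ₂ = ((0,1),(1,0))`, `σ₃ = ((0,-i),(i,0))`. -/
def alphaMatrix : Fin 3 → Matrix (Fin 4) (Fin 4) ℂ :=
  ![!![0, 0, 1, 0; 0, 0, 0, -1; 1, 0, 0, 0; 0, -1, 0, 0],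
    !![0, 0, 0, 1; 0, 0, 1, 0; 0, 1, 0, 0; 1, 0, 0, 0],
    !![0, 0, 0, -Complex.I; 0, 0, Complex.I, 0; 0, -Complex.I, 0, 0; Complex.I, 0, 0, 0]]

/-- The Dirac matrix `β = diag(1,1,-1,-1)`. -/
def betaMatrix : Matrix (Fin 4) (Fin 4) ℂ :=
  Matrix.diagonal ![1, 1, -1, -1]

def alphaOp (l : Fin 3) : SpinorOp := Matrix.toEuclideanCLM (𝕜 := ℂ) (alphaMatrix l)

def betaOp : SpinorOp := Matrix.toEuclideanCLM (𝕜 := ℂ) betaMatrix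

/-- `α · v = ∑ₗ vₗ αₗ`. -/
def alphaDot (v : E3) : SpinorOp := ∑ l, ((v l : ℝ) : ℂ) • alphaOp l

/-- The energy `E_k = √(1 + k²)`. -/
def energy (k : ℝ) : ℝ := Real.sqrt (1 + k ^ 2)

/-- The outgoing Green's function `G⁺_E` of the free Dirac operator, i.e. the kernel of
`lim_{δ↓0} (E - D⁰ + iδ)⁻¹`, at the energy `E = E_k`, `k ≥ 0`:
`(4π)⁻¹ e^{ikx} ( -x⁻¹ (E_k + k α·x/|x| + β) - i x⁻² α·x/|x| )` where `x` also denotes `|x|`. -/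
def green (k : ℝ) (x : E3) : SpinorOp :=
  ((4 * Real.pi : ℝ) : ℂ)⁻¹ • Complex.exp (Complex.I * ((k * ‖x‖ : ℝ) : ℂ)) •
    (-((((‖x‖⁻¹ : ℝ) : ℂ)) • (((energy k : ℝ) : ℂ) • ContinuousLinearMap.id ℂ Spinor
          + ((k : ℝ) : ℂ) • alphaDot (‖x‖⁻¹ • x) + betaOp))
      - (Complex.I * ((‖x‖⁻¹ ^ 2 : ℝ) : ℂ)) • alphaDot (‖x‖⁻¹ • x))

/-- The operator `T^V_{E_k}`: `(T f)(x) = ∫ G⁺_{E_k}(x - y) V(y) f(y) d³y`. -/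
def opT (V : E3 → SpinorOp) (k : ℝ) (f : E3 → Spinor) (x : E3) : Spinor :=
  ∫ y, green k (x - y) (V y (f y))

/-- Potentials: Hermitian matrix valued functions in `L¹ ∩ L^∞`. -/
def IsPotential (V : E3 → SpinorOp) : Prop :=
  (∀ x, IsSelfAdjoint (V x)) ∧ MemLp V 1 volume ∧ MemLp V ⊤ volume

/-- The `L^∞`-norm (of spinor or matrix valued functions). -/
def normInf {F : Type*} [NormedAddCommGroup F] (f : E3 → F) : ℝ :=
  (eLpNorm f ⊤ volume).toReal

/-- The `L¹`-norm (of spinor or matrix valued functions). -/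
def normOne {F : Type*} [NormedAddCommGroup F] (f : E3 → F) : ℝ :=
  (eLpNorm f 1 volume).toReal

/-- The space `𝓑` of bounded functions tending to zero at infinity. -/
def spaceB : Set (E3 → Spinor) :=
  {f | MemLp f ⊤ volume ∧ Tendsto f (cocompact E3) (𝓝 0)}

/-- `⟨f, V, g⟩ = ∫ f† V g d³x`. -/
def pairing (f : E3 → Spinor) (V : E3 → SpinorOp) (g : E3 → Spinor) : ℂ :=
  ∫ x, inner ℂ (f x) (V x (g x))

/-- `𝓝 = {Φ ∈ 𝓑 : (1 - T^A_1) Φ = 0}`; energy `1` is `k = 0`. -/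
def spaceN (A : E3 → SpinorOp) : Set (E3 → Spinor) :=
  {Φ | Φ ∈ spaceB ∧ ∀ x, Φ x = opT A 0 Φ x}

/-- `A` is critical if there are nontrivial solutions of `(1 - T^A_1) Φ = 0`. -/
def IsCritical (A : E3 → SpinorOp) : Prop := ∃ Φ ∈ spaceN A, Φ ≠ 0

/-- `𝓜^⊥ = {h ∈ 𝓑 : ⟨h, A, Φ⟩ = 0 for all Φ ∈ 𝓝}`. -/
def spaceMperp (A : E3 → SpinorOp) : Set (E3 → Spinor) :=
  {h | h ∈ spaceB ∧ ∀ Φ ∈ spaceN A, pairing h A Φ = 0}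

/-- `λ(Φ) = ∫ (1 + β) A(y) Φ(y) d³y`. -/
def lam (A : E3 → SpinorOp) (Φ : E3 → Spinor) : Spinor :=
  ∫ y, (ContinuousLinearMap.id ℂ Spinor + betaOp) (A y (Φ y))

/-- `λ̄ = 1`: `λ(Φ) ≠ 0` for every nonzero `Φ ∈ 𝓝`. -/
def LamBarOne (A : E3 → SpinorOp) : Prop := ∀ Φ ∈ spaceN A, Φ ≠ 0 → lam A Φ ≠ 0

/-- The class `𝓒` of critical potentials. -/
structure ClassC (A : E3 → SpinorOp) : Prop where
  potential : IsPotential A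
  critical : IsCritical A
  lipschitz : ∃ L : ℝ≥0, LipschitzWith L A
  decay_one : MemLp (fun x => ((1 + ‖x‖) ^ 2 : ℝ) • A x) 1 volume
  decay_top : MemLp (fun x => ((1 + ‖x‖) ^ 2 : ℝ) • A x) ⊤ volume
  inter_Mperp : spaceN A ∩ spaceMperp A = {0}
  dichotomy : (∀ Φ ∈ spaceN A, MemLp Φ 2 volume) ∨
    (∀ Φ ∈ spaceN A, MemLp Φ 2 volume → Φ = 0)
  nondegenerate : ∀ Φ ∈ spaceN A, Φ ≠ 0 →
    (∫ x, A x (Φ x)) ≠ 0 ∨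
    ∃ l : Fin 3, (ContinuousLinearMap.id ℂ Spinor - Complex.I • betaOp)
      (∫ x, ((x l : ℝ) : ℂ) • A x (Φ x)) ≠ 0

/-- The set `𝓦_K` of admissible perturbations of `A`, with the defining inequality
`‖Φ‖²_∞ (‖B‖₁ + ‖B‖_∞)² / |⟨Φ, B, Φ⟩| ≤ K` multiplied out. -/
def setW (A : E3 → SpinorOp) (K : ℝ) : Set (E3 → SpinorOp) :=
  {B | IsPotential B ∧ ∀ Φ ∈ spaceN A,
    normInf Φ ^ 2 * (normOne B + normInf B) ^ 2 ≤ K * ‖pairing Φ B Φ‖}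

/-- The normalized free spinor of momentum `k`, positive energy and spin index `j`:
`((1 + E_k) e_j + α·k e_j) / √(2 E_k (1 + E_k))`, with `e_j` the first two standard basis
vectors of `ℂ⁴`. It is a unit eigenvector of `α·k + β` with eigenvalue `E_k`. -/
def freeSpinor (j : Fin 2) (k : E3) : Spinor :=
  ((Real.sqrt (2 * energy ‖k‖ * (1 + energy ‖k‖)) : ℝ) : ℂ)⁻¹ •
    (((1 + energy ‖k‖ : ℝ) : ℂ) • EuclideanSpace.single (Fin.castLE (by norm_num) j) (1 : ℂ)
      + alphaDot k (EuclideanSpace.single (Fin.castLE (by norm_num) j) (1 : ℂ)))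

/-- The free generalized eigenfunction `χ(j, k, x) = e^{i k·x} u_j(k)`. -/
def chi (j : Fin 2) (k x : E3) : Spinor :=
  Complex.exp (Complex.I * ((inner ℝ k x : ℝ) : ℂ)) • freeSpinor j k

/-- `φ` is an `L^∞`-solution of the Lippmann-Schwinger equation
`(1 - T^V_{E_k}) φ = χ(j, k, ·)`. -/
def IsGenEigenfunction (V : E3 → SpinorOp) (j : Fin 2) (k : E3) (φ : E3 → Spinor) : Prop :=
  MemLp φ ⊤ volume ∧ ∀ x, φ x - opT V ‖k‖ φ x = chi j k x

/-- `1 + (inf_{Φ ∈ 𝓝, ‖Φ‖ = 1} |⟨Φ, B, Φ⟩| + k)⁻¹`. -/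
def alphaOne (A B : E3 → SpinorOp) (k : ℝ) : ℝ :=
  1 + (sInf {t : ℝ | ∃ Φ ∈ spaceN A, normInf Φ = 1 ∧ t = ‖pairing Φ B Φ‖} + k)⁻¹

end DiracScattering

end

noncomputable section

namespace DiracScattering

/-! ### The Dirac matrices -/

/-! The potentials vanish outside a ball, so `opT` sees only the values of a function on that ball,
where it is a compact operator on continuous functions. Everything rests on an a priori bound `‖f‖ ≤
C α ‖(1 - T) f‖` for `T = T^{A+B}_{E_k}` (`exists_apriori_bound`). It must degenerate as `k` and `B`
tend to zero, because `1 - T^A_1` has the kernel `𝓝`.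

To prove it, let `γ` bound the residual `(1 - T) f`. Compactness of `T^A_1` gives `Φ ∈ 𝓝` with `f -
Φ` controlled by `(1 - T^A_1) f` (`exists_zeroEnergy_bounds`), so only `‖Φ‖` must be bounded. Test
with `A Φ`. By the symmetry of the zero energy Green's function, `A Φ` annihilates the range of `1 -
T^A_1` (`integral_inner_sub_opT_eq_zero`), and what survives is the pairing of `A Φ` with `(T -
T^A_1) Φ`. By `norm_integral_inner_expansion_le` this equals `⟨Φ, B, Φ⟩ - i k |λ(Φ)|² / (8π)` up to
`O(k² + k (‖B‖₁ + ‖B‖_∞)) ‖Φ‖²`. The first term is real and the second imaginary, so they cannot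
cancel. In the resonance case `|λ(Φ)|²` is at least a constant times `‖Φ‖²`, so the modulus is at
least a constant times `(inf + k) ‖Φ‖²`, with `inf` the infimum in `α`. The errors of order `k`
times something small are absorbed by the imaginary part; those quadratic in `B` are absorbed by the
real part, which is the purpose of `𝓦_K`. Hence `‖Φ‖ ≤ C γ / (inf + k)`.

The Fredholm alternative turns the bound into invertibility of `1 - T` with inverse of size `C α`
(`isUnit_one_sub_of_apriori`). Since `(S⁻¹)' = -S⁻¹ S' S⁻¹`, each derivative in `k` costs one
further factor `α` (`exists_derivBound_ringInverse`), while differentiating the phases `e^{ik|x-y|}`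
and `e^{i𝐤·x}` costs a factor `1 + |x|`. Applied to `φ = χ + T (1 - T)⁻¹ χ`, this gives the
derivative bounds (`exists_derivBound_resolvent`). -/

lemma betaOp_isSelfAdjoint : IsSelfAdjoint betaOp := by
  rw [betaOp, IsSelfAdjoint, ← map_star]
  congr 1
  ext i j
  fin_cases i <;> fin_cases j <;> simp [betaMatrix, Matrix.diagonal]

lemma alphaOp_isSelfAdjoint (l : Fin 3) : IsSelfAdjoint (alphaOp l) := by
  rw [alphaOp, IsSelfAdjoint, ← map_star]
  congr 1
  ext i j
  fin_cases l <;> fin_cases i <;> fin_cases j <;>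
    simp [alphaMatrix]

lemma betaOp_mul_self : betaOp * betaOp = 1 := by
  rw [betaOp, ← map_mul, ← map_one (Matrix.toEuclideanCLM (𝕜 := ℂ) (n := Fin 4))]
  congr 1
  ext i j
  fin_cases i <;> fin_cases j <;> simp [betaMatrix]

lemma inner_betaOp (u w : Spinor) : inner ℂ u (betaOp w) = inner ℂ (betaOp u) w := by
  have h := betaOp_isSelfAdjoint
  rw [ContinuousLinearMap.isSelfAdjoint_iff'] at h
  conv_rhs => rw [← h]
  rw [ContinuousLinearMap.adjoint_inner_left]

lemma inner_alphaOp (l : Fin 3) (u w : Spinor) :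
    inner ℂ u (alphaOp l w) = inner ℂ (alphaOp l u) w := by
  have h := alphaOp_isSelfAdjoint l
  rw [ContinuousLinearMap.isSelfAdjoint_iff'] at h
  conv_rhs => rw [← h]
  rw [ContinuousLinearMap.adjoint_inner_left]

/-- `β` is a self-adjoint involution, so `(1 + β)² = 2 (1 + β)`. This turns the quadratic form of
the first order term of the Green's function into `|λ(Φ)|²`, with a sign. -/
lemma inner_id_add_betaOp (u : Spinor) :
    inner ℂ u ((ContinuousLinearMap.id ℂ Spinor + betaOp) u) =
      ((‖(ContinuousLinearMap.id ℂ Spinor + betaOp) u‖ ^ 2 / 2 : ℝ) : ℂ) := by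
  have h1 : betaOp (betaOp u) = u := by
    rw [← mul_apply_eq_comp, betaOp_mul_self]; rfl
  have h2 := inner_self_eq_norm_sq_to_K (𝕜 := ℂ) ((ContinuousLinearMap.id ℂ Spinor + betaOp) u)
  have h3 : inner ℂ (betaOp u) (betaOp u) = inner ℂ u u := by
    rw [← inner_betaOp, h1]
  simp only [add_apply, ContinuousLinearMap.id_apply, inner_add_left,
    inner_add_right, h3, inner_betaOp u u] at h2 ⊢
  push_cast
  simp only [Complex.coe_algebraMap] at h2
  rw [← h2]
  ring

lemma alphaDot_neg (v : E3) : alphaDot (-v) = -alphaDot v := by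
  rw [alphaDot, alphaDot, ← Finset.sum_neg_distrib]
  refine Finset.sum_congr rfl fun l _ => ?_
  simp only [PiLp.neg_apply, Complex.ofReal_neg]
  exact neg_smul ((v l : ℝ) : ℂ) (alphaOp l)

lemma alphaDot_smul (r : ℝ) (v : E3) : alphaDot (r • v) = (r : ℂ) • alphaDot v := by
  simp [alphaDot, Finset.smul_sum, smul_smul]

lemma inner_alphaDot (v : E3) (u w : Spinor) :
    inner ℂ u (alphaDot v w) = inner ℂ (alphaDot v u) w := by
  simp only [alphaDot, sum_apply, inner_sum, sum_inner,
    smul_apply, inner_smul_left, inner_smul_right, inner_alphaOp,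
    Complex.conj_ofReal]

/-- A common bound for the norms of the Dirac matrices. -/
def diracConst : ℝ := 1 + ‖betaOp‖ + ∑ l, ‖alphaOp l‖

lemma one_le_diracConst : 1 ≤ diracConst := by
  have h : 0 ≤ ∑ l, ‖alphaOp l‖ := Finset.sum_nonneg fun l _ => norm_nonneg _
  have := norm_nonneg betaOp
  unfold diracConst; linarith

lemma diracConst_pos : 0 < diracConst := zero_lt_one.trans_le one_le_diracConst

lemma norm_betaOp_le : ‖betaOp‖ ≤ diracConst := by
  have h : 0 ≤ ∑ l, ‖alphaOp l‖ := Finset.sum_nonneg fun l _ => norm_nonneg _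
  unfold diracConst; linarith

lemma norm_alphaDot_le (v : E3) : ‖alphaDot v‖ ≤ diracConst * ‖v‖ := by
  have h1 : ‖alphaDot v‖ ≤ ∑ l, ‖alphaOp l‖ * ‖v‖ := by
    refine (norm_sum_le _ _).trans (Finset.sum_le_sum fun l _ => ?_)
    rw [norm_smul, mul_comm, Complex.norm_real]
    exact mul_le_mul_of_nonneg_left (PiLp.norm_apply_le v l) (norm_nonneg _)
  rw [← Finset.sum_mul] at h1
  refine h1.trans (mul_le_mul_of_nonneg_right ?_ (norm_nonneg _))
  have := norm_nonneg betaOp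
  unfold diracConst; linarith

lemma norm_alphaDot_unit_le (z : E3) : ‖alphaDot (‖z‖⁻¹ • z)‖ ≤ diracConst := by
  refine (norm_alphaDot_le _).trans ?_
  have h : ‖‖z‖⁻¹ • z‖ ≤ 1 := by
    rw [norm_smul, norm_inv, norm_norm]
    exact inv_mul_le_one
  have := diracConst_pos
  nlinarith

/-! ### Splitting of the Green's function -/

/-- The coefficient of `E_k` in the Green's function. -/
def kerE (z : E3) : SpinorOp :=
  (((-(4 * Real.pi)⁻¹ * ‖z‖⁻¹ : ℝ)) : ℂ) • ContinuousLinearMap.id ℂ Spinor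

/-- The coefficient of `k` in the Green's function. -/
def kerK (z : E3) : SpinorOp :=
  (((-(4 * Real.pi)⁻¹ * ‖z‖⁻¹ : ℝ)) : ℂ) • alphaDot (‖z‖⁻¹ • z)

/-- The part of the Green's function that carries no explicit factor `E_k` or `k`. -/
def kerC (z : E3) : SpinorOp :=
  (((-(4 * Real.pi)⁻¹ * ‖z‖⁻¹ : ℝ)) : ℂ) • betaOp
    + (Complex.I * ((-(4 * Real.pi)⁻¹ * ‖z‖⁻¹ ^ 2 : ℝ) : ℂ)) • alphaDot (‖z‖⁻¹ • z)

/-- The dependence on `k` is confined to the phase and two scalar factors, so that differentiation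
in `k` never touches the singular coefficients. -/
lemma green_eq (k : ℝ) (z : E3) :
    green k z = Complex.exp (Complex.I * ((k * ‖z‖ : ℝ) : ℂ)) •
      (((energy k : ℝ) : ℂ) • kerE z + ((k : ℝ) : ℂ) • kerK z + kerC z) := by
  unfold green kerE kerK kerC
  push_cast
  module

/-- The singularity of the Green's function. -/
def sing (z : E3) : ℝ := 1 + ‖z‖⁻¹ ^ 2

lemma one_le_sing (z : E3) : 1 ≤ sing z := by
  unfold sing; nlinarith [sq_nonneg (‖z‖⁻¹)]

lemma inv_norm_le_sing (z : E3) : ‖z‖⁻¹ + ‖z‖⁻¹ ^ 2 ≤ 2 * sing z := by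
  unfold sing; nlinarith [sq_nonneg (‖z‖⁻¹ - 1)]

/-- An expansion of the phase produces a factor `|z|`, which destroys the decay of the kernel; the
summand `1` in `sing` makes room for one such factor. -/
lemma norm_mul_inv_le_sing (z : E3) : ‖z‖ * (‖z‖⁻¹ + ‖z‖⁻¹ ^ 2) ≤ 2 * sing z := by
  rcases eq_or_ne (‖z‖) 0 with h | h
  · rw [h]; simp; linarith [one_le_sing z]
  · have : ‖z‖ * (‖z‖⁻¹ + ‖z‖⁻¹ ^ 2) = 1 + ‖z‖⁻¹ := by field_simp
    rw [this]; unfold sing; nlinarith [sq_nonneg (‖z‖⁻¹ - 1)]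

lemma four_pi_inv_le : (4 * Real.pi)⁻¹ ≤ 1 := by
  apply inv_le_one_of_one_le₀; nlinarith [Real.pi_gt_three]

lemma four_pi_inv_pos : 0 < (4 * Real.pi)⁻¹ := by positivity

lemma norm_kerE_le (z : E3) : ‖kerE z‖ ≤ diracConst * (‖z‖⁻¹ + ‖z‖⁻¹ ^ 2) := by
  have h1 : 0 ≤ ‖z‖⁻¹ := by positivity
  have h2 := one_le_diracConst
  have h3 := four_pi_inv_le
  have h4 := four_pi_inv_pos
  unfold kerE
  rw [norm_smul, Complex.norm_real, norm_mul, norm_neg, Real.norm_of_nonneg h4.le,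
    Real.norm_of_nonneg h1]
  have h5 : ‖ContinuousLinearMap.id ℂ Spinor‖ ≤ 1 := ContinuousLinearMap.norm_id_le
  calc (4 * Real.pi)⁻¹ * ‖z‖⁻¹ * ‖ContinuousLinearMap.id ℂ Spinor‖
      ≤ 1 * ‖z‖⁻¹ * 1 := by gcongr
    _ ≤ diracConst * (‖z‖⁻¹ + ‖z‖⁻¹ ^ 2) := by nlinarith [sq_nonneg (‖z‖⁻¹)]

lemma norm_kerK_le (z : E3) : ‖kerK z‖ ≤ diracConst * (‖z‖⁻¹ + ‖z‖⁻¹ ^ 2) := by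
  have h1 : 0 ≤ ‖z‖⁻¹ := by positivity
  have h2 := diracConst_pos
  have h3 := four_pi_inv_le
  have h4 := four_pi_inv_pos
  have h5 := norm_alphaDot_unit_le z
  unfold kerK
  rw [norm_smul, Complex.norm_real, norm_mul, norm_neg, Real.norm_of_nonneg h4.le,
    Real.norm_of_nonneg h1]
  calc (4 * Real.pi)⁻¹ * ‖z‖⁻¹ * ‖alphaDot (‖z‖⁻¹ • z)‖
      ≤ 1 * ‖z‖⁻¹ * diracConst := by gcongr
    _ ≤ diracConst * (‖z‖⁻¹ + ‖z‖⁻¹ ^ 2) := by nlinarith [mul_nonneg h2.le (sq_nonneg (‖z‖⁻¹))]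

lemma norm_kerC_le (z : E3) : ‖kerC z‖ ≤ diracConst * (‖z‖⁻¹ + ‖z‖⁻¹ ^ 2) := by
  have h1 : 0 ≤ ‖z‖⁻¹ := by positivity
  have h3 := four_pi_inv_le
  have h4 := four_pi_inv_pos
  have h5 := norm_alphaDot_unit_le z
  have h6 := norm_betaOp_le
  unfold kerC
  refine (norm_add_le _ _).trans ?_
  rw [norm_smul, norm_smul, norm_mul, Complex.norm_I, one_mul, Complex.norm_real,
    Complex.norm_real, norm_mul, norm_mul, norm_neg, Real.norm_of_nonneg h4.le, norm_pow,
    Real.norm_of_nonneg h1]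
  calc (4 * Real.pi)⁻¹ * ‖z‖⁻¹ * ‖betaOp‖ + (4 * Real.pi)⁻¹ * ‖z‖⁻¹ ^ 2 * ‖alphaDot (‖z‖⁻¹ • z)‖
      ≤ 1 * ‖z‖⁻¹ * diracConst + 1 * ‖z‖⁻¹ ^ 2 * diracConst := by gcongr
    _ = diracConst * (‖z‖⁻¹ + ‖z‖⁻¹ ^ 2) := by ring

lemma norm_le_sing_of {a : E3 → SpinorOp}
    (h : ∀ z, ‖a z‖ ≤ diracConst * (‖z‖⁻¹ + ‖z‖⁻¹ ^ 2)) (z : E3) :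
    ‖a z‖ ≤ 2 * diracConst * sing z := by
  have := mul_le_mul_of_nonneg_left (inv_norm_le_sing z) diracConst_pos.le
  linarith [h z]

lemma norm_mul_le_sing_of {a : E3 → SpinorOp}
    (h : ∀ z, ‖a z‖ ≤ diracConst * (‖z‖⁻¹ + ‖z‖⁻¹ ^ 2)) (z : E3) :
    ‖z‖ * ‖a z‖ ≤ 2 * diracConst * sing z := by
  have h1 := mul_le_mul_of_nonneg_left (norm_mul_inv_le_sing z) diracConst_pos.le
  have h2 := mul_le_mul_of_nonneg_left (h z) (norm_nonneg z)
  linarith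

lemma energy_zero : energy 0 = 1 := by simp [energy]

lemma one_le_energy (k : ℝ) : 1 ≤ energy k :=
  Real.one_le_sqrt.mpr (by nlinarith [sq_nonneg k])

lemma energy_sub_one_le (k : ℝ) : energy k - 1 ≤ k ^ 2 := by
  have : energy k ≤ 1 + k ^ 2 := Real.sqrt_le_iff.mpr ⟨by positivity, by nlinarith [sq_nonneg k]⟩
  linarith

lemma norm_phase (t : ℝ) : ‖Complex.exp (Complex.I * (t : ℂ))‖ = 1 := by
  rw [mul_comm]; exact Complex.norm_exp_ofReal_mul_I t

lemma norm_phase_sub_one_le (t : ℝ) : ‖Complex.exp (Complex.I * (t : ℂ)) - 1‖ ≤ |t| :=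
  Real.norm_exp_I_mul_ofReal_sub_one_le

/-- Needed for all real `t`, since `k|z|` is not small. Taylor's formula serves for `|t| ≤ 1`;
beyond that the trivial bound `2|t| ≤ 2t²` does. -/
lemma norm_phase_sub_one_sub_le (t : ℝ) :
    ‖Complex.exp (Complex.I * (t : ℂ)) - 1 - Complex.I * (t : ℂ)‖ ≤ 2 * t ^ 2 := by
  have hn : ‖Complex.I * (t : ℂ)‖ = |t| := by simp
  rcases le_or_gt |t| 1 with h | h
  · have := Complex.norm_exp_sub_one_sub_id_le (x := Complex.I * (t : ℂ)) (by rwa [hn])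
    rw [hn, sq_abs] at this
    nlinarith [sq_nonneg t]
  · have := norm_sub_le (Complex.exp (Complex.I * (t : ℂ)) - 1) (Complex.I * (t : ℂ))
    rw [hn] at this
    have h2 := norm_phase_sub_one_le t
    rw [← sq_abs]
    nlinarith

lemma norm_real_smul_le {F : Type*} [NormedAddCommGroup F] [NormedSpace ℂ F] {c C : ℝ} {v : F}
    {M : ℝ} (hc : |c| ≤ C) (hv : ‖v‖ ≤ M) (hC : 0 ≤ C) : ‖(c : ℂ) • v‖ ≤ C * M := by
  rw [norm_smul, Complex.norm_real, Real.norm_eq_abs]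
  exact mul_le_mul hc hv (norm_nonneg _) hC

lemma norm_green_le {k : ℝ} (hk : 0 ≤ k) (hk1 : k ≤ 1) (z : E3) :
    ‖green k z‖ ≤ 8 * diracConst * sing z := by
  rw [green_eq, norm_smul, norm_phase, one_mul]
  have h1 := one_le_energy k
  have h2 := energy_sub_one_le k
  have hE : |energy k| ≤ 2 := by rw [abs_of_nonneg (by linarith)]; nlinarith
  have hK : |k| ≤ 1 := by rw [abs_of_nonneg hk]; exact hk1
  have e1 := norm_real_smul_le hE (norm_le_sing_of norm_kerE_le z) (by norm_num)
  have e2 := norm_real_smul_le hK (norm_le_sing_of norm_kerK_le z) (by norm_num)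
  have e3 := norm_le_sing_of norm_kerC_le z
  have := norm_add₃_le (a := ((energy k : ℝ) : ℂ) • kerE z) (b := ((k : ℝ) : ℂ) • kerK z)
    (c := kerC z)
  linarith

lemma norm_green_zero_le (z : E3) :
    ‖green 0 z‖ ≤ 2 * diracConst * (‖z‖⁻¹ + ‖z‖⁻¹ ^ 2) := by
  rw [green_eq, norm_smul, norm_phase, one_mul, energy_zero]
  rw [Complex.ofReal_one, one_smul, Complex.ofReal_zero, zero_smul ℂ (kerK z), add_zero]
  refine (norm_add_le _ _).trans ?_
  linarith [norm_kerE_le z, norm_kerC_le z]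

/-- The phase difference costs `k|z|`, which the `|z|⁻¹` decay of the kernels compensates. Hence the
error is linear in `k` without growth in `z`. -/
lemma norm_green_sub_le {k : ℝ} (hk : 0 ≤ k) (hk1 : k ≤ 1) (z : E3) :
    ‖green k z - green 0 z‖ ≤ 16 * diracConst * k * sing z := by
  have hs := one_le_sing z
  have h1 := one_le_energy k
  have h2 := energy_sub_one_le k
  have hc := diracConst_pos
  have hE : |energy k| ≤ 2 := by rw [abs_of_nonneg (by linarith)]; nlinarith
  have hE1 : |energy k - 1| ≤ k := by rw [abs_of_nonneg (by linarith)]; nlinarith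
  have hK : |k| ≤ 1 := by rw [abs_of_nonneg hk]; exact hk1
  have hK' : |k| ≤ k := (abs_of_nonneg hk).le
  have key : green k z - green 0 z =
      (Complex.exp (Complex.I * ((k * ‖z‖ : ℝ) : ℂ)) - 1) •
        (((energy k : ℝ) : ℂ) • kerE z + ((k : ℝ) : ℂ) • kerK z + kerC z)
      + (((energy k - 1 : ℝ) : ℂ) • kerE z + ((k : ℝ) : ℂ) • kerK z) := by
    rw [green_eq, green_eq, energy_zero]
    simp only [zero_mul, Complex.ofReal_zero, mul_zero, Complex.exp_zero]
    push_cast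
    module
  rw [key]
  refine (norm_add_le _ _).trans ?_
  have hA : ‖(Complex.exp (Complex.I * ((k * ‖z‖ : ℝ) : ℂ)) - 1) •
        (((energy k : ℝ) : ℂ) • kerE z + ((k : ℝ) : ℂ) • kerK z + kerC z)‖
      ≤ 8 * diracConst * k * sing z := by
    rw [norm_smul]
    have hp := norm_phase_sub_one_le (k * ‖z‖)
    rw [abs_of_nonneg (by positivity)] at hp
    have e1 := norm_real_smul_le (v := kerE z) hE le_rfl (by norm_num)
    have e2 := norm_real_smul_le (v := kerK z) hK le_rfl (by norm_num)
    have h3 := norm_add₃_le (a := ((energy k : ℝ) : ℂ) • kerE z) (b := ((k : ℝ) : ℂ) • kerK z)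
      (c := kerC z)
    have h4 := norm_mul_le_sing_of norm_kerE_le z
    have h5 := norm_mul_le_sing_of norm_kerK_le z
    have h6 := norm_mul_le_sing_of norm_kerC_le z
    calc _ ≤ (k * ‖z‖) * (2 * ‖kerE z‖ + 1 * ‖kerK z‖ + ‖kerC z‖) := by
          gcongr; linarith
      _ = k * (2 * (‖z‖ * ‖kerE z‖) + ‖z‖ * ‖kerK z‖ + ‖z‖ * ‖kerC z‖) := by ring
      _ ≤ k * (2 * (2 * diracConst * sing z) + 2 * diracConst * sing z
            + 2 * diracConst * sing z) := by gcongr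
      _ = _ := by ring
  have e1 := norm_real_smul_le hE1 (norm_le_sing_of norm_kerE_le z) hk
  have e2 := norm_real_smul_le hK' (norm_le_sing_of norm_kerK_le z) hk
  have h3 := norm_add_le (((energy k - 1 : ℝ) : ℂ) • kerE z) (((k : ℝ) : ℂ) • kerK z)
  have : 0 ≤ diracConst * k * sing z := by positivity
  nlinarith

/-- The derivative of the Green's function in `k` at `k = 0`, a constant matrix. -/
def greenDeriv : SpinorOp :=
  (-Complex.I * (((4 * Real.pi)⁻¹ : ℝ) : ℂ)) • (ContinuousLinearMap.id ℂ Spinor + betaOp)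

/-- At second order one power of `|z|` is no longer compensated, whence the factor `1 + |z|`. The
origin is excluded because there the convention `0⁻¹ = 0` makes the Green's function vanish but not
its linear term. -/
lemma norm_green_taylor_le {k : ℝ} (hk : 0 ≤ k) {z : E3} (hz : z ≠ 0) :
    ‖green k z - green 0 z - (k : ℂ) • greenDeriv‖ ≤
      12 * diracConst * k ^ 2 * ((1 + ‖z‖) * sing z) := by
  have hs := one_le_sing z
  have h1 := one_le_energy k
  have h2 := energy_sub_one_le k
  have hc := diracConst_pos
  have hE1 : |energy k - 1| ≤ k ^ 2 := by rw [abs_of_nonneg (by linarith)]; exact h2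
  have hK' : |k| ≤ k := (abs_of_nonneg hk).le
  have hz0 : (‖z‖ : ℂ) ≠ 0 := by exact_mod_cast norm_ne_zero_iff.mpr hz
  -- The factor `|z|` cancels `|z|⁻¹` in the terms with `1` and `β`, and `i² = -1` makes the
  -- `α`-term of `kerC` cancel `kerK`. Only a constant matrix is left.
  have hlin : (Complex.I * ((k * ‖z‖ : ℝ) : ℂ)) • (kerE z + kerC z) + (k : ℂ) • kerK z
      = (k : ℂ) • greenDeriv := by
    unfold kerE kerC kerK greenDeriv
    push_cast
    have e1 : Complex.I * ((k : ℂ) * (‖z‖ : ℂ)) * (-(4 * (Real.pi : ℂ))⁻¹ * (‖z‖ : ℂ)⁻¹)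
        = (k : ℂ) * (-Complex.I * (4 * (Real.pi : ℂ))⁻¹) := by
      field_simp
    have e2 : Complex.I * ((k : ℂ) * (‖z‖ : ℂ)) *
        (Complex.I * (-(4 * (Real.pi : ℂ))⁻¹ * (‖z‖ : ℂ)⁻¹ ^ 2))
        = -((k : ℂ) * (-(4 * (Real.pi : ℂ))⁻¹ * (‖z‖ : ℂ)⁻¹)) := by
      field_simp
      rw [Complex.I_sq]; ring
    simp only [smul_add, smul_smul, e1, e2]
    module
  have key : green k z - green 0 z - (k : ℂ) • greenDeriv =
      (Complex.exp (Complex.I * ((k * ‖z‖ : ℝ) : ℂ)) - 1 - Complex.I * ((k * ‖z‖ : ℝ) : ℂ)) •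
        (kerE z + kerC z)
      + Complex.exp (Complex.I * ((k * ‖z‖ : ℝ) : ℂ)) • (((energy k - 1 : ℝ) : ℂ) • kerE z)
      + (Complex.exp (Complex.I * ((k * ‖z‖ : ℝ) : ℂ)) - 1) • ((k : ℂ) • kerK z) := by
    rw [← hlin, green_eq, green_eq, energy_zero]
    simp only [zero_mul, Complex.ofReal_zero, mul_zero, Complex.exp_zero]
    push_cast
    module
  rw [key]
  have hE := norm_kerE_le z
  refine norm_add₃_le.trans ?_
  have f1 : ‖(Complex.exp (Complex.I * ((k * ‖z‖ : ℝ) : ℂ)) - 1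
      - Complex.I * ((k * ‖z‖ : ℝ) : ℂ)) • (kerE z + kerC z)‖
      ≤ 8 * diracConst * k ^ 2 * (‖z‖ * sing z) := by
    rw [norm_smul]
    have h4 := norm_mul_le_sing_of norm_kerE_le z
    have h6 := norm_mul_le_sing_of norm_kerC_le z
    calc _ ≤ (2 * (k * ‖z‖) ^ 2) * (‖kerE z‖ + ‖kerC z‖) := by
          gcongr
          · exact norm_phase_sub_one_sub_le _
          · exact norm_add_le _ _
      _ = 2 * k ^ 2 * ‖z‖ * (‖z‖ * ‖kerE z‖ + ‖z‖ * ‖kerC z‖) := by ring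
      _ ≤ 2 * k ^ 2 * ‖z‖ * (2 * diracConst * sing z + 2 * diracConst * sing z) := by gcongr
      _ = _ := by ring
  have f2 : ‖Complex.exp (Complex.I * ((k * ‖z‖ : ℝ) : ℂ)) • (((energy k - 1 : ℝ) : ℂ) • kerE z)‖
      ≤ 2 * diracConst * k ^ 2 * sing z := by
    rw [norm_smul, norm_phase, one_mul]
    refine (norm_real_smul_le hE1 (norm_le_sing_of norm_kerE_le z) (by positivity)).trans ?_
    linarith
  have f3 : ‖(Complex.exp (Complex.I * ((k * ‖z‖ : ℝ) : ℂ)) - 1) • ((k : ℂ) • kerK z)‖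
      ≤ 2 * diracConst * k ^ 2 * sing z := by
    rw [norm_smul]
    have hp := norm_phase_sub_one_le (k * ‖z‖)
    rw [abs_of_nonneg (by positivity)] at hp
    calc _ ≤ (k * ‖z‖) * (k * ‖kerK z‖) := by
          have := norm_real_smul_le (v := kerK z) hK' le_rfl hk
          gcongr
      _ = k ^ 2 * (‖z‖ * ‖kerK z‖) := by ring
      _ ≤ k ^ 2 * (2 * diracConst * sing z) := by
          exact mul_le_mul_of_nonneg_left (norm_mul_le_sing_of norm_kerK_le z) (sq_nonneg k)
      _ = _ := by ring
  have : 0 ≤ diracConst * k ^ 2 * sing z := by positivity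
  have h7 : 0 ≤ diracConst * k ^ 2 * (‖z‖ * sing z) := by positivity
  nlinarith

/-- At `k = 0` the phase is absent; the part with `1 + β` is Hermitian and even in `z`, and the part
`i α·z` is anti-Hermitian and odd. -/
lemma inner_green_zero (z : E3) (u w : Spinor) :
    inner ℂ u (green 0 z w) = inner ℂ (green 0 (-z) u) w := by
  rw [green_eq, green_eq, energy_zero, kerE, kerC, kerE, kerC, norm_neg, smul_neg, alphaDot_neg]
  simp only [zero_mul, Complex.ofReal_zero, mul_zero, Complex.exp_zero, one_smul, zero_smul,
    add_zero, Complex.ofReal_one, add_apply, smul_apply,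
    ContinuousLinearMap.id_apply, inner_add_left, inner_add_right, inner_smul_left,
    inner_smul_right, inner_betaOp, inner_alphaDot, map_mul, Complex.conj_I, Complex.conj_ofReal,
    neg_apply, inner_neg_left]
  ring

/-! ### Measurability -/

instance : SecondCountableTopology SpinorOp :=
  haveI := FiniteDimensional.proper ℂ SpinorOp
  inferInstance

lemma measurable_alphaDot_unit : Measurable fun z : E3 => alphaDot (‖z‖⁻¹ • z) := by
  unfold alphaDot
  simp only [PiLp.smul_apply, smul_eq_mul]
  refine Finset.measurable_sum _ fun l _ => ?_
  refine Measurable.smul_const ?_ _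
  fun_prop

lemma measurable_kerE : Measurable kerE := by
  unfold kerE
  refine Measurable.smul_const ?_ _
  fun_prop

lemma measurable_kerK : Measurable kerK := by
  unfold kerK
  refine Measurable.fun_smul ?_ measurable_alphaDot_unit
  fun_prop

lemma measurable_kerC : Measurable kerC := by
  unfold kerC
  refine (Measurable.smul_const ?_ _).add (Measurable.fun_smul ?_ measurable_alphaDot_unit) <;>
    fun_prop

lemma measurable_green (k : ℝ) : Measurable (green k) := by
  have : green k = fun z => Complex.exp (Complex.I * ((k * ‖z‖ : ℝ) : ℂ)) •
      (((energy k : ℝ) : ℂ) • kerE z + ((k : ℝ) : ℂ) • kerK z + kerC z) := funext (green_eq k)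
  rw [this]
  have h : Measurable fun z => ((energy k : ℝ) : ℂ) • kerE z + ((k : ℝ) : ℂ) • kerK z + kerC z :=
    ((measurable_kerE.fun_const_smul _).fun_add
      (measurable_kerK.fun_const_smul _)).fun_add measurable_kerC
  have h' : Measurable fun z : E3 => Complex.exp (Complex.I * ((k * ‖z‖ : ℝ) : ℂ)) := by fun_prop
  exact h'.fun_smul h

lemma measurable_sing : Measurable sing := by unfold sing; fun_prop

lemma locallyIntegrable_sing : LocallyIntegrable sing volume := by
  have h1 : LocallyIntegrable (fun z : E3 => ‖z‖⁻¹ ^ 2) volume := by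
    refine locallyIntegrable_of_norm_le_rpow (C := 1) (α := 2) (by simp) (by simp; norm_num) ?_
      (by fun_prop)
    refine Eventually.of_forall fun z => ?_
    rw [one_mul, Real.norm_of_nonneg (by positivity), Real.rpow_neg (norm_nonneg _),
      show (2 : ℝ) = ((2 : ℕ) : ℝ) by norm_num, Real.rpow_natCast, inv_pow]
  exact (locallyIntegrable_const (1 : ℝ)).add h1

/-! ### Integral estimates -/

/-- The norm `‖V‖₁ + ‖V‖_∞`. -/
def potNorm (V : E3 → SpinorOp) : ℝ := normOne V + normInf V

section Norms

variable {F : Type*} [NormedAddCommGroup F]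

lemma normInf_nonneg (f : E3 → F) : 0 ≤ normInf f := ENNReal.toReal_nonneg

lemma normOne_nonneg (f : E3 → F) : 0 ≤ normOne f := ENNReal.toReal_nonneg

lemma ae_norm_le_normInf {f : E3 → F} (hf : MemLp f ⊤ volume) : ∀ᵐ x, ‖f x‖ ≤ normInf f := by
  have h := ae_le_eLpNormEssSup (f := f) (μ := volume)
  filter_upwards [h] with x hx
  rw [normInf, eLpNorm_exponent_top, ← toReal_enorm]
  refine ENNReal.toReal_mono ?_ hx
  have := hf.2.ne
  rwa [eLpNorm_exponent_top] at this

/-- The set where the bound fails is open and null, hence empty. This allows pointwise suprema to be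
used throughout. -/
lemma norm_le_normInf {f : E3 → F} (hf : MemLp f ⊤ volume) (hc : Continuous f) (x : E3) :
    ‖f x‖ ≤ normInf f := by
  by_contra! h
  have ho : IsOpen {x | normInf f < ‖f x‖} := isOpen_lt continuous_const hc.norm
  have h0 : volume {x | normInf f < ‖f x‖} = 0 := by
    have := ae_norm_le_normInf hf
    rw [ae_iff] at this
    simpa using this
  rw [ho.measure_eq_zero_iff volume] at h0
  exact (h0 ▸ h : x ∈ (∅ : Set E3))

lemma normInf_le {f : E3 → F} {M : ℝ} (hM : 0 ≤ M) (h : ∀ x, ‖f x‖ ≤ M) : normInf f ≤ M := by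
  rw [normInf, eLpNorm_exponent_top]
  refine ENNReal.toReal_le_of_le_ofReal hM ?_
  exact eLpNormEssSup_le_of_ae_bound (Eventually.of_forall h)

lemma integral_norm_eq_normOne {f : E3 → F} (hf : MemLp f 1 volume) :
    ∫ x, ‖f x‖ = normOne f := by
  rw [normOne, eLpNorm_one_eq_lintegral_enorm, integral_norm_eq_lintegral_enorm hf.1]

lemma memLp_top_of_continuous {f : E3 → F} [SecondCountableTopologyEither E3 F]
    (hc : Continuous f) {M : ℝ} (h : ∀ x, ‖f x‖ ≤ M) : MemLp f ⊤ volume :=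
  memLp_top_of_bound hc.aestronglyMeasurable M (Eventually.of_forall h)

lemma memLp_fun_add {f g : E3 → F} {p : ENNReal} (hf : MemLp f p volume) (hg : MemLp g p volume) :
    MemLp (fun x => f x + g x) p volume := hf.add hg

lemma normOne_add_le {f g : E3 → F} (hf : MemLp f 1 volume) (hg : MemLp g 1 volume) :
    normOne (fun x => f x + g x) ≤ normOne f + normOne g := by
  rw [normOne, normOne, normOne, ← ENNReal.toReal_add hf.2.ne hg.2.ne]
  exact ENNReal.toReal_mono (ENNReal.add_ne_top.mpr ⟨hf.2.ne, hg.2.ne⟩)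
    (eLpNorm_add_le hf.1 hg.1 le_rfl)

lemma normInf_add_le {f g : E3 → F} (hf : MemLp f ⊤ volume) (hg : MemLp g ⊤ volume) :
    normInf (fun x => f x + g x) ≤ normInf f + normInf g := by
  rw [normInf, normInf, normInf, ← ENNReal.toReal_add hf.2.ne hg.2.ne]
  exact ENNReal.toReal_mono (ENNReal.add_ne_top.mpr ⟨hf.2.ne, hg.2.ne⟩)
    (eLpNorm_add_le hf.1 hg.1 le_top)

end Norms

lemma potNorm_nonneg (V : E3 → SpinorOp) : 0 ≤ potNorm V :=
  add_nonneg (normOne_nonneg V) (normInf_nonneg V)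

lemma IsPotential.integrable {V : E3 → SpinorOp} (hV : IsPotential V) : Integrable V :=
  memLp_one_iff_integrable.mp hV.2.1

lemma IsPotential.aesm {V : E3 → SpinorOp} (hV : IsPotential V) :
    AEStronglyMeasurable V volume := hV.2.1.1

lemma isSelfAdjoint_add_op {S T : SpinorOp} (hS : IsSelfAdjoint S) (hT : IsSelfAdjoint T) :
    IsSelfAdjoint (S + T) := by
  rw [ContinuousLinearMap.isSelfAdjoint_iff'] at *
  exact (map_add _ S T).trans (by rw [hS, hT])

lemma IsPotential.add {V W : E3 → SpinorOp} (hV : IsPotential V) (hW : IsPotential W) :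
    IsPotential fun x => V x + W x :=
  ⟨fun x => isSelfAdjoint_add_op (hV.1 x) (hW.1 x), memLp_fun_add hV.2.1 hW.2.1,
    memLp_fun_add hV.2.2 hW.2.2⟩

lemma potNorm_add_le {V W : E3 → SpinorOp} (hV : IsPotential V) (hW : IsPotential W) :
    potNorm (fun x => V x + W x) ≤ potNorm V + potNorm W := by
  have h1 := normOne_add_le hV.2.1 hW.2.1
  have h2 := normInf_add_le hV.2.2 hW.2.2
  unfold potNorm; linarith

/-- Inside the unit ball the singularity is integrable and `‖V‖_∞` is used; outside it `sing ≤ 2`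
and `‖V‖₁` is used. The constant is uniform in `x` and `V`. -/
lemma exists_sing_bound : ∃ C : ℝ, 0 < C ∧ ∀ V, IsPotential V → ∀ x : E3,
    Integrable (fun y => sing (x - y) * ‖V y‖) ∧
      ∫ y, sing (x - y) * ‖V y‖ ≤ C * potNorm V := by
  set q : E3 → ℝ := (Metric.closedBall (0 : E3) 1).indicator sing with hq
  have hqi : Integrable q :=
    (locallyIntegrable_sing.integrableOn_isCompact (isCompact_closedBall 0 1)).integrable_indicator
      measurableSet_closedBall
  have hq0 : ∀ z, 0 ≤ q z := fun z =>
    Set.indicator_nonneg (fun w _ => zero_le_one.trans (one_le_sing w)) z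
  have hsq : ∀ z, sing z ≤ 2 + q z := by
    intro z
    by_cases hz : z ∈ Metric.closedBall (0 : E3) 1
    · rw [hq, Set.indicator_of_mem hz]; linarith
    · rw [hq, Set.indicator_of_notMem hz]
      rw [mem_closedBall_zero_iff, not_le] at hz
      have : ‖z‖⁻¹ ≤ 1 := inv_le_one_of_one_le₀ hz.le
      have h0 : 0 ≤ ‖z‖⁻¹ := by positivity
      unfold sing; nlinarith
  refine ⟨2 + ∫ z, q z, by
    have h0 : 0 ≤ ∫ z, q z := integral_nonneg hq0
    linarith, fun V hV x => ?_⟩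
  have hVi := hV.integrable.norm
  have hqx : Integrable fun y => q (x - y) := hqi.comp_sub_left x
  have hdom : Integrable fun y => 2 * ‖V y‖ + normInf V * q (x - y) :=
    (hVi.const_mul 2).add (hqx.const_mul _)
  have hle : ∀ᵐ y, sing (x - y) * ‖V y‖ ≤ 2 * ‖V y‖ + normInf V * q (x - y) := by
    filter_upwards [ae_norm_le_normInf hV.2.2] with y hy
    have := mul_le_mul_of_nonneg_right (hsq (x - y)) (norm_nonneg (V y))
    have := mul_le_mul_of_nonneg_right hy (hq0 (x - y))
    nlinarith
  have hint : Integrable fun y => sing (x - y) * ‖V y‖ := by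
    refine hdom.mono' ?_ ?_
    · exact (measurable_sing.comp (measurable_const.sub measurable_id)).aestronglyMeasurable.mul
        hV.aesm.norm
    · filter_upwards [hle] with y hy
      rwa [Real.norm_of_nonneg]
      exact mul_nonneg (zero_le_one.trans (one_le_sing _)) (norm_nonneg _)
  refine ⟨hint, (integral_mono_ae hint hdom hle).trans ?_⟩
  rw [integral_add (hVi.const_mul 2) (hqx.const_mul _), integral_const_mul, integral_const_mul,
    integral_norm_eq_normOne hV.2.1, integral_sub_left_eq_self q volume x]
  have h1 := normOne_nonneg V
  have h2 := normInf_nonneg V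
  have h3 : 0 ≤ ∫ z, q z := integral_nonneg hq0
  unfold potNorm
  nlinarith

/-- The constant in `∫ sing (x - y) ‖V y‖ dy ≤ C (‖V‖₁ + ‖V‖_∞)`. -/
def singConst : ℝ := exists_sing_bound.choose

lemma singConst_pos : 0 < singConst := exists_sing_bound.choose_spec.1

lemma integrable_sing_mul {V : E3 → SpinorOp} (hV : IsPotential V) (x : E3) :
    Integrable (fun y => sing (x - y) * ‖V y‖) := (exists_sing_bound.choose_spec.2 V hV x).1

lemma integral_sing_mul_le {V : E3 → SpinorOp} (hV : IsPotential V) (x : E3) :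
    ∫ y, sing (x - y) * ‖V y‖ ≤ singConst * potNorm V :=
  (exists_sing_bound.choose_spec.2 V hV x).2

lemma norm_integral_le_of_sing {G : Type*} [NormedAddCommGroup G] [NormedSpace ℝ G]
    {V : E3 → SpinorOp} (hV : IsPotential V)
    {x : E3} {F : E3 → G} {c : ℝ} (hc : 0 ≤ c)
    (h : ∀ᵐ y, ‖F y‖ ≤ c * (sing (x - y) * ‖V y‖)) :
    ‖∫ y, F y‖ ≤ c * (singConst * potNorm V) := by
  refine (norm_integral_le_of_norm_le ((integrable_sing_mul hV x).const_mul c) h).trans ?_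
  rw [integral_const_mul]
  exact mul_le_mul_of_nonneg_left (integral_sing_mul_le hV x) hc

lemma integrable_of_sing {G : Type*} [NormedAddCommGroup G] {V : E3 → SpinorOp} (hV : IsPotential V)
    {x : E3} {F : E3 → G} {c : ℝ} (hF : AEStronglyMeasurable F volume)
    (h : ∀ᵐ y, ‖F y‖ ≤ c * (sing (x - y) * ‖V y‖)) : Integrable F :=
  ((integrable_sing_mul hV x).const_mul c).mono' hF h

lemma aesm_clm_apply {X : Type*} [MeasurableSpace X] {μ : Measure X} {V : X → SpinorOp}
    {f : X → Spinor} (hV : AEStronglyMeasurable V μ) (hf : AEStronglyMeasurable f μ) :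
    AEStronglyMeasurable (fun y => V y (f y)) μ :=
  (ContinuousLinearMap.id ℂ SpinorOp).aestronglyMeasurable_comp₂ hV hf

lemma aesm_kernel {a V : E3 → SpinorOp} {f : E3 → Spinor} (ha : Measurable a)
    (hV : AEStronglyMeasurable V volume) (hf : AEStronglyMeasurable f volume) (x : E3) :
    AEStronglyMeasurable (fun y => a (x - y) (V y (f y))) volume :=
  aesm_clm_apply (ha.comp (measurable_const.sub measurable_id)).aestronglyMeasurable
    (aesm_clm_apply hV hf)

lemma norm_kernel_le {S V : SpinorOp} {f : Spinor} {c s M : ℝ} (hS : ‖S‖ ≤ c * s)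
    (hf : ‖f‖ ≤ M) (hcs : 0 ≤ c * s) : ‖S (V f)‖ ≤ c * M * (s * ‖V‖) := by
  calc ‖S (V f)‖ ≤ ‖S‖ * ‖V f‖ := S.le_opNorm _
    _ ≤ ‖S‖ * (‖V‖ * ‖f‖) := by gcongr; exact V.le_opNorm _
    _ ≤ (c * s) * (‖V‖ * M) := by gcongr
    _ = _ := by ring

/-- Continuity of translations in `L¹`, read off from the continuous action of the translation group
on `Lp`. -/
lemma exists_translation_bound {g : E3 → SpinorOp} (hg : Integrable g) {ε : ℝ} (hε : 0 < ε) :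
    ∃ δ > 0, ∀ h : E3, ‖h‖ < δ → ∫ z, ‖g (h + z) - g z‖ < ε := by
  set f := (memLp_one_iff_integrable.mpr hg).toLp g with hf
  have : Fact ((1 : ENNReal) ≠ ⊤) := ⟨ENNReal.one_ne_top⟩
  have hcont : Continuous fun h : E3 => (DomAddAct.mk h) +ᵥ f :=
    DomAddAct.mkHomeomorph.continuous.vadd continuous_const
  have hc0 : ContinuousAt (fun h : E3 => (DomAddAct.mk h) +ᵥ f) 0 := hcont.continuousAt
  rw [Metric.continuousAt_iff] at hc0
  obtain ⟨δ, hδ, h⟩ := hc0 ε hε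
  refine ⟨δ, hδ, fun t ht => ?_⟩
  have h1 := h (x := t) (by simpa [dist_eq_norm] using ht)
  have h0 : (DomAddAct.mk (0 : E3)) +ᵥ f = f := by
    rw [show DomAddAct.mk (0 : E3) = 0 from rfl, zero_vadd]
  rw [h0, dist_eq_norm, hf, DomAddAct.mk_vadd_toLp, ← MemLp.toLp_sub, Lp.norm_toLp,
    eLpNorm_one_eq_lintegral_enorm] at h1
  rw [integral_norm_eq_lintegral_enorm]
  · simpa using h1
  · exact (hg.comp_add_left t).aestronglyMeasurable.sub hg.aestronglyMeasurable

lemma exists_integrable_eq_on_ball {F : Type*} [NormedAddCommGroup F] {a : E3 → F}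
    (ha : LocallyIntegrable a volume) (r : ℝ) :
    ∃ g : E3 → F, Integrable g ∧ ∀ z, ‖z‖ ≤ r → g z = a z :=
  ⟨(Metric.closedBall (0 : E3) r).indicator a,
    (ha.integrableOn_isCompact (isCompact_closedBall 0 _)).integrable_indicator
      measurableSet_closedBall,
    fun _ hz => Set.indicator_of_mem (mem_closedBall_zero_iff.mpr hz) a⟩

/-- Only arguments with `|x - y| ≤ σ + ρ` matter, so the kernel may be truncated to an `L¹`
function, whose translations are continuous. Since `δ` depends on `w` only through `v`, this yields
both the continuity of `T f` and the equicontinuity needed for compactness. -/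
lemma exists_equicontinuity_bound {a : E3 → SpinorOp} (ha : LocallyIntegrable a volume)
    (σ ρ v : ℝ) {ε : ℝ} (hε : 0 < ε) :
    ∃ δ > 0, ∀ x x' : E3, ‖x‖ ≤ σ → ‖x'‖ ≤ σ → ‖x - x'‖ < δ → ∀ w : E3 → Spinor,
      AEStronglyMeasurable w volume → (∀ᵐ y, ‖w y‖ ≤ v) → (∀ y, ρ < ‖y‖ → w y = 0) →
        ‖(∫ y, a (x - y) (w y)) - ∫ y, a (x' - y) (w y)‖ ≤ ε := by
  obtain ⟨g, hg, hga⟩ := exists_integrable_eq_on_ball ha (σ + ρ)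
  have hv : 0 < |v| + 1 := by positivity
  obtain ⟨δ, hδ, h⟩ := exists_translation_bound hg (div_pos hε hv)
  refine ⟨δ, hδ, fun x x' hx hx' hxx w hw hwv hw0 => ?_⟩
  have hag : ∀ x : E3, ‖x‖ ≤ σ → ∀ y, a (x - y) (w y) = g (x - y) (w y) := by
    intro x hx y
    by_cases hy : ρ < ‖y‖
    · simp [hw0 y hy]
    · rw [hga]
      linarith [norm_sub_le x y]
  have hgi : ∀ x : E3, Integrable fun y => g (x - y) (w y) := by
    intro x
    have hgx := hg.comp_sub_left x
    refine (hgx.norm.const_mul |v|).mono' (aesm_clm_apply hgx.aestronglyMeasurable hw) ?_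
    filter_upwards [hwv] with y hy
    refine (ContinuousLinearMap.le_opNorm _ _).trans ?_
    rw [mul_comm]
    exact mul_le_mul_of_nonneg_right (hy.trans (le_abs_self v)) (norm_nonneg _)
  simp_rw [hag x hx, hag x' hx']
  rw [← integral_sub (hgi x) (hgi x')]
  have hb : Integrable fun y => ‖g ((x - x') + (x' - y)) - g (x' - y)‖ :=
    (((hg.comp_add_left (x - x')).sub hg).norm).comp_sub_left x'
  refine (norm_integral_le_of_norm_le (hb.const_mul |v|) ?_).trans ?_
  · filter_upwards [hwv] with y hy
    rw [sub_add_sub_cancel, ← sub_apply]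
    refine (ContinuousLinearMap.le_opNorm _ _).trans ?_
    rw [mul_comm]
    exact mul_le_mul_of_nonneg_right (hy.trans (le_abs_self v)) (norm_nonneg _)
  · rw [integral_const_mul,
      integral_sub_left_eq_self (fun z => ‖g ((x - x') + z) - g z‖) volume x']
    have h1 := (h (x - x') hxx).le
    have h2 : 0 ≤ ∫ z, ‖g ((x - x') + z) - g z‖ := integral_nonneg fun z => norm_nonneg _
    rw [le_div_iff₀ hv] at h1
    nlinarith [abs_nonneg v]

/-- The kernels that occur are dominated by a locally bounded multiple of `sing`. -/
lemma locallyIntegrable_of_sing {a : E3 → SpinorOp} (ha : Measurable a) {b : ℝ → ℝ}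
    (hb : Continuous b) (h : ∀ z, ‖a z‖ ≤ b ‖z‖ * sing z) : LocallyIntegrable a volume := by
  have h1 : LocallyIntegrable (fun z : E3 => b ‖z‖ * sing z) volume := by
    rw [locallyIntegrable_iff]
    intro K hK
    exact (locallyIntegrable_sing.integrableOn_isCompact hK).continuousOn_mul
      (hb.comp continuous_norm).continuousOn hK
  refine h1.mono ha.aestronglyMeasurable (Eventually.of_forall fun z => ?_)
  exact (h z).trans (le_abs_self _)

/-! ### The operator `T` on bounded functions -/

section opT

variable {V : E3 → SpinorOp} {f : E3 → Spinor} {k M : ℝ}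

lemma opT_integrable (hV : IsPotential V) (hk : 0 ≤ k) (hk1 : k ≤ 1)
    (hf : AEStronglyMeasurable f volume) (hM : ∀ᵐ y, ‖f y‖ ≤ M) (x : E3) :
    Integrable fun y => green k (x - y) (V y (f y)) := by
  refine integrable_of_sing hV (x := x) (c := 8 * diracConst * M)
    (aesm_kernel (measurable_green k) hV.aesm hf x) ?_
  filter_upwards [hM] with y hy
  have := diracConst_pos
  have := one_le_sing (x - y)
  exact norm_kernel_le (norm_green_le hk hk1 _) hy (by positivity)

lemma norm_opT_le (hV : IsPotential V) (hk : 0 ≤ k) (hk1 : k ≤ 1) (hM0 : 0 ≤ M)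
    (hM : ∀ᵐ y, ‖f y‖ ≤ M) (x : E3) :
    ‖opT V k f x‖ ≤ 8 * diracConst * M * (singConst * potNorm V) := by
  have := diracConst_pos
  refine norm_integral_le_of_sing hV (x := x) (by positivity) ?_
  filter_upwards [hM] with y hy
  have := one_le_sing (x - y)
  exact norm_kernel_le (norm_green_le hk hk1 _) hy (by positivity)

lemma norm_opT_sub_le (hV : IsPotential V) (hk : 0 ≤ k) (hk1 : k ≤ 1)
    (hf : AEStronglyMeasurable f volume) (hM0 : 0 ≤ M) (hM : ∀ᵐ y, ‖f y‖ ≤ M) (x : E3) :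
    ‖opT V k f x - opT V 0 f x‖ ≤ 16 * diracConst * k * M * (singConst * potNorm V) := by
  have := diracConst_pos
  rw [opT, opT, ← integral_sub (opT_integrable hV hk hk1 hf hM x)
    (opT_integrable hV le_rfl zero_le_one hf hM x)]
  refine norm_integral_le_of_sing hV (x := x) (by positivity) ?_
  filter_upwards [hM] with y hy
  have := one_le_sing (x - y)
  rw [← sub_apply]
  exact norm_kernel_le (norm_green_sub_le hk hk1 _) hy (by positivity)

lemma opT_sub (hV : IsPotential V) (hk : 0 ≤ k) (hk1 : k ≤ 1) {g : E3 → Spinor} {M' : ℝ}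
    (hf : AEStronglyMeasurable f volume) (hM : ∀ᵐ y, ‖f y‖ ≤ M)
    (hg : AEStronglyMeasurable g volume) (hM' : ∀ᵐ y, ‖g y‖ ≤ M') (x : E3) :
    opT V k (fun y => f y - g y) x = opT V k f x - opT V k g x := by
  rw [opT, opT, opT, ← integral_sub (opT_integrable hV hk hk1 hf hM x)
    (opT_integrable hV hk hk1 hg hM' x)]
  simp

lemma opT_add_potential {W : E3 → SpinorOp} (hV : IsPotential V) (hW : IsPotential W)
    (hk : 0 ≤ k) (hk1 : k ≤ 1)
    (hf : AEStronglyMeasurable f volume) (hM : ∀ᵐ y, ‖f y‖ ≤ M) (x : E3) :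
    opT (fun y => V y + W y) k f x = opT V k f x + opT W k f x := by
  rw [opT, opT, opT, ← integral_add (opT_integrable hV hk hk1 hf hM x)
    (opT_integrable hW hk hk1 hf hM x)]
  simp

lemma locallyIntegrable_green (hk : 0 ≤ k) (hk1 : k ≤ 1) :
    LocallyIntegrable (green k) volume :=
  locallyIntegrable_of_sing (measurable_green k) (b := fun _ => 8 * diracConst) continuous_const
    (norm_green_le hk hk1)

lemma continuous_opT (hV : IsPotential V) {ρ : ℝ} (hρ : ∀ x, ρ < ‖x‖ → V x = 0)
    (hk : 0 ≤ k) (hk1 : k ≤ 1)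
    (hf : AEStronglyMeasurable f volume) (hM : ∀ᵐ y, ‖f y‖ ≤ M) : Continuous (opT V k f) := by
  rw [Metric.continuous_iff]
  intro x ε hε
  obtain ⟨δ, hδ, h⟩ := exists_equicontinuity_bound (locallyIntegrable_green hk hk1) (‖x‖ + 1) ρ
    (normInf V * M) (half_pos hε)
  refine ⟨min δ 1, by positivity, fun x' hx' => ?_⟩
  rw [dist_eq_norm] at hx' ⊢
  refine (h x' x ?_ (by linarith) (hx'.trans_le (min_le_left _ _)) (fun y => V y (f y))
    (aesm_clm_apply hV.aesm hf) ?_ (fun y hy => by simp [hρ y hy])).trans_lt (half_lt_self hε)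
  · have := norm_sub_norm_le x' x
    linarith [hx'.trans_le (min_le_right _ _)]
  · filter_upwards [ae_norm_le_normInf hV.2.2, hM] with y h1 h2
    exact (ContinuousLinearMap.le_opNorm _ _).trans
      (mul_le_mul h1 h2 (norm_nonneg _) (normInf_nonneg V))

end opT

/-! ### Compact perturbations of the identity -/

/-- Riesz theory: the identity of the fixed space is compact, so this space is finite dimensional
and has a continuous projection `P`. On `ker P` the map `1 - T` is bounded below; otherwise unit
vectors with `h - T h → 0` would accumulate, by compactness, at a unit fixed vector in `ker P`,
where only `0` is fixed. -/
lemma exists_fixedPoint_near_of_isCompactOperator {X : Type*} [NormedAddCommGroup X]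
    [NormedSpace ℝ X] {T : X →L[ℝ] X} (hT : IsCompactOperator T) :
    ∃ N : Submodule ℝ X, FiniteDimensional ℝ N ∧ (∀ z, z ∈ N ↔ T z = z) ∧
      ∃ C > 0, ∀ x, ∃ z ∈ N, ‖x - z‖ ≤ C * ‖x - T x‖ := by
  set N : Submodule ℝ X := (1 - T : X →L[ℝ] X).ker with hN
  have hmem : ∀ z, z ∈ N ↔ T z = z := by
    intro z
    change z - T z = 0 ↔ T z = z
    rw [sub_eq_zero, eq_comm]
  have hNc : IsClosed (N : Set X) := ContinuousLinearMap.isClosed_ker _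
  have hfin : FiniteDimensional ℝ N := by
    have h1 : IsCompactOperator (T ∘L N.subtypeL) := hT.comp_clm N.subtypeL
    have h2 : ∀ x : N, (T ∘L N.subtypeL) x ∈ N := fun x => by
      have := (hmem x).mp x.2
      simp [this]
    have h3 := IsCompactOperator.codRestrict (f := ((T ∘L N.subtypeL : N →L[ℝ] X) : N →ₗ[ℝ] X))
      (V := N) h1 h2 hNc
    have h4 : (LinearMap.codRestrict N ((T ∘L N.subtypeL : N →L[ℝ] X) : N →ₗ[ℝ] X) h2 : N → N)
        = id := by
      funext x
      apply Subtype.ext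
      simpa using (hmem x).mp x.2
    exact FiniteDimensional.of_isCompactOperator_id (𝕜 := ℝ) (h4 ▸ h3)
  obtain ⟨P, hP⟩ := Submodule.ClosedComplemented.of_finiteDimensional (𝕜 := ℝ) N
  refine ⟨N, hfin, hmem, ?_⟩
  suffices h : ∃ C > 0, ∀ h, P h = 0 → ‖h‖ ≤ C * ‖h - T h‖ by
    obtain ⟨C, hC, h⟩ := h
    refine ⟨C, hC, fun x => ⟨P x, (P x).2, ?_⟩⟩
    refine (h (x - P x) (by rw [map_sub, hP, sub_self])).trans (le_of_eq ?_)
    rw [map_sub, (hmem _).mp (P x).2]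
    congr 2; abel
  by_contra! hcon
  have hcon' : ∀ n : ℕ, ∃ h, P h = 0 ∧ ‖h‖ = 1 ∧ ‖h - T h‖ < 1 / ((n : ℝ) + 1) := by
    intro n
    obtain ⟨h, h0, h1⟩ := hcon ((n : ℝ) + 1) (by positivity)
    have hpos : 0 < ‖h‖ := lt_of_le_of_lt (by positivity) h1
    refine ⟨‖h‖⁻¹ • h, by rw [map_smul, h0, smul_zero], ?_, ?_⟩
    · rw [norm_smul, norm_inv, norm_norm, inv_mul_cancel₀ hpos.ne']
    · rw [map_smul, ← smul_sub, norm_smul, norm_inv, norm_norm, inv_mul_lt_iff₀ hpos,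
        mul_one_div, lt_div_iff₀ (by positivity), mul_comm]
      exact h1
  choose h h0 h1 h2 using hcon'
  have hlim : Tendsto (fun n => h n - T (h n)) atTop (𝓝 0) :=
    squeeze_zero_norm (fun n => (h2 n).le) tendsto_one_div_add_atTop_nhds_zero_nat
  obtain ⟨K, hK, hK'⟩ := hT.image_closedBall_subset_compact 1
  obtain ⟨y, -, φ, hφ, hy⟩ := hK.tendsto_subseq (x := fun n => T (h n))
    fun n => hK' ⟨h n, by simp [h1 n], rfl⟩
  have hhy : Tendsto (fun n => h (φ n)) atTop (𝓝 y) := by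
    have := (hlim.comp hφ.tendsto_atTop).add hy
    simpa using this
  have hTy : T y = y :=
    tendsto_nhds_unique ((T.continuous.tendsto y).comp hhy) hy
  have hPy : P y = 0 := by
    refine tendsto_nhds_unique ((P.continuous.tendsto y).comp hhy) ?_
    simp [Function.comp_def, h0]
  have hy0 : y = 0 := by
    have := hP ⟨y, (hmem y).mpr hTy⟩
    simp only [hPy] at this
    exact (congrArg Subtype.val this).symm
  have hn : ‖y‖ = 1 := tendsto_nhds_unique hhy.norm (by simp [h1])
  rw [hy0, norm_zero] at hn
  exact zero_ne_one hn

lemma hasDerivAt_of_norm_le_sq {E : Type*} [NormedAddCommGroup E] [NormedSpace ℝ E] {F : ℝ → E}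
    {F' : E} {k C : ℝ} (h : ∀ t, ‖F (k + t) - F k - t • F'‖ ≤ C * t ^ 2) : HasDerivAt F F' k := by
  rw [hasDerivAt_iff_isLittleO_nhds_zero]
  have h1 : (fun t => F (k + t) - F k - t • F') =O[𝓝 0] fun t : ℝ => t ^ 2 := by
    refine Asymptotics.IsBigO.of_bound C (Eventually.of_forall fun t => ?_)
    rw [Real.norm_of_nonneg (sq_nonneg t)]
    exact h t
  exact h1.trans_isLittleO (Asymptotics.isLittleO_pow_id one_lt_two)

/-! ### Functions on a ball -/

instance (ρ : ℝ) : CompactSpace (Metric.closedBall (0 : E3) ρ) :=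
  isCompact_iff_compactSpace.mp (isCompact_closedBall 0 ρ)

/-- Continuous spinor valued functions on the closed ball of radius `ρ`. -/
abbrev BallFn (ρ : ℝ) : Type := C(Metric.closedBall (0 : E3) ρ, Spinor)

/-- The radial retraction onto the closed ball. -/
def ballRetract {ρ : ℝ} (hρ : 0 < ρ) : C(E3, Metric.closedBall (0 : E3) ρ) where
  toFun x := ⟨(ρ / max ρ ‖x‖) • x, by
    have h : 0 < max ρ ‖x‖ := lt_max_of_lt_left hρ
    rw [mem_closedBall_zero_iff, norm_smul, Real.norm_of_nonneg (by positivity), div_mul_eq_mul_div,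
      div_le_iff₀ h]
    exact mul_le_mul_of_nonneg_left (le_max_right _ _) hρ.le⟩
  continuous_toFun := by
    have h : Continuous fun x : E3 => ρ / max ρ ‖x‖ :=
      continuous_const.div (continuous_const.max continuous_norm)
        fun x => (lt_max_of_lt_left hρ).ne'
    exact (h.smul continuous_id).subtype_mk _

lemma ballRetract_of_norm_le {ρ : ℝ} (hρ : 0 < ρ) {x : E3} (hx : ‖x‖ ≤ ρ) :
    ballRetract hρ x = ⟨x, mem_closedBall_zero_iff.mpr hx⟩ := by
  apply Subtype.ext
  change (ρ / max ρ ‖x‖) • x = x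
  rw [max_eq_left hx, div_self hρ.ne', one_smul]

/-- Extension of a function on the ball to a bounded continuous function on `ℝ³`. -/
def extend {ρ : ℝ} (hρ : 0 < ρ) (u : BallFn ρ) (x : E3) : Spinor := u (ballRetract hρ x)

section extend

variable {ρ : ℝ} (hρ : 0 < ρ)

lemma continuous_extend (u : BallFn ρ) : Continuous (extend hρ u) :=
  u.continuous.comp (ballRetract hρ).continuous

lemma norm_extend_le (u : BallFn ρ) (x : E3) : ‖extend hρ u x‖ ≤ ‖u‖ :=
  u.norm_coe_le_norm _

lemma extend_of_norm_le (u : BallFn ρ) {x : E3} (hx : ‖x‖ ≤ ρ) :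
    extend hρ u x = u ⟨x, mem_closedBall_zero_iff.mpr hx⟩ := by
  rw [extend, ballRetract_of_norm_le hρ hx]

lemma extend_add (u v : BallFn ρ) (x : E3) :
    extend hρ (u + v) x = extend hρ u x + extend hρ v x := rfl

lemma extend_smul (r : ℝ) (u : BallFn ρ) (x : E3) :
    extend hρ (r • u) x = r • extend hρ u x := rfl

end extend

/-- Restriction of a continuous function to the ball. -/
def restrictBall (ρ : ℝ) {f : E3 → Spinor} (hf : Continuous f) : BallFn ρ :=
  ⟨fun x => f x, hf.comp continuous_subtype_val⟩

/-- The potential cuts off the integrand. This reduces the equation on `ℝ³` to one on the ball and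
makes the values of `extend` outside the ball irrelevant. -/
lemma opT_congr {V : E3 → SpinorOp} {ρ : ℝ} (hsupp : ∀ x, ρ < ‖x‖ → V x = 0) (k : ℝ)
    {f g : E3 → Spinor} (h : ∀ y, ‖y‖ ≤ ρ → f y = g y) : opT V k f = opT V k g := by
  funext x
  unfold opT
  congr 1
  funext y
  rcases le_or_gt ‖y‖ ρ with hy | hy
  · rw [h y hy]
  · simp [hsupp y hy]

/-! ### Integral operators on functions on a ball -/

/-- Kernels with the singularity of the Green's function and polynomial growth. -/
structure IsKernel (a : E3 → SpinorOp) (c : ℝ) (n : ℕ) : Prop where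
  measurable : Measurable a
  nonneg : 0 ≤ c
  bound : ∀ z, ‖a z‖ ≤ c * (1 + ‖z‖) ^ n * sing z

namespace IsKernel

variable {a : E3 → SpinorOp} {c : ℝ} {n : ℕ} {V : E3 → SpinorOp} {ρ : ℝ}

lemma locallyIntegrable (ha : IsKernel a c n) : LocallyIntegrable a volume :=
  locallyIntegrable_of_sing ha.measurable (b := fun t => c * (1 + t) ^ n) (by fun_prop) ha.bound

lemma norm_apply_le (ha : IsKernel a c n) (hsupp : ∀ x, ρ < ‖x‖ → V x = 0) {f : E3 → Spinor}
    {M : ℝ} (hM : ∀ y, ‖f y‖ ≤ M) {x : E3} {σ : ℝ} (hx : ‖x‖ ≤ σ) (y : E3) :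
    ‖a (x - y) (V y (f y))‖ ≤ c * (1 + σ + ρ) ^ n * M * (sing (x - y) * ‖V y‖) := by
  rcases le_or_gt ‖y‖ ρ with hy | hy
  · have hs := one_le_sing (x - y)
    have hc := ha.nonneg
    have hn := norm_nonneg x
    have hn' := norm_nonneg y
    have h0 : 0 ≤ 1 + σ + ρ := by linarith
    refine norm_kernel_le (c := c * (1 + σ + ρ) ^ n) ?_ (hM y) (by positivity)
    refine (ha.bound _).trans ?_
    have h1 : 1 + ‖x - y‖ ≤ 1 + σ + ρ := by linarith [norm_sub_le x y]
    gcongr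
  · simp [hsupp y hy]

lemma integrable (ha : IsKernel a c n) (hV : IsPotential V) (hsupp : ∀ x, ρ < ‖x‖ → V x = 0)
    {f : E3 → Spinor} (hf : Continuous f) {M : ℝ} (hM : ∀ y, ‖f y‖ ≤ M) (x : E3) :
    Integrable fun y => a (x - y) (V y (f y)) :=
  integrable_of_sing hV (x := x) (aesm_kernel ha.measurable hV.aesm hf.aestronglyMeasurable x)
    (Eventually.of_forall fun y => ha.norm_apply_le hsupp hM le_rfl y)

lemma norm_integral_le (ha : IsKernel a c n) (hV : IsPotential V) (hρ : 0 ≤ ρ)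
    (hsupp : ∀ x, ρ < ‖x‖ → V x = 0)
    {f : E3 → Spinor} {M : ℝ} (hM : ∀ y, ‖f y‖ ≤ M) {x : E3} {σ : ℝ} (hx : ‖x‖ ≤ σ) :
    ‖∫ y, a (x - y) (V y (f y))‖ ≤ c * (1 + σ + ρ) ^ n * (singConst * potNorm V) * M := by
  have h0 : 0 ≤ σ := (norm_nonneg x).trans hx
  have hc := ha.nonneg
  have hM0 : 0 ≤ M := (norm_nonneg _).trans (hM 0)
  refine (norm_integral_le_of_sing hV (x := x) (by positivity)
    (Eventually.of_forall (ha.norm_apply_le hsupp hM hx))).trans (le_of_eq (by ring))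

end IsKernel

section KernelOp

variable {ρ : ℝ} (hρ : 0 < ρ) {V : E3 → SpinorOp}

lemma norm_potential_extend_le (hV : IsPotential V) (u : BallFn ρ) :
    ∀ᵐ y, ‖V y (extend hρ u y)‖ ≤ normInf V * ‖u‖ := by
  filter_upwards [ae_norm_le_normInf hV.2.2] with y h1
  exact (ContinuousLinearMap.le_opNorm _ _).trans
    (mul_le_mul h1 (norm_extend_le hρ u y) (norm_nonneg _) (normInf_nonneg V))

lemma continuous_kernel_integral {a : E3 → SpinorOp} (ha : LocallyIntegrable a volume)
    (hV : IsPotential V) (hsupp : ∀ x, ρ < ‖x‖ → V x = 0) (u : BallFn ρ) :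
    Continuous fun x => ∫ y, a (x - y) (V y (extend hρ u y)) := by
  rw [Metric.continuous_iff]
  intro x ε hε
  obtain ⟨δ, hδ, h⟩ := exists_equicontinuity_bound ha (‖x‖ + 1) ρ (normInf V * ‖u‖) (half_pos hε)
  refine ⟨min δ 1, by positivity, fun x' hx' => ?_⟩
  rw [dist_eq_norm] at hx' ⊢
  refine (h x' x ?_ (by linarith) (hx'.trans_le (min_le_left _ _))
    (fun y => V y (extend hρ u y))
    (aesm_clm_apply hV.aesm (continuous_extend hρ u).aestronglyMeasurable)
    (norm_potential_extend_le hρ hV u) (fun y hy => by simp [hsupp y hy])).trans_lt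
      (half_lt_self hε)
  have := norm_sub_norm_le x' x
  linarith [hx'.trans_le (min_le_right _ _)]

/-- The parameter space `S` is left free to cover two uses: the ball itself, where `1 - T` is
inverted, and a single point, where the solution is evaluated at an arbitrary `x`. -/
lemma exists_kernelOp {S : Type*} [TopologicalSpace S] [CompactSpace S] (ι : C(S, E3))
    (hV : IsPotential V) (hsupp : ∀ x, ρ < ‖x‖ → V x = 0) {a : E3 → SpinorOp} {c : ℝ} {n : ℕ}
    (ha : IsKernel a c n) :
    ∃ L : BallFn ρ →L[ℝ] C(S, Spinor), ∀ u s,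
      L u s = ∫ y, a (ι s - y) (V y (extend hρ u y)) := by
  have hi : ∀ (u : BallFn ρ) (x : E3), Integrable fun y => a (x - y) (V y (extend hρ u y)) :=
    fun u x => ha.integrable hV hsupp (continuous_extend hρ u) (norm_extend_le hρ u) x
  obtain ⟨σ, hσ⟩ : ∃ σ, ∀ s, ‖ι s‖ ≤ σ := ⟨‖ι‖, ι.norm_coe_le_norm⟩
  let L₀ : BallFn ρ →ₗ[ℝ] C(S, Spinor) :=
    { toFun := fun u => ⟨fun s => ∫ y, a (ι s - y) (V y (extend hρ u y)),
        (continuous_kernel_integral hρ ha.locallyIntegrable hV hsupp u).comp ι.continuous⟩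
      map_add' := fun u v => by
        ext1 s
        simp only [ContinuousMap.add_apply, ContinuousMap.coe_mk, extend_add, map_add]
        exact integral_add (hi u _) (hi v _)
      map_smul' := fun r u => by
        ext1 s
        simp only [ContinuousMap.smul_apply, ContinuousMap.coe_mk, extend_smul, RingHom.id_apply]
        rw [← integral_smul]
        congr 1
        funext y
        rw [← Complex.coe_smul r (extend hρ u y), map_smul, map_smul, Complex.coe_smul] }
  -- Without a point of `S` the bound `σ` could be negative.
  rcases isEmpty_or_nonempty S with hS | ⟨⟨s₀⟩⟩
  · exact ⟨0, fun u s => (hS.false s).elim⟩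
  refine ⟨L₀.mkContinuous (c * (1 + σ + ρ) ^ n * (singConst * potNorm V)) fun u => ?_,
    fun u s => rfl⟩
  have h0 : 0 ≤ σ := (norm_nonneg _).trans (hσ s₀)
  have h1 := singConst_pos
  have h2 := potNorm_nonneg V
  have h3 := ha.nonneg
  rw [ContinuousMap.norm_le _ (by positivity)]
  exact fun s => ha.norm_integral_le hV hρ.le hsupp (norm_extend_le hρ u) (hσ s)

/-- Arzelà–Ascoli: the image of the unit ball is bounded, and equicontinuous by
`exists_equicontinuity_bound`. -/
lemma isCompactOperator_kernelOp (hV : IsPotential V) (hsupp : ∀ x, ρ < ‖x‖ → V x = 0)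
    {a : E3 → SpinorOp} (ha : LocallyIntegrable a volume) {L : BallFn ρ →L[ℝ] BallFn ρ}
    (hL : ∀ u s, L u s = ∫ y, a (s - y) (V y (extend hρ u y))) : IsCompactOperator L := by
  let e := ContinuousMap.linearIsometryBoundedOfCompact (Metric.closedBall (0 : E3) ρ) Spinor ℝ
  have key : IsCompactOperator (e.toLinearEquiv.toLinearMap ∘ₗ L.toLinearMap) := by
    rw [isCompactOperator_iff_isCompact_closure_image_closedBall (r := 1) _ one_pos]
    refine BoundedContinuousFunction.arzela_ascoli (Metric.closedBall (0 : Spinor) ‖L‖)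
      (isCompact_closedBall 0 _) _ ?_ ?_
    · rintro _ x ⟨u, hu, rfl⟩
      rw [mem_closedBall_zero_iff] at hu ⊢
      refine (ContinuousMap.norm_coe_le_norm (L u) x).trans ((L.le_opNorm u).trans ?_)
      nlinarith [norm_nonneg L]
    · intro x₀
      rw [Metric.equicontinuousAt_iff]
      intro ε hε
      obtain ⟨δ, hδ, h⟩ := exists_equicontinuity_bound ha ρ ρ (normInf V) (half_pos hε)
      refine ⟨δ, hδ, fun x hx => ?_⟩
      rintro ⟨_, u, hu, rfl⟩
      rw [mem_closedBall_zero_iff] at hu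
      change dist (L u x₀) (L u x) < ε
      rw [dist_eq_norm, hL, hL]
      rw [dist_comm, Subtype.dist_eq, dist_eq_norm] at hx
      refine (h x₀ x (mem_closedBall_zero_iff.mp x₀.2) (mem_closedBall_zero_iff.mp x.2) hx
        (fun y => V y (extend hρ u y))
        (aesm_clm_apply hV.aesm (continuous_extend hρ u).aestronglyMeasurable) ?_
        (fun y hy => by simp [hsupp y hy])).trans_lt (half_lt_self hε)
      filter_upwards [norm_potential_extend_le hρ hV u] with y hy
      refine hy.trans ?_
      nlinarith [normInf_nonneg V]
  have h := IsCompactOperator.continuous_comp key e.symm.continuous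
  have he : (L : BallFn ρ → BallFn ρ) =
      e.symm ∘ (e.toLinearEquiv.toLinearMap ∘ₗ L.toLinearMap) := by
    funext u
    exact (e.symm_apply_apply (L u)).symm
  rw [he]
  exact h

end KernelOp

/-! ### Sesquilinear integrals -/

section Pairing

variable {V W : E3 → SpinorOp} {f g h : E3 → Spinor} {M M' : ℝ}

lemma inner_potential (hV : IsPotential V) (x : E3) (u w : Spinor) :
    inner ℂ u (V x w) = inner ℂ (V x u) w := by
  have h := hV.1 x
  rw [ContinuousLinearMap.isSelfAdjoint_iff'] at h
  conv_rhs => rw [← h]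
  rw [ContinuousLinearMap.adjoint_inner_left]

/-- A bound on `h` is asked only where `V` is nonzero, since the expansion in `k` is controlled only
on the support of `A`. -/
lemma norm_inner_potential_le {x : E3} (hM : ∀ x, ‖f x‖ ≤ M) (hM' : V x ≠ 0 → ‖h x‖ ≤ M') :
    ‖inner ℂ (V x (f x)) (h x)‖ ≤ ‖V x‖ * (M * M') := by
  by_cases hx : V x = 0
  · simp [hx]
  · have h1 := hM x
    have h2 := hM' hx
    calc ‖inner ℂ (V x (f x)) (h x)‖ ≤ ‖V x (f x)‖ * ‖h x‖ := norm_inner_le_norm _ _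
      _ ≤ (‖V x‖ * ‖f x‖) * ‖h x‖ := by gcongr; exact (V x).le_opNorm _
      _ ≤ (‖V x‖ * M) * M' := by gcongr; exact mul_nonneg (norm_nonneg _) ((norm_nonneg _).trans h1)
      _ = _ := by ring

lemma integrable_inner_potential (hV : IsPotential V) (hf : Continuous f)
    (hM : ∀ x, ‖f x‖ ≤ M) (hh : Continuous h) (hM' : ∀ x, ‖h x‖ ≤ M') :
    Integrable fun x => inner ℂ (V x (f x)) (h x) :=
  (hV.integrable.norm.mul_const (M * M')).mono'
    ((aesm_clm_apply hV.aesm hf.aestronglyMeasurable).inner hh.aestronglyMeasurable)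
    (Eventually.of_forall fun x => norm_inner_potential_le hM fun _ => hM' x)

lemma norm_integral_inner_potential_le (hV : IsPotential V) (hM : ∀ x, ‖f x‖ ≤ M)
    (hM' : ∀ x, V x ≠ 0 → ‖h x‖ ≤ M') :
    ‖∫ x, inner ℂ (V x (f x)) (h x)‖ ≤ normOne V * (M * M') := by
  refine (norm_integral_le_of_norm_le (hV.integrable.norm.mul_const (M * M'))
    (Eventually.of_forall fun x => norm_inner_potential_le hM (hM' x))).trans ?_
  rw [integral_mul_const, integral_norm_eq_normOne hV.2.1]

lemma pairing_eq (hV : IsPotential V) (f g : E3 → Spinor) :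
    pairing f V g = ∫ x, inner ℂ (V x (f x)) (g x) := by
  simp only [pairing, inner_potential hV]

lemma norm_pairing_le (hV : IsPotential V) (hM : ∀ x, ‖f x‖ ≤ M) :
    ‖pairing f V f‖ ≤ normOne V * (M * M) := by
  rw [pairing_eq hV]
  exact norm_integral_inner_potential_le hV hM fun x _ => hM x

/-- Hermiticity of the potential. The reality of `⟨Φ, B, Φ⟩` is what prevents cancellation against
the imaginary resonance term. -/
lemma pairing_self_im (hV : IsPotential V) (f : E3 → Spinor) : (pairing f V f).im = 0 := by
  rw [← Complex.conj_eq_iff_im, pairing, ← integral_conj]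
  simp only [inner_conj_symm, inner_potential hV]

/-- Symmetry of the zero energy operator: `⟨V f, T^W g⟩ = ⟨T^V f, W g⟩`. -/
lemma integral_inner_opT_symm (hV : IsPotential V) (hW : IsPotential W) (hf : Continuous f)
    (hM : ∀ x, ‖f x‖ ≤ M) (hg : Continuous g) (hM' : ∀ x, ‖g x‖ ≤ M') :
    ∫ x, inner ℂ (V x (f x)) (opT W 0 g x) = ∫ y, inner ℂ (opT V 0 f y) (W y (g y)) := by
  have hM0 : 0 ≤ M := (norm_nonneg _).trans (hM 0)
  have hM0' : 0 ≤ M' := (norm_nonneg _).trans (hM' 0)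
  have hc := diracConst_pos
  have hVf := aesm_clm_apply hV.aesm hf.aestronglyMeasurable
  have hWg := aesm_clm_apply hW.aesm hg.aestronglyMeasurable
  set H : E3 → E3 → ℂ := fun x y => inner ℂ (V x (f x)) (green 0 (x - y) (W y (g y))) with hH
  have hHm : AEStronglyMeasurable (Function.uncurry H) (volume.prod volume) := by
    refine (hVf.comp_fst).inner (aesm_clm_apply ?_ hWg.comp_snd)
    exact ((measurable_green 0).comp (measurable_fst.sub measurable_snd)).aestronglyMeasurable
  have hHle : ∀ x y, ‖H x y‖ ≤
      (‖V x‖ * M * (8 * diracConst * M')) * (sing (x - y) * ‖W y‖) := by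
    intro x y
    have h1 := norm_kernel_le (V := W y) (norm_green_le le_rfl zero_le_one (x - y)) (hM' y)
      (by have := one_le_sing (x - y); positivity)
    have h2 : ‖V x (f x)‖ ≤ ‖V x‖ * M :=
      ((V x).le_opNorm _).trans (mul_le_mul_of_nonneg_left (hM x) (norm_nonneg _))
    calc ‖H x y‖ ≤ ‖V x (f x)‖ * ‖green 0 (x - y) (W y (g y))‖ := norm_inner_le_norm _ _
      _ ≤ (‖V x‖ * M) * (8 * diracConst * M' * (sing (x - y) * ‖W y‖)) := by gcongr
      _ = _ := by ring
  have hHx : ∀ x, Integrable (H x) := fun x => integrable_of_sing hW (x := x)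
    ((aestronglyMeasurable_const (b := V x (f x))).inner
      (aesm_kernel (measurable_green 0) hW.aesm hg.aestronglyMeasurable x))
    (Eventually.of_forall (hHle x))
  -- For Fubini: the inner integral is bounded uniformly in `x` by the `sing` estimate for `W`, and
  -- the outer one converges since `V` is in `L¹`.
  have hint : Integrable (Function.uncurry H) (volume.prod volume) := by
    rw [integrable_prod_iff hHm]
    refine ⟨Eventually.of_forall hHx, ?_⟩
    refine (hV.integrable.norm.mul_const
      (M * (8 * diracConst * M') * (singConst * potNorm W))).mono' hHm.norm.integral_prod_right' ?_
    refine Eventually.of_forall fun x => ?_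
    refine (norm_integral_le_of_sing hW (x := x)
      (c := ‖V x‖ * M * (8 * diracConst * M')) (by positivity)
      (Eventually.of_forall fun y => ?_)).trans (le_of_eq (by ring))
    rw [norm_norm]
    exact hHle x y
  have hswap := integral_integral_swap hint
  have hl : ∀ x, ∫ y, H x y = inner ℂ (V x (f x)) (opT W 0 g x) := fun x =>
    integral_inner (opT_integrable hW le_rfl zero_le_one hg.aestronglyMeasurable
      (Eventually.of_forall hM') x) _
  have hr : ∀ y, ∫ x, H x y = inner ℂ (opT V 0 f y) (W y (g y)) := by
    intro y
    rw [← inner_conj_symm, opT, ← integral_inner (opT_integrable hV le_rfl zero_le_one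
      hf.aestronglyMeasurable (Eventually.of_forall hM) y), ← integral_conj]
    congr 1
    funext x
    rw [hH, inner_conj_symm]
    simp only
    rw [inner_green_zero, neg_sub]
  simp_rw [hl, hr] at hswap
  exact hswap

end Pairing

/-! ### Zero energy solutions -/

section ZeroEnergy

variable {A : E3 → SpinorOp} {ρ : ℝ}

lemma isKernel_green {k : ℝ} (hk : 0 ≤ k) (hk1 : k ≤ 1) :
    IsKernel (green k) (8 * diracConst) 0 where
  measurable := measurable_green k
  nonneg := by have := diracConst_pos; positivity
  bound z := by simpa using norm_green_le hk hk1 z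

lemma continuous_of_mem_spaceN (hA : IsPotential A) (hsupp : ∀ x, ρ < ‖x‖ → A x = 0)
    {Φ : E3 → Spinor} (hΦ : Φ ∈ spaceN A) : Continuous Φ := by
  have : Φ = opT A 0 Φ := funext hΦ.2
  rw [this]
  exact continuous_opT hA hsupp le_rfl zero_le_one hΦ.1.1.1 (ae_norm_le_normInf hΦ.1.1)

/-- Far from the support the zero energy kernel is `O((|x| - ρ)⁻¹)`. This supplies the decay
required for membership in `𝓑`. -/
lemma tendsto_opT_zero (hA : IsPotential A) (hsupp : ∀ x, ρ < ‖x‖ → A x = 0)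
    {f : E3 → Spinor} {M : ℝ} (hM : ∀ x, ‖f x‖ ≤ M) :
    Tendsto (opT A 0 f) (cocompact E3) (𝓝 0) := by
  have hM0 : 0 ≤ M := (norm_nonneg _).trans (hM 0)
  have hc := diracConst_pos
  have h1 : Tendsto (fun x : E3 => ‖x‖ - ρ) (cocompact E3) atTop :=
    tendsto_atTop_add_const_right _ (-ρ) (tendsto_norm_cocompact_atTop)
  have h2 : Tendsto (fun x : E3 => normOne A * (4 * diracConst * M) * (‖x‖ - ρ)⁻¹)
      (cocompact E3) (𝓝 0) := by
    simpa using (tendsto_inv_atTop_zero.comp h1).const_mul (normOne A * (4 * diracConst * M))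
  refine squeeze_zero_norm' ?_ h2
  filter_upwards [h1.eventually_ge_atTop 1] with x hx
  have h0 : 0 ≤ (‖x‖ - ρ)⁻¹ := by rw [inv_nonneg]; linarith
  refine (norm_integral_le_of_norm_le
    (hA.integrable.norm.mul_const ((4 * diracConst * M) * (‖x‖ - ρ)⁻¹))
    (Eventually.of_forall fun y => ?_)).trans (le_of_eq ?_)
  · rcases le_or_gt ‖y‖ ρ with hy | hy
    · have h3 : ‖x‖ - ρ ≤ ‖x - y‖ := by linarith [norm_sub_norm_le x y]
      have h4 : ‖x - y‖⁻¹ ≤ (‖x‖ - ρ)⁻¹ := inv_anti₀ (by linarith) h3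
      have h5 : ‖x - y‖⁻¹ ≤ 1 := inv_le_one_of_one_le₀ (by linarith)
      have h6 : 0 ≤ ‖x - y‖⁻¹ := by positivity
      have h7 := norm_green_zero_le (x - y)
      have h8 : ‖green 0 (x - y)‖ ≤ 4 * diracConst * (‖x‖ - ρ)⁻¹ := by
        refine h7.trans ?_
        have : ‖x - y‖⁻¹ + ‖x - y‖⁻¹ ^ 2 ≤ 2 * (‖x‖ - ρ)⁻¹ := by nlinarith
        nlinarith
      refine (norm_kernel_le (V := A y) h8 (hM y) (by positivity)).trans (le_of_eq (by ring))
    · simp [hsupp y hy]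
  · rw [integral_mul_const, integral_norm_eq_normOne hA.2.1]; ring

lemma opT_smul (k r : ℝ) (f : E3 → Spinor) (x : E3) :
    opT A k (fun y => r • f y) x = r • opT A k f x := by
  rw [opT, opT, ← integral_smul]
  congr 1
  funext y
  rw [← Complex.coe_smul r (f y), map_smul, map_smul, Complex.coe_smul]

lemma smul_mem_spaceN {Φ : E3 → Spinor} (hΦ : Φ ∈ spaceN A) (r : ℝ) :
    (fun x => r • Φ x) ∈ spaceN A := by
  refine ⟨⟨hΦ.1.1.const_smul r, ?_⟩, fun x => ?_⟩
  · simpa using hΦ.1.2.const_smul r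
  · rw [opT_smul, ← hΦ.2 x]

lemma normInf_smul (r : ℝ) (f : E3 → Spinor) : normInf (fun x => r • f x) = |r| * normInf f := by
  rw [normInf, normInf, show (fun x => r • f x) = r • f from rfl, eLpNorm_const_smul,
    ENNReal.toReal_mul, toReal_enorm, Real.norm_eq_abs]

lemma pairing_smul (r : ℝ) (V : E3 → SpinorOp) (f : E3 → Spinor) :
    pairing (fun x => r • f x) V (fun x => r • f x) = (r : ℂ) ^ 2 * pairing f V f := by
  rw [pairing, pairing, ← integral_const_mul]
  congr 1
  funext x
  rw [← Complex.coe_smul r (f x), map_smul, inner_smul_left, inner_smul_right, Complex.conj_ofReal]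
  ring

lemma normInf_pos (hA : IsPotential A) (hsupp : ∀ x, ρ < ‖x‖ → A x = 0)
    {Φ : E3 → Spinor} (hΦ : Φ ∈ spaceN A) (h0 : Φ ≠ 0) : 0 < normInf Φ := by
  obtain ⟨x, hx⟩ := Function.ne_iff.mp h0
  exact (norm_pos_iff.mpr hx).trans_le
    (norm_le_normInf hΦ.1.1 (continuous_of_mem_spaceN hA hsupp hΦ) x)

/-- The infimum in the definition of `alphaOne`. -/
def pairingInf (A B : E3 → SpinorOp) : ℝ :=
  sInf {t : ℝ | ∃ Φ ∈ spaceN A, normInf Φ = 1 ∧ t = ‖pairing Φ B Φ‖}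

lemma pairingInf_nonneg (A B : E3 → SpinorOp) : 0 ≤ pairingInf A B :=
  Real.sInf_nonneg (by rintro t ⟨Φ, -, -, rfl⟩; exact norm_nonneg _)

/-- Both sides are homogeneous of degree two under real scaling, so `Φ` may be normalized. -/
lemma pairingInf_mul_le (B : E3 → SpinorOp) {Φ : E3 → Spinor} (hΦ : Φ ∈ spaceN A)
    (h0 : 0 < normInf Φ) : pairingInf A B * normInf Φ ^ 2 ≤ ‖pairing Φ B Φ‖ := by
  have h1 : pairingInf A B ≤ ‖pairing (fun x => (normInf Φ)⁻¹ • Φ x) B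
      (fun x => (normInf Φ)⁻¹ • Φ x)‖ := by
    refine csInf_le ⟨0, ?_⟩ ⟨_, smul_mem_spaceN hΦ (normInf Φ)⁻¹, ?_, rfl⟩
    · rintro t ⟨Φ, -, -, rfl⟩; exact norm_nonneg _
    · rw [normInf_smul, abs_of_pos (inv_pos.mpr h0), inv_mul_cancel₀ h0.ne']
  rw [pairing_smul, norm_mul, norm_pow, Complex.norm_real, norm_inv,
    Real.norm_of_nonneg h0.le, inv_pow, inv_mul_eq_div, le_div_iff₀ (by positivity)] at h1
  exact h1

/-- A fixed point on the ball is continued to `ℝ³` by applying `T` once more rather than by the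
retraction; the result agrees with `v` on the ball, so `T` fixes it everywhere. -/
lemma opT_extend_mem_spaceN (hA : IsPotential A) (hρ : 0 < ρ) (hsupp : ∀ x, ρ < ‖x‖ → A x = 0)
    {v : BallFn ρ} (hv : ∀ s : Metric.closedBall (0 : E3) ρ, opT A 0 (extend hρ v) s = v s) :
    opT A 0 (extend hρ v) ∈ spaceN A := by
  have hc : Continuous (opT A 0 (extend hρ v)) := continuous_opT hA hsupp le_rfl zero_le_one
    (continuous_extend hρ v).aestronglyMeasurable (Eventually.of_forall (norm_extend_le hρ v))
  refine ⟨⟨memLp_top_of_continuous hc (norm_opT_le hA le_rfl zero_le_one (norm_nonneg v)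
    (Eventually.of_forall (norm_extend_le hρ v))), tendsto_opT_zero hA hsupp
    (norm_extend_le hρ v)⟩, fun x => ?_⟩
  refine congrFun (opT_congr hsupp 0 fun y hy => ?_) x
  rw [extend_of_norm_le hρ v hy]
  exact (hv ⟨y, _⟩).symm

/-- Functions are close to `𝓝` as soon as `(1 - T) f` is small, and `λ` is bounded below on
`𝓝` in the resonance case. -/
lemma exists_zeroEnergy_bounds (hA : IsPotential A) (hρ : 0 < ρ)
    (hsupp : ∀ x, ρ < ‖x‖ → A x = 0) (hlam : LamBarOne A) :
    (∃ C > 0, ∀ f : E3 → Spinor, Continuous f → ∀ M, (∀ x, ‖f x‖ ≤ M) → ∃ Φ ∈ spaceN A, ∀ γ,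
      (∀ x, ‖f x - opT A 0 f x‖ ≤ γ) → ∀ x, ‖f x - Φ x‖ ≤ C * γ) ∧
    ∃ c > 0, ∀ Φ ∈ spaceN A, c * normInf Φ ≤ ‖lam A Φ‖ := by
  have hbd : ∀ (v : BallFn ρ) (x : E3), ‖opT A 0 (extend hρ v) x‖ ≤
      8 * diracConst * (singConst * potNorm A) * ‖v‖ := fun v x =>
    (norm_opT_le hA le_rfl zero_le_one (norm_nonneg v)
      (Eventually.of_forall (norm_extend_le hρ v)) x).trans (le_of_eq (by ring))
  set c₁ := 8 * diracConst * (singConst * potNorm A) with hc₁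
  have hc₁0 : 0 ≤ c₁ := by
    have := diracConst_pos; have := singConst_pos; have := potNorm_nonneg A
    positivity
  obtain ⟨T, hT⟩ := exists_kernelOp hρ (⟨Subtype.val, continuous_subtype_val⟩ :
    C(Metric.closedBall (0 : E3) ρ, E3)) hA hsupp (isKernel_green le_rfl zero_le_one)
  have hT' : ∀ u s, T u s = opT A 0 (extend hρ u) s := hT
  have hcomp : IsCompactOperator T :=
    isCompactOperator_kernelOp hρ hA hsupp (locallyIntegrable_green le_rfl zero_le_one) hT
  obtain ⟨N, hfin, hN, C, hC, hnear⟩ := exists_fixedPoint_near_of_isCompactOperator hcomp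
  have hfix : ∀ v ∈ N, ∀ s : Metric.closedBall (0 : E3) ρ, opT A 0 (extend hρ v) s = v s := by
    intro v hv s
    rw [← hT', (hN v).mp hv]
  constructor
  · refine ⟨1 + c₁ * C, by positivity, fun f hf M hM => ?_⟩
    set u := restrictBall ρ hf with hu
    obtain ⟨z, hz, hz'⟩ := hnear u
    have hTf : opT A 0 f = opT A 0 (extend hρ u) :=
      opT_congr hsupp 0 fun y hy => by rw [extend_of_norm_le hρ u hy]; rfl
    refine ⟨opT A 0 (extend hρ z), opT_extend_mem_spaceN hA hρ hsupp (hfix z hz),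
      fun γ hγ x => ?_⟩
    have hγ0 : 0 ≤ γ := (norm_nonneg _).trans (hγ 0)
    have h1 : ‖u - T u‖ ≤ γ := by
      rw [ContinuousMap.norm_le _ hγ0]
      intro s
      rw [ContinuousMap.sub_apply, hT', ← hTf]
      exact hγ s
    have h2 : opT A 0 (extend hρ (u - z)) x =
        opT A 0 (extend hρ u) x - opT A 0 (extend hρ z) x :=
      opT_sub hA le_rfl zero_le_one (continuous_extend hρ u).aestronglyMeasurable
        (Eventually.of_forall (norm_extend_le hρ u))
        (continuous_extend hρ z).aestronglyMeasurable
        (Eventually.of_forall (norm_extend_le hρ z)) x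
    -- The residual is estimated everywhere, while `u - z` is controlled only on the ball and
    -- reaches other points through `T`. Hence the constant `1 + c₁ * C`.
    have h3 : f x - opT A 0 (extend hρ z) x =
        (f x - opT A 0 f x) + opT A 0 (extend hρ (u - z)) x := by
      rw [h2, hTf]; abel
    rw [h3]
    refine (norm_add_le _ _).trans ?_
    have h4 := hbd (u - z) x
    have h5 : ‖u - z‖ ≤ C * γ := hz'.trans (mul_le_mul_of_nonneg_left h1 hC.le)
    have h6 := mul_le_mul_of_nonneg_left h5 hc₁0
    linarith [hγ x]
  · have hi : ∀ v : BallFn ρ, Integrable fun y =>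
        (ContinuousLinearMap.id ℂ Spinor + betaOp) (A y (extend hρ v y)) := by
      intro v
      refine ContinuousLinearMap.integrable_comp _ ?_
      refine (hA.integrable.norm.mul_const ‖v‖).mono'
        (aesm_clm_apply hA.aesm (continuous_extend hρ v).aestronglyMeasurable)
        (Eventually.of_forall fun y => ?_)
      exact ((A y).le_opNorm _).trans
        (mul_le_mul_of_nonneg_left (norm_extend_le hρ v y) (norm_nonneg _))
    let Λ : N →ₗ[ℝ] Spinor :=
      { toFun := fun v => lam A (extend hρ (v : BallFn ρ))
        map_add' := fun v w => by
          unfold lam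
          rw [← integral_add (hi v) (hi w)]
          simp only [Submodule.coe_add, extend_add, map_add]
        map_smul' := fun r v => by
          unfold lam
          rw [RingHom.id_apply, ← integral_smul]
          congr 1
          funext y
          rw [Submodule.coe_smul, extend_smul, ← Complex.coe_smul r (extend hρ (v : BallFn ρ) y),
            map_smul, map_smul, Complex.coe_smul] }
    have hlamcongr : ∀ f g : E3 → Spinor, (∀ y, ‖y‖ ≤ ρ → f y = g y) → lam A f = lam A g := by
      intro f g hfg
      unfold lam
      congr 1
      funext y
      rcases le_or_gt ‖y‖ ρ with hy | hy
      · rw [hfg y hy]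
      · simp [hsupp y hy]
    -- The resonance condition says that `λ` is injective on the fixed space; finite dimension
    -- upgrades this to a lower bound.
    have hker : Λ.ker = ⊥ := by
      rw [LinearMap.ker_eq_bot']
      intro v hv
      have hv' : lam A (extend hρ (v : BallFn ρ)) = 0 := hv
      by_contra hne
      refine hlam _ (opT_extend_mem_spaceN hA hρ hsupp (hfix v v.2)) ?_ ?_
      · intro h0
        apply hne
        apply Subtype.ext
        ext1 s
        rw [← hfix v v.2 s, h0]; rfl
      · rw [← hv']
        refine hlamcongr _ _ fun y hy => ?_
        rw [extend_of_norm_le hρ _ hy]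
        exact hfix v v.2 ⟨y, _⟩
    obtain ⟨κ, hκ, hanti⟩ := Λ.exists_antilipschitzWith hker
    -- The summand `1` keeps the constant positive when only `0 ≤ c₁` is known.
    refine ⟨((c₁ + 1) * κ)⁻¹, by positivity, fun Φ hΦ => ?_⟩
    have hΦc := continuous_of_mem_spaceN hA hsupp hΦ
    set v := restrictBall ρ hΦc with hv
    have hve : ∀ y, ‖y‖ ≤ ρ → Φ y = extend hρ v y := fun y hy => by
      rw [extend_of_norm_le hρ v hy]; rfl
    have hTΦ : opT A 0 (extend hρ v) = Φ := by
      rw [← opT_congr hsupp 0 hve]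
      exact (funext hΦ.2).symm
    have hvN : v ∈ N := by
      rw [hN]
      ext1 s
      rw [hT', hTΦ]; rfl
    have h1 : ‖v‖ ≤ κ * ‖lam A Φ‖ := by
      have h2 := hanti.le_mul_dist ⟨v, hvN⟩ 0
      rw [dist_zero_right, map_zero, dist_zero_right] at h2
      rw [hlamcongr _ _ hve]
      exact h2
    have h2 : normInf Φ ≤ c₁ * ‖v‖ :=
      normInf_le (by positivity) fun x => by rw [← hTΦ]; exact hbd v x
    rw [inv_mul_le_iff₀ (by positivity)]
    have h3 := mul_le_mul_of_nonneg_left h1 hc₁0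
    have h4 : 0 ≤ (κ : ℝ) * ‖lam A Φ‖ := by positivity
    linarith

end ZeroEnergy

/-! ### The a priori estimate -/

section Apriori

variable {A B : E3 → SpinorOp} {ρ R k : ℝ}

lemma integrable_potential_apply (hA : IsPotential A) {f : E3 → Spinor} (hf : Continuous f) {M : ℝ}
    (hM : ∀ x, ‖f x‖ ≤ M) : Integrable fun y => A y (f y) :=
  (hA.integrable.norm.mul_const M).mono' (aesm_clm_apply hA.aesm hf.aestronglyMeasurable)
    (Eventually.of_forall fun y => ((A y).le_opNorm _).trans
      (mul_le_mul_of_nonneg_left (hM y) (norm_nonneg _)))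

lemma norm_opT_perturbed_sub_le (hA : IsPotential A) (hB : IsPotential B) (hk : 0 ≤ k)
    (hk1 : k ≤ 1) {f : E3 → Spinor} (hf : Continuous f) {M : ℝ} (hM : ∀ x, ‖f x‖ ≤ M) (x : E3) :
    ‖opT (fun y => A y + B y) k f x - opT A 0 f x‖ ≤
      16 * diracConst * singConst * (potNorm A + 1) * (k + potNorm B) * M := by
  have hM0 : 0 ≤ M := (norm_nonneg _).trans (hM 0)
  have hc := diracConst_pos
  have hs := singConst_pos
  have ha := potNorm_nonneg A
  have hb := potNorm_nonneg B
  have hM' : ∀ᵐ x, ‖f x‖ ≤ M := Eventually.of_forall hM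
  rw [opT_add_potential hA hB hk hk1 hf.aestronglyMeasurable hM']
  have h1 := norm_opT_sub_le hA hk hk1 hf.aestronglyMeasurable hM0 hM' x
  have h2 := norm_opT_le hB hk hk1 hM0 hM' x
  rw [add_sub_right_comm]
  refine (norm_add_le _ _).trans ((add_le_add h1 h2).trans ?_)
  have h3 : 0 ≤ diracConst * singConst * M := by positivity
  have h4 : 0 ≤ diracConst * singConst * M * (k + potNorm A * potNorm B + potNorm B) := by
    positivity
  nlinarith

/-- First order expansion in `k` of the operator of the unperturbed potential. -/
lemma norm_opT_taylor_le (hA : IsPotential A) (hsupp : ∀ x, ρ < ‖x‖ → A x = 0) (hρ : 0 ≤ ρ)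
    (hk : 0 ≤ k) (hk1 : k ≤ 1) {f : E3 → Spinor} (hf : Continuous f) {M : ℝ}
    (hM : ∀ x, ‖f x‖ ≤ M) {x : E3} (hx : ‖x‖ ≤ ρ) :
    ‖opT A k f x - opT A 0 f x - (k : ℂ) • greenDeriv (∫ y, A y (f y))‖ ≤
      12 * diracConst * (1 + 2 * ρ) * (singConst * potNorm A) * k ^ 2 * M := by
  have hM0 : 0 ≤ M := (norm_nonneg _).trans (hM 0)
  have hc := diracConst_pos
  have hM' : ∀ᵐ x, ‖f x‖ ≤ M := Eventually.of_forall hM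
  have hi := integrable_potential_apply hA hf hM
  have h1 := opT_integrable hA hk hk1 hf.aestronglyMeasurable hM' x
  have h2 := opT_integrable hA le_rfl zero_le_one hf.aestronglyMeasurable hM' x
  have h12 : Integrable fun y => green k (x - y) (A y (f y)) - green 0 (x - y) (A y (f y)) :=
    h1.sub h2
  rw [opT, opT, ← smul_apply, ← ContinuousLinearMap.integral_comp_comm _ hi,
    ← integral_sub h1 h2, ← integral_sub h12 (ContinuousLinearMap.integrable_comp _ hi)]
  refine (norm_integral_le_of_sing hA (x := x)
    (c := 12 * diracConst * k ^ 2 * (1 + 2 * ρ) * M) (by positivity) ?_).trans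
    (le_of_eq (by ring))
  -- The expansion of the Green's function fails at the origin.
  have hne : ∀ᵐ y : E3, y ≠ x := by
    rw [ae_iff]; simp
  filter_upwards [hne] with y hy
  rcases le_or_gt ‖y‖ ρ with hyρ | hyρ
  · have hz : x - y ≠ 0 := sub_ne_zero.mpr (Ne.symm hy)
    have hs := one_le_sing (x - y)
    rw [← sub_apply, ← sub_apply]
    refine norm_kernel_le ((norm_green_taylor_le hk hz).trans ?_) (hM y) (by positivity)
    have : ‖x - y‖ ≤ 2 * ρ := by linarith [norm_sub_le x y]
    rw [mul_assoc (12 * diracConst * k ^ 2)]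
    gcongr
  · simp [hsupp y hyρ]

/-- As `greenDeriv` is constant, the integral collapses to a quadratic form in `J = ∫ A Φ`. The
factor `-i/(4π)` and `⟨J, (1 + β) J⟩ = |λ(Φ)|²/2` make the result purely imaginary with a definite
sign. -/
lemma inner_greenDeriv (hA : IsPotential A) {Φ : E3 → Spinor} (hΦ : Continuous Φ) {M : ℝ}
    (hM : ∀ x, ‖Φ x‖ ≤ M) :
    ∫ x, inner ℂ (A x (Φ x)) ((k : ℂ) • greenDeriv (∫ y, A y (Φ y))) =
      -((k * (8 * Real.pi)⁻¹ * ‖lam A Φ‖ ^ 2 : ℝ) : ℂ) * Complex.I := by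
  have hi := integrable_potential_apply hA hΦ hM
  set J := ∫ y, A y (Φ y) with hJ
  have h1 : ∫ x, inner ℂ (A x (Φ x)) ((k : ℂ) • greenDeriv J) =
      inner ℂ J ((k : ℂ) • greenDeriv J) := by
    rw [← inner_conj_symm, hJ, ← integral_inner hi, ← integral_conj]
    simp only [inner_conj_symm]
  have h2 : lam A Φ = (ContinuousLinearMap.id ℂ Spinor + betaOp) J :=
    ContinuousLinearMap.integral_comp_comm _ hi
  rw [h1, h2, greenDeriv, smul_apply, inner_smul_right, inner_smul_right, inner_id_add_betaOp]
  push_cast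
  ring

/-- Symmetry moves `T^A_1` from `f` onto `Φ`, which it fixes. -/
lemma integral_inner_sub_opT_eq_zero (hA : IsPotential A) (hsupp : ∀ x, ρ < ‖x‖ → A x = 0)
    {Φ : E3 → Spinor} (hΦ : Φ ∈ spaceN A) {f : E3 → Spinor} (hf : Continuous f) {M : ℝ}
    (hM : ∀ x, ‖f x‖ ≤ M) : ∫ x, inner ℂ (A x (Φ x)) (f x - opT A 0 f x) = 0 := by
  have hΦc := continuous_of_mem_spaceN hA hsupp hΦ
  have hΦn := norm_le_normInf hΦ.1.1 hΦc
  have hM' : ∀ᵐ x, ‖f x‖ ≤ M := Eventually.of_forall hM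
  have hM0 : 0 ≤ M := (norm_nonneg _).trans (hM 0)
  simp only [inner_sub_right]
  rw [integral_sub (integrable_inner_potential hA hΦc hΦn hf hM)
    (integrable_inner_potential hA hΦc hΦn
      (continuous_opT hA hsupp le_rfl zero_le_one hf.aestronglyMeasurable hM')
      (norm_opT_le hA le_rfl zero_le_one hM0 hM')),
    integral_inner_opT_symm hA hA hΦc hΦn hf hM, sub_eq_zero]
  congr 1
  funext x
  rw [← hΦ.2 x, inner_potential hA]

/-- Expansion of the perturbed operator on the zero energy solutions. -/
lemma norm_integral_inner_expansion_le (hA : IsPotential A) (hsupp : ∀ x, ρ < ‖x‖ → A x = 0)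
    (hρ : 0 ≤ ρ) (hB : IsPotential B) (hsuppB : ∀ x, R < ‖x‖ → B x = 0) (hk : 0 ≤ k)
    (hk1 : k ≤ 1) {Φ : E3 → Spinor} (hΦ : Φ ∈ spaceN A) :
    ‖(∫ x, inner ℂ (A x (Φ x)) (opT (fun y => A y + B y) k Φ x - opT A 0 Φ x)) -
        (pairing Φ B Φ - ((k * (8 * Real.pi)⁻¹ * ‖lam A Φ‖ ^ 2 : ℝ) : ℂ) * Complex.I)‖ ≤
      normOne A * (16 * diracConst * (1 + 2 * ρ) * singConst * (potNorm A + 1)) *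
        (k ^ 2 + k * potNorm B) * normInf Φ ^ 2 := by
  have hΦc := continuous_of_mem_spaceN hA hsupp hΦ
  have hΦn := norm_le_normInf hΦ.1.1 hΦc
  have hn0 := normInf_nonneg Φ
  have hΦa : ∀ᵐ x, ‖Φ x‖ ≤ normInf Φ := Eventually.of_forall hΦn
  have hm := hΦc.aestronglyMeasurable (μ := (volume : Measure E3))
  have hAB := hA.add hB
  have hsuppAB : ∀ x, max ρ R < ‖x‖ → A x + B x = 0 := fun x hx => by
    rw [hsupp x ((le_max_left _ _).trans_lt hx),
      hsuppB x ((le_max_right _ _).trans_lt hx), add_zero]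
  set D : E3 → Spinor := fun x => opT (fun y => A y + B y) k Φ x - opT A 0 Φ x with hD
  set G : Spinor := (k : ℂ) • greenDeriv (∫ y, A y (Φ y)) with hG
  have hDc : Continuous D := (continuous_opT hAB hsuppAB hk hk1 hm hΦa).sub
    (continuous_opT hA hsupp le_rfl zero_le_one hm hΦa)
  have hBc : Continuous (opT B 0 Φ) := continuous_opT hB hsuppB le_rfl zero_le_one hm hΦa
  have i1 := integrable_inner_potential hA hΦc hΦn hDc
    (norm_opT_perturbed_sub_le hA hB hk hk1 hΦc hΦn)
  have i2 := integrable_inner_potential hA hΦc hΦn hBc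
    (norm_opT_le hB le_rfl zero_le_one hn0 hΦa)
  have i3 := integrable_inner_potential hA hΦc hΦn (continuous_const (y := G)) (fun _ => le_rfl)
  -- Symmetry with two different potentials: `⟨A Φ, T^B Φ⟩ = ⟨T^A Φ, B Φ⟩ = ⟨Φ, B Φ⟩` at zero
  -- energy.
  have hp : pairing Φ B Φ = ∫ x, inner ℂ (A x (Φ x)) (opT B 0 Φ x) := by
    rw [integral_inner_opT_symm hA hB hΦc hΦn hΦc hΦn, pairing]
    congr 1
    funext x
    rw [← hΦ.2 x]
  have key : (∫ x, inner ℂ (A x (Φ x)) (D x)) -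
      (pairing Φ B Φ - ((k * (8 * Real.pi)⁻¹ * ‖lam A Φ‖ ^ 2 : ℝ) : ℂ) * Complex.I) =
      ∫ x, inner ℂ (A x (Φ x)) (D x - opT B 0 Φ x - G) := by
    have i12 : Integrable fun x => inner ℂ (A x (Φ x)) (D x) -
        inner ℂ (A x (Φ x)) (opT B 0 Φ x) := i1.sub i2
    simp only [inner_sub_right]
    rw [integral_sub i12 i3, integral_sub i1 i2, ← hp, inner_greenDeriv hA hΦc hΦn]
    ring
  rw [key]
  have hc := diracConst_pos
  have hs := singConst_pos
  have ha := potNorm_nonneg A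
  have hb := potNorm_nonneg B
  refine (norm_integral_inner_potential_le hA hΦn (M' := 16 * diracConst * (1 + 2 * ρ) *
    singConst * (potNorm A + 1) * (k ^ 2 + k * potNorm B) * normInf Φ) fun x hx => ?_).trans
    (le_of_eq (by ring))
  have hxρ : ‖x‖ ≤ ρ := by
    by_contra! h
    exact hx (hsupp x h)
  have e1 := norm_opT_taylor_le hA hsupp hρ hk hk1 hΦc hΦn hxρ
  have e2 := norm_opT_sub_le hB hk hk1 hm hn0 hΦa x
  have e3 : D x - opT B 0 Φ x - G = (opT A k Φ x - opT A 0 Φ x - G) +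
      (opT B k Φ x - opT B 0 Φ x) := by
    simp only [hD]
    rw [opT_add_potential hA hB hk hk1 hm hΦa]
    abel
  rw [e3]
  refine (norm_add_le _ _).trans ((add_le_add e1 e2).trans ?_)
  have h1 : 12 * diracConst * (1 + 2 * ρ) * (singConst * potNorm A) * k ^ 2 * normInf Φ ≤
      16 * diracConst * (1 + 2 * ρ) * (singConst * (potNorm A + 1)) * k ^ 2 * normInf Φ := by
    gcongr <;> linarith
  have h2 : 16 * diracConst * k * normInf Φ * (singConst * potNorm B) ≤
      16 * diracConst * (1 + 2 * ρ) * (singConst * (potNorm A + 1)) * (k * potNorm B) *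
        normInf Φ := by
    have h3 : 1 ≤ (1 + 2 * ρ) * (potNorm A + 1) := by nlinarith [mul_nonneg hρ ha]
    have h4 : 0 ≤ 16 * diracConst * k * normInf Φ * (singConst * potNorm B) := by positivity
    calc _ = 16 * diracConst * k * normInf Φ * (singConst * potNorm B) * 1 := by ring
      _ ≤ 16 * diracConst * k * normInf Φ * (singConst * potNorm B) *
          ((1 + 2 * ρ) * (potNorm A + 1)) := mul_le_mul_of_nonneg_left h3 h4
      _ = _ := by ring
  linarith

/-- Admissible perturbations are small. -/
lemma potNorm_le_of_mem_setW (hA : IsPotential A) (hsupp : ∀ x, ρ < ‖x‖ → A x = 0)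
    (hcrit : IsCritical A) {K : ℝ} (hK : 0 ≤ K) (hB : B ∈ setW A K) : potNorm B ≤ K := by
  obtain ⟨Φ, hΦ, hne⟩ := hcrit
  have h0 := normInf_pos hA hsupp hΦ hne
  have hn := norm_le_normInf hΦ.1.1 (continuous_of_mem_spaceN hA hsupp hΦ)
  have h1 := hB.2 Φ hΦ
  have h2 := norm_pairing_le hB.1 hn
  have h3 : normOne B ≤ potNorm B := le_add_of_nonneg_right (normInf_nonneg B)
  have hb := potNorm_nonneg B
  -- The defining inequality of `𝓦_K` is quadratic in `B` and the pairing is linear in it; dividing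
  -- bounds `potNorm B` by `K`. Criticality provides the nonzero `Φ`.
  have h4 : normInf Φ ^ 2 * potNorm B ^ 2 ≤ normInf Φ ^ 2 * (K * potNorm B) := by
    calc normInf Φ ^ 2 * potNorm B ^ 2 ≤ K * ‖pairing Φ B Φ‖ := h1
      _ ≤ K * (potNorm B * (normInf Φ * normInf Φ)) := by gcongr; exact h2.trans (by gcongr)
      _ = _ := by ring
  have h5 := le_of_mul_le_mul_left h4 (by positivity)
  rcases hb.eq_or_lt with h | h
  · rw [← h]; exact hK
  · rw [sq] at h5
    exact le_of_mul_le_mul_right h5 h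

/-- Real and imaginary parts are each bounded by the modulus, so both survive. -/
lemma add_le_two_mul_norm_sub_mul_I {p l : ℝ} :
    |p| + |l| ≤ 2 * ‖(p : ℂ) - (l : ℂ) * Complex.I‖ := by
  have h1 := Complex.abs_re_le_norm ((p : ℂ) - (l : ℂ) * Complex.I)
  have h2 := Complex.abs_im_le_norm ((p : ℂ) - (l : ℂ) * Complex.I)
  simp at h1 h2
  linarith

/-- The real arithmetic behind the a priori estimate. -/
lemma apriori_arith {M n γ k b s p l a D C E c δ : ℝ} (hn : 0 ≤ n) (hγ : 0 ≤ γ)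
    (hk : 0 < k) (hb : 0 ≤ b) (hs : 0 ≤ s) (ha : 0 ≤ a) (hD : 0 ≤ D) (hC : 0 < C)
    (hE : 0 ≤ E) (hc : 0 < c) (hc1 : c ≤ 1)
    (hδ1 : 4 * (C * D) * δ ≤ 1) (hδ2 : 16 * (a * C * D ^ 2) * δ ≤ 1)
    (hδ3 : 4 * (4 * (a * C * D ^ 2) + 2 * E) * δ ≤ c)
    (hkδ : k ≤ δ) (hbδ : b ≤ δ)
    (hM : M ≤ n + C * (γ + D * (k + b) * M))
    (hW : n ^ 2 * b ^ 2 ≤ δ * p) (hsn : s * n ^ 2 ≤ p) (hl : c * k * n ^ 2 ≤ l)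
    (hmain : (p + l) / 2 ≤
      a * (n * (γ + D * (k + b) * (C * (γ + D * (k + b) * M)))) + E * (k ^ 2 + k * b) * n ^ 2) :
    M ≤ (16 * a / c + 2 * C) * (1 + (s + k)⁻¹) * γ := by
  -- Meaning of the letters: `M = sup |f|`, `n = ‖Φ‖_∞`, `γ` bounds the residual, `b = potNorm B`,
  -- `p = |⟨Φ, B, Φ⟩|`, `s` is its infimum over normalized `Φ`, `l` is the resonance term, `a =
  -- ‖A‖₁`, `D * (k + b)` bounds the perturbation of the operator, and `C` measures the distance to
  -- `𝓝`.
  have hsk : 0 < s + k := by linarith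
  obtain ⟨t, ht⟩ : ∃ t, t = k + b := ⟨_, rfl⟩
  rw [← ht] at hM hmain
  have ht0 : 0 ≤ t := by linarith
  have hCγ : 0 ≤ C * γ := by positivity
  have hx : C * D * t ≤ 1 / 2 := by
    have : C * D * t ≤ C * D * (2 * δ) := by gcongr; linarith
    linarith
  -- Half of `M` is absorbed on the left; from here on only `n` has to be bounded.
  have hM0 : M ≤ 2 * n + 2 * (C * γ) := by
    rcases le_or_gt M 0 with h | h
    · linarith
    · have h1 := mul_le_mul_of_nonneg_right hx h.le
      have h2 : C * (γ + D * t * M) = C * γ + C * D * t * M := by ring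
      linarith
  have hη : C * (γ + D * t * M) ≤ 2 * (C * γ) + 2 * (C * D * t) * n := by
    have h1 : C * D * t * M ≤ C * D * t * (2 * n + 2 * (C * γ)) := by gcongr
    have h2 : C * D * t * (2 * (C * γ)) ≤ 1 / 2 * (2 * (C * γ)) := by gcongr
    have h3 : C * (γ + D * t * M) = C * γ + C * D * t * M := by ring
    have h4 : C * D * t * (2 * n + 2 * (C * γ)) =
      2 * (C * D * t) * n + C * D * t * (2 * (C * γ)) := by ring
    linarith
  have hη2 : D * t * (C * (γ + D * t * M)) ≤ γ + 2 * (C * D ^ 2) * t ^ 2 * n := by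
    have h1 := mul_le_mul_of_nonneg_left hη (mul_nonneg hD ht0)
    have h2 : C * D * t * γ ≤ 1 / 2 * γ := by gcongr
    have h3 : D * t * (2 * (C * γ) + 2 * (C * D * t) * n) =
      2 * (C * D * t * γ) + 2 * (C * D ^ 2) * t ^ 2 * n := by ring
    linarith
  have h3 : a * (n * (γ + D * t * (C * (γ + D * t * M)))) ≤
      a * (n * (γ + (γ + 2 * (C * D ^ 2) * t ^ 2 * n))) := by gcongr
  obtain ⟨Q, hQ⟩ : ∃ Q, Q = a * C * D ^ 2 := ⟨_, rfl⟩
  rw [← hQ] at hδ2 hδ3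
  have hQ0 : 0 ≤ Q := by rw [hQ]; positivity
  have h4 : a * (n * (γ + (γ + 2 * (C * D ^ 2) * t ^ 2 * n))) ≤
      2 * (a * n * γ) + 4 * Q * k ^ 2 * n ^ 2 + 4 * Q * (n ^ 2 * b ^ 2) := by
    have h5 : t ^ 2 ≤ 2 * k ^ 2 + 2 * b ^ 2 := by rw [ht]; nlinarith [sq_nonneg (k - b)]
    have h6 : 2 * Q * n ^ 2 * t ^ 2 ≤ 2 * Q * n ^ 2 * (2 * k ^ 2 + 2 * b ^ 2) := by gcongr
    have h7 : a * (n * (γ + (γ + 2 * (C * D ^ 2) * t ^ 2 * n))) =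
      2 * (a * n * γ) + 2 * Q * n ^ 2 * t ^ 2 := by rw [hQ]; ring
    linarith
  have hp : 0 ≤ p := le_trans (by positivity) hsn
  -- The error quadratic in `B` is absorbed by the real part, through membership in `𝓦_δ`.
  have h5 : 4 * Q * (n ^ 2 * b ^ 2) ≤ p / 4 := by
    have h6 : 4 * Q * (n ^ 2 * b ^ 2) ≤ 4 * Q * (δ * p) := by gcongr
    have h7 := mul_le_mul_of_nonneg_right hδ2 hp
    linarith
  -- All other errors contain `k` times a small factor and are absorbed by the resonance term.
  have h6 : 4 * Q * k ^ 2 * n ^ 2 + E * (k ^ 2 + k * b) * n ^ 2 ≤ c * k * n ^ 2 / 4 := by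
    have h7 : 4 * Q * k ^ 2 + E * (k ^ 2 + k * b) ≤ c * k / 4 := by
      have e1 : 4 * Q * k ^ 2 ≤ 4 * Q * (k * δ) := by rw [sq]; gcongr
      have e2 : E * (k ^ 2 + k * b) ≤ E * (k * δ + k * δ) := by rw [sq]; gcongr
      have e3 := mul_le_mul_of_nonneg_left hδ3 hk.le
      linarith
    have := mul_le_mul_of_nonneg_right h7 (sq_nonneg n)
    linarith
  have h7 : (s + c * k) * n ^ 2 ≤ 8 * (a * n * γ) := by linarith
  have h8 : c * (s + k) * n ^ 2 ≤ 8 * (a * n * γ) := by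
    refine le_trans (mul_le_mul_of_nonneg_right ?_ (sq_nonneg n)) h7
    have := mul_le_mul_of_nonneg_right hc1 hs
    linarith
  have h9 : n ≤ 8 * a / c * (s + k)⁻¹ * γ := by
    rcases hn.eq_or_lt with h | h
    · rw [← h]; positivity
    · have h10 : (c * (s + k)) * n ≤ 8 * a * γ := by
        refine le_of_mul_le_mul_right ?_ h
        linarith
      rw [show 8 * a / c * (s + k)⁻¹ * γ = (8 * a * γ) / (c * (s + k)) by field_simp]
      rw [le_div_iff₀ (by positivity)]
      linarith
  have h10 : 0 ≤ 16 * a / c * γ := by positivity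
  have h11 : 0 ≤ 2 * C * (s + k)⁻¹ * γ := by positivity
  calc M ≤ 2 * n + 2 * (C * γ) := hM0
    _ ≤ 2 * (8 * a / c * (s + k)⁻¹ * γ) + 2 * (C * γ) := by gcongr
    _ ≤ _ := by
      have : (16 * a / c + 2 * C) * (1 + (s + k)⁻¹) * γ =
        2 * (8 * a / c * (s + k)⁻¹ * γ) + 2 * (C * γ) + 16 * a / c * γ
          + 2 * C * (s + k)⁻¹ * γ := by ring
      linarith

/-- Testing against `A Φ`, with `Φ ∈ 𝓝` close to `f`, bounds the component of `f` along the kernel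
of `1 - T^A_1`. The constants `δ` and `C` are fixed before `B` and `R`, so they do not depend on the
support of `B`. -/
theorem exists_apriori_bound (hA : IsPotential A) (hρ : 0 < ρ)
    (hsupp : ∀ x, ρ < ‖x‖ → A x = 0) (hcrit : IsCritical A) (hlam : LamBarOne A) :
    ∃ δ > 0, δ ≤ 1 ∧ ∃ C > 0, ∀ B ∈ setW A δ, ∀ R, (∀ x, R < ‖x‖ → B x = 0) → ∀ k, 0 < k → k < δ →
      ∀ f : E3 → Spinor, Continuous f → ∀ M, (∀ x, ‖f x‖ ≤ M) → ∀ γ,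
        (∀ x, ‖f x - opT (fun y => A y + B y) k f x‖ ≤ γ) →
          ∀ x, ‖f x‖ ≤ C * alphaOne A B k * γ := by
  obtain ⟨⟨C, hC, hnear⟩, c₀, hc₀, hlow⟩ := exists_zeroEnergy_bounds hA hρ hsupp hlam
  obtain ⟨a, ha⟩ : ∃ a, a = normOne A := ⟨_, rfl⟩
  obtain ⟨D, hD⟩ : ∃ D, D = 16 * diracConst * singConst * (potNorm A + 1) := ⟨_, rfl⟩
  obtain ⟨E, hE⟩ : ∃ E, E =
    normOne A * (16 * diracConst * (1 + 2 * ρ) * singConst * (potNorm A + 1)) := ⟨_, rfl⟩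
  -- The minimum with `1` gives `c * (s + k) ≤ s + c * k`, so that both contributions combine into
  -- `s + k`.
  obtain ⟨c, hc⟩ : ∃ c, c = min 1 ((8 * Real.pi)⁻¹ * c₀ ^ 2) := ⟨_, rfl⟩
  have hdc := diracConst_pos
  have hsc := singConst_pos
  have hpA := potNorm_nonneg A
  have ha0 : 0 ≤ a := ha ▸ normOne_nonneg A
  have hD0 : 0 ≤ D := by rw [hD]; positivity
  have hE0 : 0 ≤ E := by have := normOne_nonneg A; rw [hE]; positivity
  have hcpos : 0 < c := by rw [hc]; positivity
  have hc1 : c ≤ 1 := hc ▸ min_le_left _ _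
  -- With `δ = X⁻¹` each summand encodes one smallness condition of `apriori_arith`; the first one
  -- gives `δ ≤ 1`.
  obtain ⟨X, hX⟩ : ∃ X, X = 1 + 4 * (C * D) + 16 * (a * C * D ^ 2) +
    4 * (4 * (a * C * D ^ 2) + 2 * E) / c := ⟨_, rfl⟩
  have t1 : 0 ≤ 4 * (C * D) := by positivity
  have t2 : 0 ≤ 16 * (a * C * D ^ 2) := by positivity
  have t3 : 0 ≤ 4 * (4 * (a * C * D ^ 2) + 2 * E) / c := by positivity
  have hX1 : 1 ≤ X := by linarith
  have hX0 : 0 < X := by linarith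
  have hle : ∀ t, t ≤ X → t * X⁻¹ ≤ 1 := fun t ht => by
    rw [← div_eq_mul_inv, div_le_one hX0]; exact ht
  have hδ3 : 4 * (4 * (a * C * D ^ 2) + 2 * E) * X⁻¹ ≤ c := by
    have := hle _ (show 4 * (4 * (a * C * D ^ 2) + 2 * E) / c ≤ X by linarith)
    rw [div_mul_eq_mul_div, div_le_one hcpos] at this
    exact this
  refine ⟨X⁻¹, by positivity, inv_le_one_of_one_le₀ hX1, 16 * a / c + 2 * C, by positivity,
    fun B hB R hR k hk hkδ f hf M₀ hM₀ γ hγ => ?_⟩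
  have hk1 : k ≤ 1 := hkδ.le.trans (inv_le_one_of_one_le₀ hX1)
  have hγ0 : 0 ≤ γ := (norm_nonneg _).trans (hγ 0)
  have hBp := hB.1
  -- The given bound is replaced by the least one, since `M` must be estimated in terms of itself.
  obtain ⟨M, hM, hMle⟩ : ∃ M, (∀ x, ‖f x‖ ≤ M) ∧ ∀ M', (∀ x, ‖f x‖ ≤ M') → M ≤ M' :=
    ⟨⨆ x, ‖f x‖, fun x => le_ciSup (f := fun x => ‖f x‖) ⟨M₀, by rintro _ ⟨x, rfl⟩; exact hM₀ x⟩ x,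
      fun M' h => ciSup_le h⟩
  obtain ⟨Φ, hΦ, hΦf⟩ := hnear f hf M hM
  have hΦc := continuous_of_mem_spaceN hA hsupp hΦ
  have hΦn := norm_le_normInf hΦ.1.1 hΦc
  have hDf : ∀ x, ‖opT (fun y => A y + B y) k f x - opT A 0 f x‖ ≤ D * (k + potNorm B) * M :=
    hD ▸ norm_opT_perturbed_sub_le hA hBp hk.le hk1 hf hM
  have hres : ∀ x, ‖f x - opT A 0 f x‖ ≤ γ + D * (k + potNorm B) * M := fun x => by
    have h1 := norm_add_le (f x - opT (fun y => A y + B y) k f x)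
      (opT (fun y => A y + B y) k f x - opT A 0 f x)
    rw [sub_add_sub_cancel] at h1
    linarith [hγ x, hDf x]
  have hη := hΦf _ hres
  set n := normInf Φ with hn
  have hMn : M ≤ n + C * (γ + D * (k + potNorm B) * M) := hMle _ fun x => by
    have h1 := norm_add_le (Φ x) (f x - Φ x)
    rw [add_sub_cancel] at h1
    linarith [hΦn x, hη x]
  have hDh : ∀ x, ‖opT (fun y => A y + B y) k (fun y => f y - Φ y) x -
      opT A 0 (fun y => f y - Φ y) x‖ ≤
        D * (k + potNorm B) * (C * (γ + D * (k + potNorm B) * M)) :=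
    fun x => by
      have h := norm_opT_perturbed_sub_le hA hBp hk.le hk1 (hf.fun_sub hΦc) hη x
      rwa [← hD] at h
  have hAB := hA.add hBp
  have hsuppAB : ∀ x, max ρ R < ‖x‖ → A x + B x = 0 := fun x hx => by
    rw [hsupp x ((le_max_left _ _).trans_lt hx), hR x ((le_max_right _ _).trans_lt hx), add_zero]
  have hfm := hf.aestronglyMeasurable (μ := (volume : Measure E3))
  have hΦm := hΦc.aestronglyMeasurable (μ := (volume : Measure E3))
  have hfa : ∀ᵐ x, ‖f x‖ ≤ M := Eventually.of_forall hM
  have hΦa : ∀ᵐ x, ‖Φ x‖ ≤ n := Eventually.of_forall hΦn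
  have hn0 : 0 ≤ n := normInf_nonneg Φ
  have hM0 : 0 ≤ M := (norm_nonneg _).trans (hM 0)
  have horth := integral_inner_sub_opT_eq_zero hA hsupp hΦ hf hM
  set DΦ : E3 → Spinor := fun x => opT (fun y => A y + B y) k Φ x - opT A 0 Φ x with hDΦ
  have hI : ‖∫ x, inner ℂ (A x (Φ x)) (DΦ x)‖ ≤
      a * (n * (γ + D * (k + potNorm B) * (C * (γ + D * (k + potNorm B) * M)))) := by
    -- Inserting `f - T^A_1 f` costs nothing, by orthogonality. What remains is the residual of `f`
    -- plus the perturbation applied to `f - Φ`, which is of second order.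
    have hrep : ∫ x, inner ℂ (A x (Φ x)) (DΦ x) =
        -∫ x, inner ℂ (A x (Φ x)) ((f x - opT A 0 f x) - DΦ x) := by
      simp only [inner_sub_right (A _ (Φ _)) (f _ - opT A 0 f _)]
      rw [integral_sub, horth, zero_sub, neg_neg]
      · exact integrable_inner_potential hA hΦc hΦn (hf.sub
          (continuous_opT hA hsupp le_rfl zero_le_one hfm hfa)) hres
      · exact integrable_inner_potential hA hΦc hΦn
          ((continuous_opT hAB hsuppAB hk.le hk1 hΦm hΦa).sub
            (continuous_opT hA hsupp le_rfl zero_le_one hΦm hΦa))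
          (norm_opT_perturbed_sub_le hA hBp hk.le hk1 hΦc hΦn)
    rw [hrep, norm_neg, ha]
    refine norm_integral_inner_potential_le hA hΦn fun x _ => ?_
    have e1 := opT_sub hAB hk.le hk1 hfm hfa hΦm hΦa x
    have e2 := opT_sub hA le_rfl zero_le_one hfm hfa hΦm hΦa x
    have e3 : (f x - opT A 0 f x) - DΦ x = (f x - opT (fun y => A y + B y) k f x) +
        (opT (fun y => A y + B y) k (fun y => f y - Φ y) x - opT A 0 (fun y => f y - Φ y) x) := by
      rw [e1, e2]; simp only [hDΦ]; abel
    rw [e3]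
    exact (norm_add_le _ _).trans (add_le_add (hγ x) (hDh x))
  have hexp := norm_integral_inner_expansion_le hA hsupp hρ.le hBp hR hk.le hk1 hΦ
  rw [← hE] at hexp
  have hre : pairing Φ B Φ = (((pairing Φ B Φ).re : ℝ) : ℂ) :=
    Complex.ext rfl (by simp [pairing_self_im hBp])
  set l := k * (8 * Real.pi)⁻¹ * ‖lam A Φ‖ ^ 2 with hl
  have hl0 : 0 ≤ l := by positivity
  have hpabs : ‖pairing Φ B Φ‖ = |(pairing Φ B Φ).re| := by
    conv_lhs => rw [hre]
    rw [Complex.norm_real, Real.norm_eq_abs]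
  have hmain : (‖pairing Φ B Φ‖ + l) / 2 ≤
      a * (n * (γ + D * (k + potNorm B) * (C * (γ + D * (k + potNorm B) * M)))) +
        E * (k ^ 2 + k * potNorm B) * n ^ 2 := by
    have h1 := add_le_two_mul_norm_sub_mul_I (p := (pairing Φ B Φ).re) (l := l)
    rw [← hre, ← hpabs, abs_of_nonneg hl0] at h1
    have h2 := norm_sub_norm_le (pairing Φ B Φ - (l : ℂ) * Complex.I)
      (∫ x, inner ℂ (A x (Φ x)) (DΦ x))
    rw [norm_sub_rev (pairing Φ B Φ - (l : ℂ) * Complex.I)] at h2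
    linarith
  have hlc : c * k * n ^ 2 ≤ l := by
    have h1 : (c₀ * n) ^ 2 ≤ ‖lam A Φ‖ ^ 2 := by gcongr; exact hlow Φ hΦ
    calc c * k * n ^ 2 ≤ ((8 * Real.pi)⁻¹ * c₀ ^ 2) * k * n ^ 2 := by
          gcongr; exact hc ▸ min_le_right _ _
      _ = k * (8 * Real.pi)⁻¹ * (c₀ * n) ^ 2 := by ring
      _ ≤ l := by rw [hl]; gcongr
  have hsn : pairingInf A B * n ^ 2 ≤ ‖pairing Φ B Φ‖ := by
    rcases hn0.eq_or_lt with h | h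
    · rw [← h]; simp
    · exact pairingInf_mul_le B hΦ h
  have hfinal := apriori_arith hn0 hγ0 hk (potNorm_nonneg B) (pairingInf_nonneg A B) ha0 hD0 hC hE0
    hcpos hc1 (hle _ (by linarith)) (hle _ (by linarith)) hδ3 hkδ.le
    (potNorm_le_of_mem_setW hA hsupp hcrit (by positivity) hB) hMn (hB.2 Φ hΦ) hsn hlc hmain
  exact fun x => (hM x).trans hfinal

end Apriori

/-! ### Bounds on iterated derivatives -/

section DerivBound

variable {E F G : Type*} [NormedAddCommGroup E] [NormedSpace ℝ E] [NormedAddCommGroup F]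
  [NormedSpace ℝ F] [NormedAddCommGroup G] [NormedSpace ℝ G]

/-- The first `N` derivatives of `f` within `s` at `r` satisfy `‖f⁽ⁱ⁾‖ ≤ C wⁱ`. -/
def DerivBound (N : ℕ) (f : ℝ → E) (s : Set ℝ) (r C w : ℝ) : Prop :=
  ∀ i ≤ N, ‖iteratedDerivWithin i f s r‖ ≤ C * w ^ i

variable {N : ℕ} {f : ℝ → E} {g : ℝ → F} {s : Set ℝ} {r C C' w w' : ℝ}

lemma DerivBound.congr {f' : ℝ → E} (h : DerivBound N f s r C w) (hr : r ∈ s)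
    (heq : EqOn f f' s) : DerivBound N f' s r C w := fun i hi => by
  rw [← iteratedDerivWithin_congr heq hr]; exact h i hi

lemma DerivBound.mono_left (h : DerivBound N f s r C w) (hC : C ≤ C') (hw : 0 ≤ w) :
    DerivBound N f s r C' w := fun i hi =>
  (h i hi).trans (mul_le_mul_of_nonneg_right hC (pow_nonneg hw i))

lemma DerivBound.mono_right (h : DerivBound N f s r C w) (hC : 0 ≤ C) (hw : 0 ≤ w)
    (hww : w ≤ w') : DerivBound N f s r C w' := fun i hi =>
  (h i hi).trans (mul_le_mul_of_nonneg_left (pow_le_pow_left₀ hw hww i) hC)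

/-- Trades a weight independent of `k` and `B`, such as `1 + ρ`, for the weight that is being
tracked; the old one goes into the constant. -/
lemma DerivBound.change_weight (h : DerivBound N f s r C w) (hC : 0 ≤ C) (hw : 1 ≤ w)
    (hw' : 1 ≤ w') : DerivBound N f s r (C * w ^ N) w' := fun i hi => by
  calc _ ≤ C * w ^ i := h i hi
    _ ≤ C * w ^ N := by gcongr
    _ ≤ C * w ^ N * w' ^ i := le_mul_of_one_le_right (by positivity) (one_le_pow₀ hw')

lemma DerivBound.derivWithin (h : DerivBound (N + 1) f s r C w) (hC : 0 ≤ C) (hw : 1 ≤ w)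
    (hw' : 1 ≤ w') : DerivBound N (derivWithin f s) s r (C * w ^ (N + 1)) w' := fun i hi => by
  have h1 := h (i + 1) (by omega)
  rw [iteratedDerivWithin_succ'] at h1
  calc _ ≤ C * w ^ (i + 1) := h1
    _ ≤ C * w ^ (N + 1) := by gcongr
    _ ≤ C * w ^ (N + 1) * w' ^ i := le_mul_of_one_le_right (by positivity) (one_le_pow₀ hw')

lemma DerivBound.add {f' : ℝ → E} (h : DerivBound N f s r C w) (h' : DerivBound N f' s r C' w)
    (hs : IsOpen s) (hr : r ∈ s) (hf : ContDiffOn ℝ ∞ f s) (hf' : ContDiffOn ℝ ∞ f' s) :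
    DerivBound N (fun t => f t + f' t) s r (C + C') w := fun i hi => by
  rw [iteratedDerivWithin_fun_add hr hs.uniqueDiffOn
    ((hf r hr).of_le (by exact_mod_cast le_top)) ((hf' r hr).of_le (by exact_mod_cast le_top))]
  refine (norm_add_le _ _).trans ((add_le_add (h i hi) (h' i hi)).trans (le_of_eq (by ring)))

/-- Leibniz' rule: the weights multiply to `w ^ i` in each term, and the binomial coefficients sum
to at most `2 ^ N`. -/
lemma DerivBound.bilinear (B : E →L[ℝ] F →L[ℝ] G) (hB : ‖B‖ ≤ 1) (hs : IsOpen s) (hr : r ∈ s)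
    (hf : ContDiffOn ℝ ∞ f s) (hg : ContDiffOn ℝ ∞ g s)
    (h : DerivBound N f s r C w) (h' : DerivBound N g s r C' w) (hC : 0 ≤ C) (hC' : 0 ≤ C')
    (hw : 0 ≤ w) : DerivBound N (fun t => B (f t) (g t)) s r (2 ^ N * C * C') w := fun i hi => by
  have h1 := B.norm_iteratedFDerivWithin_le_of_bilinear hf hg hs.uniqueDiffOn hr (n := i)
    (by exact_mod_cast le_top)
  simp only [norm_iteratedFDerivWithin_eq_norm_iteratedDerivWithin] at h1
  refine h1.trans ?_
  have h2 : ∑ j ∈ Finset.range (i + 1), (i.choose j : ℝ) * ‖iteratedDerivWithin j f s r‖ *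
      ‖iteratedDerivWithin (i - j) g s r‖ ≤ ∑ j ∈ Finset.range (i + 1),
        (i.choose j : ℝ) * (C * C' * w ^ i) := by
    refine Finset.sum_le_sum fun j hj => ?_
    have hj' : j ≤ i := Nat.lt_succ_iff.mp (Finset.mem_range.mp hj)
    have e1 := h j (hj'.trans hi)
    have e2 := h' (i - j) ((Nat.sub_le i j).trans hi)
    rw [mul_assoc]
    refine mul_le_mul_of_nonneg_left ?_ (Nat.cast_nonneg _)
    calc _ ≤ (C * w ^ j) * (C' * w ^ (i - j)) := by gcongr
      _ = C * C' * (w ^ j * w ^ (i - j)) := by ring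
      _ = _ := by rw [← pow_add, Nat.add_sub_cancel' hj']
  have h3 : ∑ j ∈ Finset.range (i + 1), (i.choose j : ℝ) * (C * C' * w ^ i) =
      2 ^ i * (C * C' * w ^ i) := by
    rw [← Finset.sum_mul]
    congr 1
    exact_mod_cast Nat.sum_range_choose i
  calc _ ≤ 1 * (2 ^ i * (C * C' * w ^ i)) := by
        rw [← h3]
        exact mul_le_mul hB h2 (Finset.sum_nonneg fun j _ => by positivity) zero_le_one
    _ ≤ 2 ^ N * (C * C' * w ^ i) := by
        rw [one_mul]
        gcongr
        norm_num
    _ = _ := by ring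

lemma DerivBound.clm_apply {S : ℝ → E →L[ℝ] F} {u : ℝ → E} (hs : IsOpen s) (hr : r ∈ s)
    (hS : ContDiffOn ℝ ∞ S s) (hu : ContDiffOn ℝ ∞ u s)
    (h : DerivBound N S s r C w) (h' : DerivBound N u s r C' w) (hC : 0 ≤ C) (hC' : 0 ≤ C')
    (hw : 0 ≤ w) : DerivBound N (fun t => S t (u t)) s r (2 ^ N * C * C') w :=
  DerivBound.bilinear (ContinuousLinearMap.id ℝ (E →L[ℝ] F)) ContinuousLinearMap.norm_id_le hs hr
    hS hu h h' hC hC' hw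

lemma DerivBound.smul {c : ℝ → ℝ} {u : ℝ → E} (hs : IsOpen s) (hr : r ∈ s)
    (hc : ContDiffOn ℝ ∞ c s) (hu : ContDiffOn ℝ ∞ u s)
    (h : DerivBound N c s r C w) (h' : DerivBound N u s r C' w) (hC : 0 ≤ C) (hC' : 0 ≤ C')
    (hw : 0 ≤ w) : DerivBound N (fun t => c t • u t) s r (2 ^ N * C * C') w :=
  DerivBound.bilinear (ContinuousLinearMap.lsmul ℝ ℝ) ContinuousLinearMap.opNorm_lsmul_le hs hr
    hc hu h h' hC hC' hw

lemma DerivBound.comp_left (L : E →L[ℝ] F) (hL : ‖L‖ ≤ 1) (hs : IsOpen s) (hr : r ∈ s)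
    (hf : ContDiffOn ℝ ∞ f s) (h : DerivBound N f s r C w) :
    DerivBound N (fun t => L (f t)) s r C w := fun i hi => by
  have h1 := L.norm_iteratedFDerivWithin_comp_left (hf r hr) hs.uniqueDiffOn hr (n := i)
    (by exact_mod_cast le_top)
  simp only [norm_iteratedFDerivWithin_eq_norm_iteratedDerivWithin] at h1
  refine h1.trans ?_
  have := mul_le_mul hL (h i hi) (norm_nonneg _) zero_le_one
  rwa [one_mul] at this

/-- Derivatives of the inverse: every derivative costs one more power of `‖S⁻¹‖`. -/
lemma exists_derivBound_ringInverse (C : ℕ → ℝ) (hC : ∀ n, 0 ≤ C n) (C₀ : ℝ) (hC₀ : 0 ≤ C₀)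
    (N : ℕ) : ∃ K, 0 ≤ K ∧ ∀ (𝔸 : Type) [NormedRing 𝔸] [NormedAlgebra ℝ 𝔸] [CompleteSpace 𝔸]
      (S : ℝ → 𝔸) (s : Set ℝ) (r α : ℝ), IsOpen s → r ∈ s → ContDiffOn ℝ ∞ S s →
      (∀ t ∈ s, IsUnit (S t)) → 1 ≤ α → ‖Ring.inverse (S r)‖ ≤ C₀ * α →
      (∀ n, DerivBound n (derivWithin S s) s r (C n) α) →
        DerivBound N (fun t => Ring.inverse (S t)) s r (K * α) α := by
  induction N with
  | zero =>
    refine ⟨C₀, hC₀, fun 𝔸 _ _ _ S s r α hs hr hS hu hα h0 hn i hi => ?_⟩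
    obtain rfl : i = 0 := Nat.le_zero.mp hi
    simpa using h0
  | succ N ih =>
    obtain ⟨K, hK, ih⟩ := ih
    -- The second summand comes from two uses of Leibniz' rule on `S⁻¹ (S' S⁻¹)`.
    refine ⟨K + 2 ^ N * K * (2 ^ N * C N * K), ?_, fun 𝔸 _ _ _ S s r α hs hr hS hu hα h0 hn =>
      ?_⟩
    · have := hC N
      positivity
    have hα0 : 0 ≤ α := zero_le_one.trans hα
    have hCN := hC N
    have hI := ih 𝔸 S s r α hs hr hS hu hα h0 hn
    have hIc : ContDiffOn ℝ ∞ (fun t => Ring.inverse (S t)) s := fun t ht => by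
      obtain ⟨x, hx⟩ := hu t ht
      exact ((hx ▸ contDiffAt_ringInverse ℝ x :
        ContDiffAt ℝ ∞ Ring.inverse (S t)).comp_contDiffWithinAt t (hS t ht))
    have hS' : ContDiffOn ℝ ∞ (derivWithin S s) s :=
      hS.derivWithin hs.uniqueDiffOn (by simp)
    have hd : EqOn (derivWithin (fun t => Ring.inverse (S t)) s)
        (fun t => -(Ring.inverse (S t) * (derivWithin S s t * Ring.inverse (S t)))) s := by
      intro t ht
      obtain ⟨x, hx⟩ := hu t ht
      have hdS : HasDerivWithinAt S (derivWithin S s t) s t :=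
        ((hS t ht).differentiableWithinAt (by simp)).hasDerivWithinAt
      have h1 : HasFDerivAt Ring.inverse (-ContinuousLinearMap.mulLeftRight ℝ 𝔸 ↑x⁻¹ ↑x⁻¹) (S t) :=
        hx ▸ hasFDerivAt_ringInverse x
      have h2 := h1.comp_hasDerivWithinAt t hdS
      refine (h2.derivWithin (hs.uniqueDiffOn t ht)).trans ?_
      simp [← hx, mul_assoc]
    have m1 := DerivBound.bilinear (ContinuousLinearMap.mul ℝ 𝔸)
      (ContinuousLinearMap.opNorm_mul_le ℝ 𝔸) hs hr hS' hIc (hn N) hI hCN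
      (by positivity) hα0
    have hmc : ContDiffOn ℝ ∞ (fun t => derivWithin S s t * Ring.inverse (S t)) s := hS'.mul hIc
    have m2 := DerivBound.bilinear (ContinuousLinearMap.mul ℝ 𝔸)
      (ContinuousLinearMap.opNorm_mul_le ℝ 𝔸) hs hr hIc hmc hI m1 (by positivity)
      (by positivity) hα0
    intro i hi
    rcases Nat.lt_or_ge i (N + 1) with h | h
    · refine (hI i (by omega)).trans ?_
      gcongr
      exact le_add_of_nonneg_right (by positivity)
    · obtain rfl : i = N + 1 := le_antisymm hi h
      -- The two inverses contribute `α * α` and the remaining `N` derivatives `α ^ N`; together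
      -- this is `α * α ^ (N + 1)`, the claimed weight.
      rw [iteratedDerivWithin_succ', iteratedDerivWithin_congr hd hr]
      rw [iteratedDerivWithin_fun_neg, norm_neg]
      refine (m2 N le_rfl).trans ?_
      have : 0 ≤ K * (α * α ^ (N + 1)) := by positivity
      rw [pow_succ] at this ⊢
      linarith

/-- An explicit sequence in which each member differentiates to the next delivers smoothness and all
derivatives at once; the operators and functions with phases are of this kind. -/
lemma iteratedDeriv_of_hasDerivAt_seq {L : ℕ → ℝ → E}
    (h : ∀ n k, HasDerivAt (L n) (L (n + 1) k) k) (n : ℕ) : iteratedDeriv n (L 0) = L n := by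
  induction n with
  | zero => exact iteratedDeriv_zero
  | succ n ih => rw [iteratedDeriv_succ, ih]; exact funext fun k => (h n k).deriv

lemma contDiff_of_hasDerivAt_seq {L : ℕ → ℝ → E}
    (h : ∀ n k, HasDerivAt (L n) (L (n + 1) k) k) : ContDiff ℝ ∞ (L 0) :=
  contDiff_of_differentiable_iteratedDeriv fun n _ => by
    rw [iteratedDeriv_of_hasDerivAt_seq h]
    exact fun k => (h n k).differentiableAt

lemma derivBound_of_hasDerivAt_seq {L : ℕ → ℝ → E}
    (h : ∀ n k, HasDerivAt (L n) (L (n + 1) k) k) (hs : IsOpen s) (hr : r ∈ s)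
    (hb : ∀ n ≤ N, ‖L n r‖ ≤ C * w ^ n) : DerivBound N (L 0) s r C w := fun i hi => by
  rw [iteratedDerivWithin_of_isOpen hs hr, iteratedDeriv_of_hasDerivAt_seq h]
  exact hb i hi

lemma exists_derivBound_of_contDiff (hf : ContDiff ℝ ∞ f) (N : ℕ) :
    ∃ C, 0 ≤ C ∧ ∀ (s : Set ℝ) (r w : ℝ), IsOpen s → r ∈ s → r ∈ Icc (0 : ℝ) 1 → 1 ≤ w →
      DerivBound N f s r C w := by
  have h1 : ∀ i : ℕ, ∃ C, ∀ r ∈ Icc (0 : ℝ) 1, ‖iteratedDeriv i f r‖ ≤ C := fun i =>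
    isCompact_Icc.exists_bound_of_continuousOn
      (hf.continuous_iteratedDeriv i (by exact_mod_cast le_top)).continuousOn
  choose C hC using h1
  have hC0 : ∀ i, 0 ≤ C i := fun i => (norm_nonneg _).trans (hC i 0 (by simp))
  refine ⟨∑ i ∈ Finset.range (N + 1), C i, Finset.sum_nonneg fun i _ => hC0 i,
    fun s r w hs hr hr' hw i hi => ?_⟩
  rw [iteratedDerivWithin_of_isOpen hs hr]
  have h2 : C i ≤ ∑ i ∈ Finset.range (N + 1), C i :=
    Finset.single_le_sum (f := C) (fun i _ => hC0 i) (Finset.mem_range.mpr (by omega))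
  refine ((hC i r hr').trans h2).trans (le_mul_of_one_le_right ?_ (one_le_pow₀ hw))
  exact Finset.sum_nonneg fun i _ => hC0 i

lemma contDiff_smul_add_smul_add {c d : ℝ → ℝ} {u v z : ℝ → E} (hc : ContDiff ℝ ∞ c)
    (hd : ContDiff ℝ ∞ d) (hu : ContDiff ℝ ∞ u) (hv : ContDiff ℝ ∞ v) (hz : ContDiff ℝ ∞ z) :
    ContDiff ℝ ∞ fun k => c k • u k + d k • v k + z k :=
  ((hc.smul hu).add (hd.smul hv)).add hz

lemma DerivBound.smul_add_smul_add {c d : ℝ → ℝ} {u v z : ℝ → E} {Cc Cd Cu Cv Cz : ℝ}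
    (hs : IsOpen s) (hr : r ∈ s) (hc : ContDiff ℝ ∞ c) (hd : ContDiff ℝ ∞ d)
    (hu : ContDiff ℝ ∞ u) (hv : ContDiff ℝ ∞ v) (hz : ContDiff ℝ ∞ z)
    (bc : DerivBound N c s r Cc w) (bd : DerivBound N d s r Cd w) (bu : DerivBound N u s r Cu w)
    (bv : DerivBound N v s r Cv w) (bz : DerivBound N z s r Cz w) (hCc : 0 ≤ Cc) (hCd : 0 ≤ Cd)
    (hCu : 0 ≤ Cu) (hCv : 0 ≤ Cv) (hw : 0 ≤ w) :
    DerivBound N (fun k => c k • u k + d k • v k + z k) s r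
      (2 ^ N * Cc * Cu + 2 ^ N * Cd * Cv + Cz) w := by
  have h1 := DerivBound.smul hs hr hc.contDiffOn hu.contDiffOn bc bu hCc hCu hw
  have h2 := DerivBound.smul hs hr hd.contDiffOn hv.contDiffOn bd bv hCd hCv hw
  have h12 := h1.add h2 hs hr (hc.smul hu).contDiffOn (hd.smul hv).contDiffOn
  exact h12.add bz hs hr ((hc.smul hu).add (hd.smul hv)).contDiffOn hz.contDiffOn

end DerivBound

/-! ### Smooth dependence on the wave number -/

lemma norm_phase_taylor_le (n : ℕ) (x k t : ℝ) :
    ‖(Complex.I * (x : ℂ)) ^ n * Complex.exp (Complex.I * (((k + t) * x : ℝ) : ℂ))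
      - (Complex.I * (x : ℂ)) ^ n * Complex.exp (Complex.I * ((k * x : ℝ) : ℂ))
      - (t : ℂ) * ((Complex.I * (x : ℂ)) ^ (n + 1) * Complex.exp (Complex.I * ((k * x : ℝ) : ℂ)))‖
      ≤ 2 * t ^ 2 * |x| ^ (n + 2) := by
  have e : (Complex.I * (x : ℂ)) ^ n * Complex.exp (Complex.I * (((k + t) * x : ℝ) : ℂ))
      - (Complex.I * (x : ℂ)) ^ n * Complex.exp (Complex.I * ((k * x : ℝ) : ℂ))
      - (t : ℂ) * ((Complex.I * (x : ℂ)) ^ (n + 1) * Complex.exp (Complex.I * ((k * x : ℝ) : ℂ)))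
      = (Complex.I * (x : ℂ)) ^ n * Complex.exp (Complex.I * ((k * x : ℝ) : ℂ)) *
        (Complex.exp (Complex.I * ((t * x : ℝ) : ℂ)) - 1 - Complex.I * ((t * x : ℝ) : ℂ)) := by
    have : Complex.I * (((k + t) * x : ℝ) : ℂ) =
      Complex.I * ((k * x : ℝ) : ℂ) + Complex.I * ((t * x : ℝ) : ℂ) := by push_cast; ring
    rw [this, Complex.exp_add]
    push_cast
    ring
  rw [e, norm_mul, norm_mul, norm_phase, norm_pow, norm_mul, Complex.norm_I, Complex.norm_real,
    Real.norm_eq_abs, one_mul, mul_one]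
  calc |x| ^ n * _ ≤ |x| ^ n * (2 * (t * x) ^ 2) := by
        gcongr; exact norm_phase_sub_one_sub_le _
    _ = 2 * t ^ 2 * |x| ^ (n + 2) := by rw [mul_pow, ← sq_abs x]; ring

/-- The `n`-th derivative in `k` of the kernel `e^{ik|z|} a(z)`. -/
def phaseKer (a : E3 → SpinorOp) (n : ℕ) (k : ℝ) (z : E3) : SpinorOp :=
  ((Complex.I * (‖z‖ : ℂ)) ^ n * Complex.exp (Complex.I * ((k * ‖z‖ : ℝ) : ℂ))) • a z

lemma isKernel_phaseKer {a : E3 → SpinorOp} {c : ℝ} (ha : IsKernel a c 0) (n : ℕ) (k : ℝ) :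
    IsKernel (phaseKer a n k) c n where
  measurable := Measurable.fun_smul (by fun_prop) ha.measurable
  nonneg := ha.nonneg
  bound z := by
    have h := ha.bound z
    have hn : ‖z‖ ^ n ≤ (1 + ‖z‖) ^ n := by gcongr; linarith
    have hs := one_le_sing z
    have hc := ha.nonneg
    rw [pow_zero, mul_one] at h
    rw [phaseKer, norm_smul, norm_mul, norm_phase, norm_pow, norm_mul, Complex.norm_I,
      Complex.norm_real, norm_norm, one_mul, mul_one]
    calc ‖z‖ ^ n * ‖a z‖ ≤ (1 + ‖z‖) ^ n * (c * sing z) := by gcongr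
      _ = _ := by ring

lemma norm_smul_taylor {F : Type*} [NormedAddCommGroup F] [NormedSpace ℂ F] (p q t r : ℂ) (v : F) :
    ‖p • v - q • v - t • r • v‖ = ‖p - q - t * r‖ * ‖v‖ := by
  rw [← norm_smul]
  congr 1
  module

/-- The Taylor remainder is again an admissible kernel, with constant `O(t²)`, so the general kernel
bound gives differentiability in operator norm. -/
lemma isKernel_phaseKer_taylor {a : E3 → SpinorOp} {c : ℝ} (ha : IsKernel a c 0) (n : ℕ)
    (k t : ℝ) : IsKernel (fun z => phaseKer a n (k + t) z - phaseKer a n k z -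
      (t : ℂ) • phaseKer a (n + 1) k z) (2 * t ^ 2 * c) (n + 2) where
  measurable := ((isKernel_phaseKer ha n (k + t)).measurable.sub
    (isKernel_phaseKer ha n k).measurable).sub
      ((isKernel_phaseKer ha (n + 1) k).measurable.const_smul (t : ℂ))
  nonneg := by have := ha.nonneg; positivity
  bound z := by
    have h := ha.bound z
    have hn : ‖z‖ ^ (n + 2) ≤ (1 + ‖z‖) ^ (n + 2) := by gcongr; linarith
    have hs := one_le_sing z
    have hc := ha.nonneg
    rw [pow_zero, mul_one] at h
    have h1 := norm_phase_taylor_le n ‖z‖ k t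
    rw [abs_of_nonneg (norm_nonneg z)] at h1
    refine (norm_smul_taylor _ _ _ _ (a z)).trans_le ?_
    calc _ ≤ (2 * t ^ 2 * ‖z‖ ^ (n + 2)) * (c * sing z) := by gcongr
      _ ≤ (2 * t ^ 2 * (1 + ‖z‖) ^ (n + 2)) * (c * sing z) := by gcongr
      _ = _ := by ring

section PhaseOp

variable {ρ : ℝ} (hρ : 0 < ρ) {V : E3 → SpinorOp} {S : Type} [TopologicalSpace S] [CompactSpace S]

lemma exists_phaseOp (ι : C(S, E3)) {σ : ℝ} (hσ0 : 0 ≤ σ) (hσ : ∀ x, ‖ι x‖ ≤ σ)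
    (hV : IsPotential V) (hsupp : ∀ x, ρ < ‖x‖ → V x = 0) {a : E3 → SpinorOp} {c : ℝ}
    (ha : IsKernel a c 0) :
    ∃ L : ℕ → ℝ → (BallFn ρ →L[ℝ] C(S, Spinor)),
      (∀ n k u s, L n k u s = ∫ y, phaseKer a n k (ι s - y) (V y (extend hρ u y))) ∧
      (∀ n k, ‖L n k‖ ≤ c * (1 + σ + ρ) ^ n * (singConst * potNorm V)) ∧
      ∀ n k, HasDerivAt (L n) (L (n + 1) k) k := by
  choose L hL using fun (n : ℕ) (k : ℝ) =>
    exists_kernelOp hρ ι hV hsupp (isKernel_phaseKer ha n k)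
  have hc := ha.nonneg
  have hs := singConst_pos
  have hp := potNorm_nonneg V
  refine ⟨L, hL, fun n k => ?_, fun n k => ?_⟩
  · refine ContinuousLinearMap.opNorm_le_bound _ (by positivity) fun u => ?_
    rw [ContinuousMap.norm_le _ (by positivity)]
    intro s
    rw [hL]
    exact (isKernel_phaseKer ha n k).norm_integral_le hV hρ.le hsupp (norm_extend_le hρ u) (hσ s)
  · refine hasDerivAt_of_norm_le_sq (E := BallFn ρ →L[ℝ] C(S, Spinor))
      (F := L n) (F' := L (n + 1) k) (k := k)
      (C := 2 * c * (1 + σ + ρ) ^ (n + 2) * (singConst * potNorm V)) fun t => ?_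
    refine ContinuousLinearMap.opNorm_le_bound _ (by positivity) fun u => ?_
    rw [ContinuousMap.norm_le _ (by positivity)]
    intro s
    have hi := fun n k => (isKernel_phaseKer ha n k).integrable hV hsupp (continuous_extend hρ u)
      (norm_extend_le hρ u) (ι s)
    have h12 : Integrable fun y => phaseKer a n (k + t) (ι s - y) (V y (extend hρ u y)) -
      phaseKer a n k (ι s - y) (V y (extend hρ u y)) := (hi n (k + t)).sub (hi n k)
    have key : (L n (k + t) - L n k - t • L (n + 1) k) u s =
        ∫ y, (fun z => phaseKer a n (k + t) z - phaseKer a n k z -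
          (t : ℂ) • phaseKer a (n + 1) k z) (ι s - y) (V y (extend hρ u y)) := by
      simp only [sub_apply, smul_apply, ContinuousMap.sub_apply, ContinuousMap.smul_apply, hL]
      have h3 : Integrable fun y =>
          (t : ℂ) • phaseKer a (n + 1) k (ι s - y) (V y (extend hρ u y)) :=
        (hi (n + 1) k).smul (t : ℂ)
      rw [← Complex.coe_smul, ← integral_smul, ← integral_sub (hi n (k + t)) (hi n k),
        ← integral_sub h12 h3]
    rw [key]
    refine ((isKernel_phaseKer_taylor ha n k t).norm_integral_le hV hρ.le hsupp
      (norm_extend_le hρ u) (hσ s)).trans (le_of_eq (by ring))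

/-- The derivative bounds of a phase operator, with weight `1 + σ`. -/
lemma derivBound_phaseOp {c P σ : ℝ} (hc : 0 ≤ c) (hρ : 0 < ρ) (hσ0 : 0 ≤ σ)
    (hP : potNorm V ≤ P) {L : ℕ → ℝ → (BallFn ρ →L[ℝ] C(S, Spinor))}
    (hL : ∀ n k, ‖L n k‖ ≤ c * (1 + σ + ρ) ^ n * (singConst * potNorm V))
    (hd : ∀ n k, HasDerivAt (L n) (L (n + 1) k) k) {s : Set ℝ} {r : ℝ} (hs : IsOpen s)
    (hr : r ∈ s) (N : ℕ) :
    DerivBound N (L 0) s r (c * (1 + ρ) ^ N * (singConst * P)) (1 + σ) :=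
  derivBound_of_hasDerivAt_seq hd hs hr fun n hn => by
    have hsc := singConst_pos
    have hp := potNorm_nonneg V
    have hP0 := hp.trans hP
    calc ‖L n r‖ ≤ c * (1 + σ + ρ) ^ n * (singConst * potNorm V) := hL n r
      -- Factoring `1 + σ + ρ ≤ (1 + ρ) (1 + σ)` moves `ρ` into the constant and leaves `1 + σ` as
      -- the weight.
      _ ≤ c * ((1 + ρ) * (1 + σ)) ^ n * (singConst * P) := by
          gcongr
          nlinarith [mul_nonneg hρ.le hσ0]
      _ = c * (1 + ρ) ^ n * (singConst * P) * (1 + σ) ^ n := by rw [mul_pow]; ring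
      _ ≤ c * (1 + ρ) ^ N * (singConst * P) * (1 + σ) ^ n := by
          gcongr
          linarith

lemma contDiff_energy : ContDiff ℝ ∞ energy := by
  unfold energy
  exact ContDiff.sqrt (by fun_prop) fun k => by positivity

/-- The operator `T` as a smooth function of `k`. -/
lemma exists_smooth_opT {ρ : ℝ} (hρ : 0 < ρ) (P : ℝ) (hP0 : 0 ≤ P) : ∃ C : ℕ → ℝ, (∀ n, 0 ≤ C n) ∧
    ∀ V, IsPotential V → (∀ x, ρ < ‖x‖ → V x = 0) → potNorm V ≤ P →
    ∀ (S : Type) [TopologicalSpace S] [CompactSpace S] (ι : C(S, E3)) (σ : ℝ), 0 ≤ σ →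
      (∀ x, ‖ι x‖ ≤ σ) → ∃ T : ℝ → (BallFn ρ →L[ℝ] C(S, Spinor)), ContDiff ℝ ∞ T ∧
        (∀ k u x, T k u x = opT V k (extend hρ u) (ι x)) ∧
        ∀ (N : ℕ) (s : Set ℝ) (r : ℝ), IsOpen s → r ∈ s → r ∈ Icc (0 : ℝ) 1 →
          DerivBound N T s r (C N) (1 + σ) := by
  have hdc := diracConst_pos
  have hsc := singConst_pos
  have kE : IsKernel kerE (2 * diracConst) 0 := ⟨measurable_kerE, by positivity, fun z => by
    simpa using norm_le_sing_of norm_kerE_le z⟩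
  have kK : IsKernel kerK (2 * diracConst) 0 := ⟨measurable_kerK, by positivity, fun z => by
    simpa using norm_le_sing_of norm_kerK_le z⟩
  have kC : IsKernel kerC (2 * diracConst) 0 := ⟨measurable_kerC, by positivity, fun z => by
    simpa using norm_le_sing_of norm_kerC_le z⟩
  have hid : ContDiff ℝ ∞ (fun k : ℝ => k) := contDiff_id
  choose CE hCE0 hCE using fun N => exists_derivBound_of_contDiff contDiff_energy N
  choose CK hCK0 hCK using fun N => exists_derivBound_of_contDiff hid N
  set D : ℕ → ℝ := fun N => 2 * diracConst * (1 + ρ) ^ N * (singConst * P) with hD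
  have hD0 : ∀ N, 0 ≤ D N := fun N => by rw [hD]; positivity
  refine ⟨fun N => 2 ^ N * CE N * D N + 2 ^ N * CK N * D N + D N, fun N => by
    have := hCE0 N; have := hCK0 N; have := hD0 N; positivity,
    fun V hV hsupp hP S _ _ ι σ hσ0 hσ => ?_⟩
  obtain ⟨LE, e1, e2, e3⟩ := exists_phaseOp hρ ι hσ0 hσ hV hsupp kE
  obtain ⟨LK, k1, k2, k3⟩ := exists_phaseOp hρ ι hσ0 hσ hV hsupp kK
  obtain ⟨LC, c1, c2, c3⟩ := exists_phaseOp hρ ι hσ0 hσ hV hsupp kC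
  have sE := contDiff_of_hasDerivAt_seq (E := BallFn ρ →L[ℝ] C(S, Spinor)) (L := LE) e3
  have sK := contDiff_of_hasDerivAt_seq (E := BallFn ρ →L[ℝ] C(S, Spinor)) (L := LK) k3
  have sC := contDiff_of_hasDerivAt_seq (E := BallFn ρ →L[ℝ] C(S, Spinor)) (L := LC) c3
  refine ⟨fun k => energy k • LE 0 k + k • LK 0 k + LC 0 k,
    contDiff_smul_add_smul_add (E := BallFn ρ →L[ℝ] C(S, Spinor)) contDiff_energy hid sE sK sC,
    fun k u x => ?_,
    fun N s r hs hr hr' => ?_⟩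
  · have iE := (isKernel_phaseKer kE 0 k).integrable hV hsupp (continuous_extend hρ u)
      (norm_extend_le hρ u) (ι x)
    have iK := (isKernel_phaseKer kK 0 k).integrable hV hsupp (continuous_extend hρ u)
      (norm_extend_le hρ u) (ι x)
    have iC := (isKernel_phaseKer kC 0 k).integrable hV hsupp (continuous_extend hρ u)
      (norm_extend_le hρ u) (ι x)
    have iE' : Integrable fun y =>
        ((energy k : ℝ) : ℂ) • phaseKer kerE 0 k (ι x - y) (V y (extend hρ u y)) :=
      iE.smul ((energy k : ℝ) : ℂ)
    have iK' : Integrable fun y => (k : ℂ) • phaseKer kerK 0 k (ι x - y) (V y (extend hρ u y)) :=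
      iK.smul (k : ℂ)
    have iEK : Integrable fun y =>
        ((energy k : ℝ) : ℂ) • phaseKer kerE 0 k (ι x - y) (V y (extend hρ u y)) +
        (k : ℂ) • phaseKer kerK 0 k (ι x - y) (V y (extend hρ u y)) :=
      iE'.add iK'
    simp only [add_apply, smul_apply, ContinuousMap.add_apply, ContinuousMap.smul_apply, e1, k1, c1]
    rw [← Complex.coe_smul (energy k), ← Complex.coe_smul k, ← integral_smul, ← integral_smul,
      ← integral_add iE' iK', ← integral_add iEK iC, opT]
    congr 1
    funext y
    rw [green_eq]
    simp only [phaseKer, pow_zero, one_mul, smul_apply, add_apply]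
    module
  · have hw : 1 ≤ 1 + σ := by linarith
    have hw0 : 0 ≤ 1 + σ := by linarith
    have bE : DerivBound N (LE 0) s r (D N) (1 + σ) :=
      derivBound_phaseOp (by positivity) hρ hσ0 hP e2 e3 hs hr N
    have bK : DerivBound N (LK 0) s r (D N) (1 + σ) :=
      derivBound_phaseOp (by positivity) hρ hσ0 hP k2 k3 hs hr N
    have bC : DerivBound N (LC 0) s r (D N) (1 + σ) :=
      derivBound_phaseOp (by positivity) hρ hσ0 hP c2 c3 hs hr N
    exact DerivBound.smul_add_smul_add (E := BallFn ρ →L[ℝ] C(S, Spinor)) hs hr contDiff_energy hid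
      sE sK sC (hCE N s r _ hs hr hr' hw) (hCK N s r _ hs hr hr' hw) bE bK bC (hCE0 N) (hCK0 N)
      (hD0 N) (hD0 N) hw0

end PhaseOp

/-! ### The resolvent and its derivatives -/

/-- The derivatives of `g₂ + T₂ (1 - T)⁻¹ g₁`. -/
lemma exists_derivBound_resolvent (C D : ℕ → ℝ) (hC : ∀ n, 0 ≤ C n) (hD : ∀ n, 0 ≤ D n) (C₀ : ℝ)
    (hC₀ : 0 ≤ C₀) {v : ℝ} (hv : 1 ≤ v) (N : ℕ) :
    ∃ K, 0 ≤ K ∧ ∀ (X Z : Type) [NormedAddCommGroup X] [NormedSpace ℝ X] [CompleteSpace X]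
      [NormedAddCommGroup Z] [NormedSpace ℝ Z] (T : ℝ → X →L[ℝ] X) (T₂ : ℝ → X →L[ℝ] Z)
      (g₁ : ℝ → X) (g₂ : ℝ → Z) (s : Set ℝ) (r α w : ℝ), IsOpen s → r ∈ s →
      ContDiff ℝ ∞ T → ContDiff ℝ ∞ T₂ → ContDiff ℝ ∞ g₁ → ContDiff ℝ ∞ g₂ →
      (∀ t ∈ s, IsUnit (1 - T t)) → 1 ≤ α → 1 ≤ w → ‖Ring.inverse (1 - T r)‖ ≤ C₀ * α →
      (∀ n, DerivBound n T s r (C n) v) → (∀ n, DerivBound n T₂ s r (C n) w) →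
      (∀ n, DerivBound n g₁ s r (D n) v) → (∀ n, DerivBound n g₂ s r (D n) w) →
        ContDiffOn ℝ ∞ (fun t => g₂ t + T₂ t (Ring.inverse (1 - T t) (g₁ t))) s ∧
        DerivBound N (fun t => g₂ t + T₂ t (Ring.inverse (1 - T t) (g₁ t))) s r (K * α)
          (w * α) := by
  have hv0 : 0 ≤ v := zero_le_one.trans hv
  obtain ⟨K, hK, hinv⟩ := exists_derivBound_ringInverse (fun n => C (n + 1) * v ^ (n + 1))
    (fun n => by have := hC (n + 1); positivity) C₀ hC₀ N
  have hCN := hC N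
  have hDN := hD N
  refine ⟨D N + 2 ^ N * C N * (2 ^ N * K * (D N * v ^ N)), by positivity,
    fun X Z _ _ _ _ _ T T₂ g₁ g₂ s r α w hs hr hT hT₂ hg₁ hg₂ hu hα hw h0 bT bT₂ b₁ b₂ => ?_⟩
  have hα0 : 0 ≤ α := zero_le_one.trans hα
  have hw0 : 0 ≤ w := zero_le_one.trans hw
  have hwα : 1 ≤ w * α := one_le_mul_of_one_le_of_one_le hw hα
  have h1T : ContDiffOn ℝ ∞ (fun t => 1 - T t) s := (contDiff_const.sub hT).contDiffOn
  have hIc : ContDiffOn ℝ ∞ (fun t => Ring.inverse (1 - T t)) s := fun t ht => by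
    obtain ⟨x, hx⟩ := hu t ht
    exact ((hx ▸ contDiffAt_ringInverse ℝ x :
      ContDiffAt ℝ ∞ Ring.inverse (1 - T t)).comp_contDiffWithinAt t (h1T t ht))
  have bI := hinv (X →L[ℝ] X) (fun t => 1 - T t) s r α hs hr h1T hu hα h0 fun n i hi => by
    have e : derivWithin (fun t => 1 - T t) s = fun t => -derivWithin T s t := by
      funext t
      exact derivWithin_const_sub 1
    rw [e, iteratedDerivWithin_fun_neg, norm_neg]
    exact (bT (n + 1)).derivWithin (hC _) hv hα i hi
  -- All factors are brought to the common weight `w * α`: the inverse supplies `α`, the outer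
  -- factors `T₂` and `g₂` supply `w`, and the weight `v` of `g₁` becomes part of the constant.
  have bI' := bI.mono_right (by positivity) hα0 (le_mul_of_one_le_left hα0 hw)
  have b₁' := (b₁ N).change_weight hDN hv hwα
  have bu := DerivBound.clm_apply hs hr hIc hg₁.contDiffOn bI' b₁' (by positivity) (by positivity)
    (by positivity)
  have hcu : ContDiffOn ℝ ∞ (fun t => Ring.inverse (1 - T t) (g₁ t)) s :=
    hIc.clm_apply hg₁.contDiffOn
  have bT₂' := (bT₂ N).mono_right hCN hw0 (le_mul_of_one_le_right hw0 hα)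
  have bTu := DerivBound.clm_apply hs hr hT₂.contDiffOn hcu bT₂' bu hCN (by positivity)
    (by positivity)
  have b₂' := (b₂ N).mono_right hDN hw0 (le_mul_of_one_le_right hw0 hα)
  have hcT : ContDiffOn ℝ ∞ (fun t => T₂ t (Ring.inverse (1 - T t) (g₁ t))) s :=
    hT₂.contDiffOn.clm_apply hcu
  refine ⟨hg₂.contDiffOn.add hcT,
    (b₂'.add bTu hs hr hg₂.contDiffOn hcT).mono_left ?_ (by positivity)⟩
  have : D N ≤ D N * α := le_mul_of_one_le_right hDN hα
  linarith

/-- The a priori bound makes `1 - T` injective on the ball, and for compact `T` the Fredholm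
alternative then gives invertibility. The norm of the inverse is the same bound read backwards. -/
lemma isUnit_one_sub_of_apriori {ρ : ℝ} (hρ : 0 < ρ) {V : E3 → SpinorOp} (hV : IsPotential V)
    (hsupp : ∀ x, ρ < ‖x‖ → V x = 0) {k : ℝ} (hk : 0 ≤ k) (hk1 : k ≤ 1) {c : ℝ} (hc : 0 ≤ c)
    (hap : ∀ f : E3 → Spinor, Continuous f → ∀ M, (∀ x, ‖f x‖ ≤ M) → ∀ γ,
      (∀ x, ‖f x - opT V k f x‖ ≤ γ) → ∀ x, ‖f x‖ ≤ c * γ)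
    {T : BallFn ρ →L[ℝ] BallFn ρ} (hT : ∀ u x, T u x = opT V k (extend hρ u) x) :
    IsUnit (1 - T) ∧ ‖Ring.inverse (1 - T)‖ ≤ c := by
  have hb : ∀ u, ‖u‖ ≤ c * ‖(1 - T) u‖ := fun u => by
    obtain ⟨g, hg⟩ : ∃ g, g = (1 - T) u := ⟨_, rfl⟩
    rw [← hg]
    rw [ContinuousMap.norm_le _ (by positivity)]
    have hu := continuous_extend hρ u
    have hun : ∀ᵐ y, ‖extend hρ u y‖ ≤ ‖u‖ := Eventually.of_forall (norm_extend_le hρ u)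
    have hball : ∀ x (hx : ‖x‖ ≤ ρ), extend hρ g x + opT V k (extend hρ u) x =
        u ⟨x, mem_closedBall_zero_iff.mpr hx⟩ := fun x hx => by
      rw [extend_of_norm_le hρ g hx, hg, ← hT u ⟨x, mem_closedBall_zero_iff.mpr hx⟩]
      exact sub_add_cancel (u _) (T u _)
    have hop : opT V k (fun x => extend hρ g x + opT V k (extend hρ u) x) =
        opT V k (extend hρ u) := opT_congr hsupp k fun y hy => by
      rw [hball y hy, extend_of_norm_le hρ u hy]
    intro x
    have hx := mem_closedBall_zero_iff.mp x.2
    -- This function on `ℝ³` agrees with `u` on the ball, and its residual is exactly the extension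
    -- of `g = (1 - T) u`.
    have h := hap (fun x => extend hρ g x + opT V k (extend hρ u) x)
      ((continuous_extend hρ g).add (continuous_opT hV hsupp hk hk1 hu.aestronglyMeasurable hun))
      (‖g‖ + 8 * diracConst * ‖u‖ * (singConst * potNorm V))
      (fun x => norm_add_le_of_le (norm_extend_le hρ g x)
        (norm_opT_le hV hk hk1 (norm_nonneg _) hun x)) ‖g‖
      (fun x => by rw [hop, add_sub_cancel_right]; exact norm_extend_le hρ g x) x
    rwa [hball x hx] at h
  have hcomp : IsCompactOperator T :=
    isCompactOperator_kernelOp hρ hV hsupp (locallyIntegrable_green hk hk1) hT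
  have hunit : IsUnit (1 - T) := by
    rcases hcomp.hasEigenvalue_or_mem_resolventSet one_ne_zero with h | h
    · obtain ⟨u, hu⟩ := h.exists_hasEigenvector
      have h1 : T u = u := by simpa using hu.apply_eq_smul
      have h2 := hb u
      have h3 : (1 - T) u = 0 := sub_eq_zero.mpr h1.symm
      rw [h3, norm_zero, mul_zero] at h2
      exact absurd (norm_le_zero_iff.mp h2) hu.2
    · rw [spectrum.mem_resolventSet_iff] at h
      simpa using h
  refine ⟨hunit, ?_⟩
  obtain ⟨x, hx⟩ := hunit
  rw [← hx, Ring.inverse_unit]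
  refine ContinuousLinearMap.opNorm_le_bound _ hc fun u => ?_
  have h1 := hb ((↑x⁻¹ : BallFn ρ →L[ℝ] BallFn ρ) u)
  have h2 : (1 - T) ((↑x⁻¹ : BallFn ρ →L[ℝ] BallFn ρ) u) = u := by
    rw [← hx]
    exact congrArg (fun L : BallFn ρ →L[ℝ] BallFn ρ => L u) x.mul_inv
  rwa [h2] at h1

/-! ### The free eigenfunctions -/

/-- The `n`-th derivative in `r` of `e^{i r e·x} v` at the points `x = ι s`. -/
def phaseFn {S : Type} [TopologicalSpace S] (ι : C(S, E3)) (e : E3) (v : Spinor) (n : ℕ) (r : ℝ) :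
    C(S, Spinor) :=
  ⟨fun s => ((Complex.I * ((inner ℝ e (ι s) : ℝ) : ℂ)) ^ n *
    Complex.exp (Complex.I * ((r * inner ℝ e (ι s) : ℝ) : ℂ))) • v, by fun_prop⟩

lemma abs_inner_le_of_norm_eq_one {S : Type} [TopologicalSpace S] (ι : C(S, E3)) {σ : ℝ} {e : E3}
    (hσ : ∀ x, ‖ι x‖ ≤ σ) (he : ‖e‖ = 1) (s : S) :
    |inner ℝ e (ι s)| ≤ σ := by
  have h := abs_real_inner_le_norm e (ι s)
  rw [he, one_mul] at h
  exact h.trans (hσ s)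

section PhaseFn

variable {S : Type} [TopologicalSpace S] [CompactSpace S] (ι : C(S, E3)) {σ : ℝ} {e : E3}

lemma norm_phaseFn_le (hσ0 : 0 ≤ σ) (hσ : ∀ x, ‖ι x‖ ≤ σ) (he : ‖e‖ = 1) (v : Spinor) (n : ℕ)
    (r : ℝ) : ‖phaseFn ι e v n r‖ ≤ ‖v‖ * (1 + σ) ^ n := by
  rw [ContinuousMap.norm_le _ (by positivity)]
  intro s
  have h := abs_inner_le_of_norm_eq_one ι hσ he s
  change ‖((Complex.I * ((inner ℝ e (ι s) : ℝ) : ℂ)) ^ n *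
    Complex.exp (Complex.I * ((r * inner ℝ e (ι s) : ℝ) : ℂ))) • v‖ ≤ _
  rw [norm_smul, norm_mul, norm_phase, norm_pow, norm_mul, Complex.norm_I, Complex.norm_real,
    one_mul, mul_one, mul_comm, Real.norm_eq_abs]
  gcongr
  linarith

lemma hasDerivAt_phaseFn (hσ0 : 0 ≤ σ) (hσ : ∀ x, ‖ι x‖ ≤ σ) (he : ‖e‖ = 1) (v : Spinor) (n : ℕ)
    (r : ℝ) : HasDerivAt (phaseFn ι e v n) (phaseFn ι e v (n + 1) r) r := by
  refine hasDerivAt_of_norm_le_sq (C := 2 * σ ^ (n + 2) * ‖v‖) fun t => ?_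
  rw [ContinuousMap.norm_le _ (by positivity)]
  intro s
  have h := abs_inner_le_of_norm_eq_one ι hσ he s
  have h1 := norm_phase_taylor_le n (inner ℝ e (ι s)) r t
  refine (norm_smul_taylor _ _ (t : ℂ) _ v).trans_le ?_
  calc _ ≤ (2 * t ^ 2 * |inner ℝ e (ι s)| ^ (n + 2)) * ‖v‖ := by gcongr
    _ ≤ (2 * t ^ 2 * σ ^ (n + 2)) * ‖v‖ := by gcongr
    _ = _ := by ring

end PhaseFn

lemma energy_abs (k : ℝ) : energy |k| = energy k := by rw [energy, energy, sq_abs]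

/-- The free eigenfunctions are smooth in `k = |𝐤|`, with derivatives of polynomial growth. -/
lemma exists_smooth_chi : ∃ D : ℕ → ℝ, (∀ n, 0 ≤ D n) ∧ ∀ (j : Fin 2) (e : E3), ‖e‖ = 1 →
    ∀ (S : Type) [TopologicalSpace S] [CompactSpace S] (ι : C(S, E3)) (σ : ℝ), 0 ≤ σ →
      (∀ x, ‖ι x‖ ≤ σ) → ∃ g : ℝ → C(S, Spinor), ContDiff ℝ ∞ g ∧
        (∀ r x, g r x = chi j (r • e) (ι x)) ∧
        ∀ (N : ℕ) (s : Set ℝ) (r : ℝ), IsOpen s → r ∈ s → r ∈ Icc (0 : ℝ) 1 →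
          DerivBound N g s r (D N) (1 + σ) := by
  have hpos : ∀ r : ℝ, 0 < Real.sqrt (2 * energy r * (1 + energy r)) := fun r => by
    have := one_le_energy r
    positivity
  have hn : ContDiff ℝ ∞ fun r : ℝ => (Real.sqrt (2 * energy r * (1 + energy r)))⁻¹ := by
    refine ContDiff.inv (ContDiff.sqrt ?_ fun r => ?_) fun r => (hpos r).ne'
    · exact (contDiff_const.mul contDiff_energy).mul (contDiff_const.add contDiff_energy)
    · have := one_le_energy r
      positivity
  have h₁ : ContDiff ℝ ∞ fun r : ℝ =>
      (Real.sqrt (2 * energy r * (1 + energy r)))⁻¹ * (1 + energy r) :=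
    hn.mul (contDiff_const.add contDiff_energy)
  have h₂ : ContDiff ℝ ∞ fun r : ℝ => (Real.sqrt (2 * energy r * (1 + energy r)))⁻¹ * r :=
    hn.mul contDiff_id
  choose C₁ hC₁0 hC₁ using fun N => exists_derivBound_of_contDiff h₁ N
  choose C₂ hC₂0 hC₂ using fun N => exists_derivBound_of_contDiff h₂ N
  have hdc := diracConst_pos
  refine ⟨fun N => 2 ^ N * C₁ N * 1 + 2 ^ N * C₂ N * diracConst, fun N => by
    have := hC₁0 N; have := hC₂0 N; positivity, fun j e he S _ _ ι σ hσ0 hσ => ?_⟩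
  obtain ⟨v, hv⟩ : ∃ v : Spinor,
    v = EuclideanSpace.single (Fin.castLE (by norm_num) j) (1 : ℂ) := ⟨_, rfl⟩
  have hv1 : ‖v‖ = 1 := by rw [hv]; simp
  have hw1 : ‖alphaDot e v‖ ≤ diracConst := by
    calc _ ≤ ‖alphaDot e‖ * ‖v‖ := (alphaDot e).le_opNorm v
      _ ≤ diracConst * ‖e‖ * 1 := by
          rw [hv1]; exact mul_le_mul_of_nonneg_right (norm_alphaDot_le e) zero_le_one
      _ = diracConst := by rw [he]; ring
  have d1 := hasDerivAt_phaseFn ι hσ0 hσ he v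
  have d2 := hasDerivAt_phaseFn ι hσ0 hσ he (alphaDot e v)
  have s1 := contDiff_of_hasDerivAt_seq d1
  have s2 := contDiff_of_hasDerivAt_seq d2
  refine ⟨fun r => ((Real.sqrt (2 * energy r * (1 + energy r)))⁻¹ * (1 + energy r)) •
      phaseFn ι e v 0 r + ((Real.sqrt (2 * energy r * (1 + energy r)))⁻¹ * r) •
      phaseFn ι e (alphaDot e v) 0 r, (h₁.smul s1).add (h₂.smul s2), fun r x => ?_,
    fun N s r hs hr hr' => ?_⟩
  · have hE : energy ‖r • e‖ = energy r := by
      rw [norm_smul, he, mul_one, Real.norm_eq_abs, energy_abs]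
    rw [chi, freeSpinor, hE, ← hv, alphaDot_smul, inner_smul_left]
    simp only [phaseFn, ContinuousMap.add_apply, ContinuousMap.smul_apply, ContinuousMap.coe_mk,
      pow_zero, one_mul, smul_apply, RCLike.conj_to_real]
    simp only [← Complex.coe_smul]
    push_cast
    module
  · have hw : 1 ≤ 1 + σ := by linarith
    have hw0 : 0 ≤ 1 + σ := by linarith
    have b1 : DerivBound N (phaseFn ι e v 0) s r 1 (1 + σ) :=
      derivBound_of_hasDerivAt_seq d1 hs hr fun n _ => by
        have := norm_phaseFn_le ι hσ0 hσ he v n r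
        rwa [hv1] at this
    have b2 : DerivBound N (phaseFn ι e (alphaDot e v) 0) s r diracConst (1 + σ) :=
      derivBound_of_hasDerivAt_seq d2 hs hr fun n _ =>
        (norm_phaseFn_le ι hσ0 hσ he _ n r).trans (by gcongr)
    have m1 := DerivBound.smul hs hr h₁.contDiffOn s1.contDiffOn (hC₁ N s r _ hs hr hr' hw) b1
      (hC₁0 N) zero_le_one hw0
    have m2 := DerivBound.smul hs hr h₂.contDiffOn s2.contDiffOn (hC₂ N s r _ hs hr hr' hw) b2
      (hC₂0 N) hdc.le hw0
    exact m1.add m2 hs hr (h₁.smul s1).contDiffOn (h₂.smul s2).contDiffOn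

/-! ### The generalized eigenfunctions -/

lemma continuous_chi (j : Fin 2) (k : E3) : Continuous (chi j k) := by
  unfold chi
  fun_prop

lemma norm_chi (j : Fin 2) (k x : E3) : ‖chi j k x‖ = ‖freeSpinor j k‖ := by
  rw [chi, norm_smul, norm_phase, one_mul]

/-- The equation itself continues `u`: its right-hand side `χ + T u` needs `u` only on the ball. -/
lemma isGenEigenfunction_of_ball {ρ : ℝ} (hρ : 0 < ρ) {V : E3 → SpinorOp} (hV : IsPotential V)
    (hsupp : ∀ x, ρ < ‖x‖ → V x = 0) {j : Fin 2} {k : E3} (hk1 : ‖k‖ ≤ 1) {u : BallFn ρ}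
    (hu : ∀ x : Metric.closedBall (0 : E3) ρ, u x - opT V ‖k‖ (extend hρ u) x = chi j k x) :
    IsGenEigenfunction V j k fun x => chi j k x + opT V ‖k‖ (extend hρ u) x := by
  have hk := norm_nonneg k
  have hc := continuous_extend hρ u
  have hb : ∀ᵐ y, ‖extend hρ u y‖ ≤ ‖u‖ := Eventually.of_forall (norm_extend_le hρ u)
  refine ⟨memLp_top_of_continuous ((continuous_chi j k).add
    (continuous_opT hV hsupp hk hk1 hc.aestronglyMeasurable hb))
    fun x => norm_add_le_of_le (norm_chi j k x).le
      (norm_opT_le hV hk hk1 (norm_nonneg u) hb x), fun x => ?_⟩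
  have h : opT V ‖k‖ (fun x => chi j k x + opT V ‖k‖ (extend hρ u) x) =
      opT V ‖k‖ (extend hρ u) := opT_congr hsupp _ fun y hy => by
    rw [extend_of_norm_le hρ u hy, ← hu ⟨y, mem_closedBall_zero_iff.mpr hy⟩, sub_add_cancel]
  rw [h, add_sub_cancel_right]

lemma IsGenEigenfunction.continuous {V : E3 → SpinorOp} (hV : IsPotential V) {ρ : ℝ}
    (hsupp : ∀ x, ρ < ‖x‖ → V x = 0) {j : Fin 2} {k : E3} (hk1 : ‖k‖ ≤ 1) {ψ : E3 → Spinor}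
    (h : IsGenEigenfunction V j k ψ) : Continuous ψ := by
  have e : ψ = fun x => chi j k x + opT V ‖k‖ ψ x :=
    funext fun x => by rw [← h.2 x, sub_add_cancel]
  rw [e]
  exact (continuous_chi j k).add (continuous_opT hV hsupp (norm_nonneg k) hk1 h.1.1
    (ae_norm_le_normInf h.1))

/-- Every `L^∞` solution is continuous, so the a priori bound applies to a difference of two, with
residual `γ = 0`. -/
lemma IsGenEigenfunction.unique {V : E3 → SpinorOp} (hV : IsPotential V) {ρ : ℝ}
    (hsupp : ∀ x, ρ < ‖x‖ → V x = 0) {j : Fin 2} {k : E3} (hk1 : ‖k‖ ≤ 1) {c : ℝ}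
    (hap : ∀ f : E3 → Spinor, Continuous f → ∀ M, (∀ x, ‖f x‖ ≤ M) → ∀ γ,
      (∀ x, ‖f x - opT V ‖k‖ f x‖ ≤ γ) → ∀ x, ‖f x‖ ≤ c * γ) {φ ψ : E3 → Spinor}
    (hφ : IsGenEigenfunction V j k φ) (hψ : IsGenEigenfunction V j k ψ) : ψ = φ := by
  have cφ := hφ.continuous hV hsupp hk1
  have cψ := hψ.continuous hV hsupp hk1
  funext x
  have h := hap (fun y => ψ y - φ y) (cψ.sub cφ) (normInf ψ + normInf φ)
    (fun y => (norm_sub_le _ _).trans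
      (add_le_add (norm_le_normInf hψ.1 cψ y) (norm_le_normInf hφ.1 cφ y))) 0 (fun y => by
      rw [opT_sub hV (norm_nonneg k) hk1 hψ.1.1 (ae_norm_le_normInf hψ.1) hφ.1.1
        (ae_norm_le_normInf hφ.1), sub_sub_sub_comm, hψ.2 y, hφ.2 y, sub_self, norm_zero]) x
  rw [mul_zero] at h
  exact sub_eq_zero.mp (norm_le_zero_iff.mp h)

lemma one_le_alphaOne (A B : E3 → SpinorOp) {k : ℝ} (hk : 0 ≤ k) : 1 ≤ alphaOne A B k :=
  le_add_of_nonneg_right (inv_nonneg.mpr (add_nonneg (pairingInf_nonneg A B) hk))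

end DiracScattering

end

/-! ### Construction of the eigenfunctions and proof of the theorem -/

open DiracScattering

theorem theorem6p2 (A : DiracScattering.E3 → DiracScattering.SpinorOp)
    (hA : DiracScattering.ClassC A) (hsupp : HasCompactSupport A)
    (hlam : DiracScattering.LamBarOne A) :
    ∃ K > (0 : ℝ), ∃ k₀ > (0 : ℝ), ∀ R : ℝ, ∃ C : ℕ → ℝ,
      ∀ B ∈ DiracScattering.setW A K, (∀ x, R < ‖x‖ → B x = 0) → ∀ j : Fin 2,
        ∃ φ : DiracScattering.E3 → DiracScattering.E3 → DiracScattering.Spinor,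
          (∀ k : DiracScattering.E3, 0 < ‖k‖ → ‖k‖ < k₀ →
            DiracScattering.IsGenEigenfunction (fun x => A x + B x) j k (φ k) ∧
            ∀ ψ, DiracScattering.IsGenEigenfunction (fun x => A x + B x) j k ψ → ψ = φ k) ∧
          ∀ e : DiracScattering.E3, ‖e‖ = 1 →
            (∀ x, ContDiffOn ℝ ∞ (fun r : ℝ => φ (r • e) x) (Set.Ioo 0 k₀)) ∧
            ∀ (m : ℕ) (k : ℝ), 0 < k → k < k₀ → ∀ x,
              ((1 + ‖x‖) ^ m)⁻¹ * ‖iteratedDeriv m (fun r : ℝ => φ (r • e) x) k‖ ≤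
                C m * ((k ^ m)⁻¹ + DiracScattering.alphaOne A B k ^ (m + 1)) := by
  obtain ⟨ρA, hρA, hAsupp⟩ : ∃ ρ > 0, ∀ x, ρ < ‖x‖ → A x = 0 := by
    obtain ⟨ρ, hρ0, hρ⟩ := hsupp.isBounded.exists_pos_norm_le
    exact ⟨ρ, hρ0, fun x hx => image_eq_zero_of_notMem_tsupport fun h =>
      absurd (hρ x h) (not_le.mpr hx)⟩
  obtain ⟨δ, hδ, hδ1, c, hc, hap⟩ := exists_apriori_bound hA.potential hρA hAsupp hA.critical hlam
  -- One `δ` serves as `K` and as `k₀`, chosen before `R`; the radius enters only the constants of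
  -- the derivative bounds.
  refine ⟨δ, hδ, δ, hδ, fun R => ?_⟩
  obtain ⟨ρ, hρA', hR⟩ : ∃ ρ, ρA ≤ ρ ∧ R ≤ ρ := ⟨max ρA R, le_max_left _ _, le_max_right _ _⟩
  have hρ : 0 < ρ := hρA.trans_le hρA'
  obtain ⟨CT, hCT0, hCT⟩ := exists_smooth_opT hρ (potNorm A + 1)
    (by have := potNorm_nonneg A; positivity)
  obtain ⟨D, hD0, hD⟩ := exists_smooth_chi
  choose K hK0 hK using fun m => exists_derivBound_resolvent CT D hCT0 hD0 c hc.le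
    (v := 1 + ρ) (by linarith) m
  refine ⟨K, fun B hB hBsupp j => ?_⟩
  obtain ⟨V, hVdef⟩ : ∃ V, V = fun x => A x + B x := ⟨_, rfl⟩
  have hV : IsPotential V := hVdef ▸ hA.potential.add hB.1
  have hVsupp : ∀ x, ρ < ‖x‖ → V x = 0 := fun x hx => by
    rw [hVdef]
    change A x + B x = 0
    rw [hAsupp x (hρA'.trans_lt hx), hBsupp x (hR.trans_lt hx), add_zero]
  have hVP : potNorm V ≤ potNorm A + 1 := by
    have h1 := potNorm_add_le hA.potential hB.1
    have h2 := potNorm_le_of_mem_setW hA.potential hAsupp hA.critical hδ.le hB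
    rw [hVdef]
    linarith
  have hapV := hap B hB R hBsupp
  rw [← hVdef] at hapV ⊢
  obtain ⟨ι, hι⟩ : ∃ ι : C(Metric.closedBall (0 : E3) ρ, E3), ∀ x, ι x = x :=
    ⟨⟨Subtype.val, continuous_subtype_val⟩, fun _ => rfl⟩
  have hιρ : ∀ x, ‖ι x‖ ≤ ρ := fun x => by
    rw [hι]; exact mem_closedBall_zero_iff.mp x.2
  obtain ⟨T, hTs, hT, hTb⟩ := hCT V hV hVsupp hVP _ ι ρ hρ.le hιρ
  have hT' : ∀ k u x, T k u x = opT V k (extend hρ u) x := fun k u x => by rw [hT, hι]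
  have hres : ∀ k, 0 < k → k < δ → IsUnit (1 - T k) ∧
      ‖Ring.inverse (1 - T k)‖ ≤ c * alphaOne A B k := fun k hk hkδ =>
    isUnit_one_sub_of_apriori hρ hV hVsupp hk.le (hkδ.le.trans hδ1)
      (mul_nonneg hc.le (zero_le_one.trans (one_le_alphaOne A B hk.le))) (hapV k hk hkδ) (hT' k)
  -- `Ring.inverse` makes this a total function of `k`; it is the true inverse for `0 < ‖k‖ < δ`.
  obtain ⟨u, hu⟩ : ∃ u : E3 → BallFn ρ,
      ∀ k, u k = Ring.inverse (1 - T ‖k‖) (restrictBall ρ (continuous_chi j k)) :=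
    ⟨_, fun _ => rfl⟩
  refine ⟨fun k x => chi j k x + opT V ‖k‖ (extend hρ (u k)) x, fun k hk hkδ => ?_,
    fun e he => ?_⟩
  · have hk1 : ‖k‖ ≤ 1 := hkδ.le.trans hδ1
    have hsol : IsGenEigenfunction V j k fun x => chi j k x + opT V ‖k‖ (extend hρ (u k)) x := by
      refine isGenEigenfunction_of_ball hρ hV hVsupp hk1 fun x => ?_
      have h1 : (1 - T ‖k‖) (u k) = restrictBall ρ (continuous_chi j k) := by
        rw [hu]
        exact congrArg (fun L : BallFn ρ →L[ℝ] BallFn ρ => L (restrictBall ρ (continuous_chi j k)))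
          (Ring.mul_inverse_cancel _ (hres _ hk hkδ).1)
      rw [← hT']
      exact congrArg (fun f : BallFn ρ => f x) h1
    exact ⟨hsol, fun ψ hψ => hsol.unique hV hVsupp hk1 (hapV _ hk hkδ) hψ⟩
  · obtain ⟨g₁, hg₁s, hg₁, hg₁b⟩ := hD j e he _ ι ρ hρ.le hιρ
    have key : ∀ (m : ℕ) (x : E3) (k : ℝ), k ∈ Ioo 0 δ →
        ContDiffOn ℝ ∞ (fun r : ℝ => chi j (r • e) x +
          opT V ‖r • e‖ (extend hρ (u (r • e))) x) (Ioo 0 δ) ∧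
        DerivBound m (fun r : ℝ => chi j (r • e) x +
          opT V ‖r • e‖ (extend hρ (u (r • e))) x) (Ioo 0 δ) k (K m * alphaOne A B k)
          ((1 + ‖x‖) * alphaOne A B k) := by
      intro m x k hk
      -- The target is the single point `x`. The constants from `hCT`, `hD` and `hK` do not depend
      -- on it, so `x` enters the bound only through the weight `1 + ‖x‖`.
      obtain ⟨ι₂, hι₂⟩ : ∃ ι₂ : C(PUnit.{1}, E3), ∀ y, ι₂ y = x :=
        ⟨ContinuousMap.const _ x, fun _ => rfl⟩
      have hι₂' : ∀ y, ‖ι₂ y‖ ≤ ‖x‖ := fun y => by rw [hι₂]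
      obtain ⟨T₂, hT₂s, hT₂, hT₂b⟩ := hCT V hV hVsupp hVP _ ι₂ ‖x‖ (norm_nonneg x) hι₂'
      obtain ⟨g₂, hg₂s, hg₂, hg₂b⟩ := hD j e he _ ι₂ ‖x‖ (norm_nonneg x) hι₂'
      have hk' : k ∈ Icc (0 : ℝ) 1 := ⟨hk.1.le, hk.2.le.trans hδ1⟩
      obtain ⟨h1, h2⟩ := hK m (BallFn ρ) C(PUnit.{1}, Spinor) T T₂ g₁ g₂ (Ioo 0 δ) k
        (alphaOne A B k) (1 + ‖x‖) isOpen_Ioo hk hTs hT₂s hg₁s hg₂s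
        (fun t ht => (hres t ht.1 ht.2).1) (one_le_alphaOne A B hk.1.le)
        (by have := norm_nonneg x; linarith) (hres k hk.1 hk.2).2
        (fun n => hTb n _ k isOpen_Ioo hk hk') (fun n => hT₂b n _ k isOpen_Ioo hk hk')
        (fun n => hg₁b n _ k isOpen_Ioo hk hk') (fun n => hg₂b n _ k isOpen_Ioo hk hk')
      obtain ⟨ev, hev, hev1⟩ : ∃ ev : C(PUnit.{1}, Spinor) →L[ℝ] Spinor,
          (∀ f, ev f = f PUnit.unit) ∧ ‖ev‖ ≤ 1 :=
        ⟨ContinuousMap.evalCLM ℝ PUnit.unit, fun _ => rfl,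
          ContinuousLinearMap.opNorm_le_bound _ zero_le_one fun f => by
            rw [one_mul]; exact f.norm_coe_le_norm _⟩
      have heq : EqOn (fun r => ev (g₂ r + T₂ r (Ring.inverse (1 - T r) (g₁ r))))
          (fun r : ℝ => chi j (r • e) x + opT V ‖r • e‖ (extend hρ (u (r • e))) x)
          (Ioo 0 δ) := by
        intro r hr
        have hr' : ‖r • e‖ = r := by
          rw [norm_smul, he, mul_one, Real.norm_of_nonneg hr.1.le]
        have hg : restrictBall ρ (continuous_chi j (r • e)) = g₁ r := by
          ext1 y
          rw [hg₁, hι]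
          rfl
        change ev (g₂ r + T₂ r (Ring.inverse (1 - T r) (g₁ r))) =
          chi j (r • e) x + opT V ‖r • e‖ (extend hρ (u (r • e))) x
        rw [hev, ContinuousMap.add_apply, hg₂, hT₂, hι₂, hu, hg, hr']
      exact ⟨(ev.contDiff.comp_contDiffOn h1).congr fun r hr => (heq hr).symm,
        (DerivBound.comp_left ev hev1 isOpen_Ioo hk h1 h2).congr hk heq⟩
    refine ⟨fun x => (key 0 x (δ / 2) ⟨half_pos hδ, half_lt_self hδ⟩).1, fun m k hk hkδ x => ?_⟩
    have h := (key m x k ⟨hk, hkδ⟩).2 m le_rfl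
    rw [iteratedDerivWithin_of_isOpen isOpen_Ioo ⟨hk, hkδ⟩] at h
    have hx : 0 < (1 + ‖x‖) ^ m := by positivity
    have hα : 0 ≤ alphaOne A B k := zero_le_one.trans (one_le_alphaOne A B hk.le)
    have hKm := hK0 m
    rw [inv_mul_le_iff₀ hx]
    refine h.trans ?_
    -- The estimate obtained has only the term `α ^ (m + 1)`; the `0` is then enlarged to `(k ^
    -- m)⁻¹`.
    calc K m * alphaOne A B k * ((1 + ‖x‖) * alphaOne A B k) ^ m
        = (1 + ‖x‖) ^ m * (K m * (0 + alphaOne A B k ^ (m + 1))) := by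
          rw [mul_pow]; ring
      _ ≤ _ := by gcongr; positivity
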